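/- **Setting.** Let $\mu$ be a Lévy measure on $\mathbb R$ (so $\mu(\{0\})=0$ and $\int(1\wedge u^2)\,\mu(du)<\infty$) such that $\mu((0,\infty))>0$ and $\int_{|y|\ge1}e^{Cy}\mu(dy)<\infty$ for every $C\in\mathbb R$. Let $I\subset\mathbb R$ be an interval (for example $\mathbb R$ or $[0,\infty)$), and let $(Z_s)_{s\in I}$ be a process with independent increments such that, for $s\le t$ in $I$, $E e^{iz(Z_t-Z_s)}=e^{(t-s)\psi(z)}$ with $\psi(z)=\int_{\mathbb R}(e^{iuz}-1-izu)\,\mu(du)$, i.e. a centered Lévy process without diffusion part (two-sided if $I=\mathbb R$). Let $f:\mathbb R\to[0,\infty)$ be measurable and bounded with $\int f^2\,ds<\infty$ and $\int (f\vee0)^2ds>0$, and put $F=\operatorname{ess\,sup} f$. Let $\mathbb T\subset\mathbb R$, and let $\theta,\chi:\mathbb T\to(0,\infty)$ be bounded away from $0$ on $\mathbb T$ and bounded on $\mathbb T\cap[a,b]$ for every $[a,b]\subset(0,\infty)$, with $$\theta(t)\to+\infty,\qquad \ln\big((\ln\chi(t))\vee1\big)=o(\ln\theta(t)),\qquad t\to+\infty,\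 t\in\mathbb T.$$ Put $\tau(t)=\chi(t)\theta(t)$ and suppose that for $t\in\mathbb T$ $$Y_t=\int_I f(t,s)\,dZ_s,\qquad f(t,s)=\chi(t)f\big(s/\theta(t)\big),$$ where $f(t,s)=0$ for $s\notin I$. The integral is the limit in probability of the integrals of step functions (with nodes in $I$) that converge to $f(t,\cdot)$ in $L^2(I)$. Let $\mu_+$ be the restriction of $\mu$ to $(0,\infty)$. Suppose that for some $i\in\{1,2,3,4\}$ the conditions $(N_i)$ and $(F_i)$ hold, and if $i=1$ also $(C)$, where * $(N_1)$: $\ln|z|=o\big(\int_{|u|\le1/|z|}(uz)^2\mu_+(du)\big)$ as $|z|\to\infty$; $(N_2)$: $\ln|z|=o\big(\int((uz)^2\wedge1)\,\mu_+(du)\big)$ as $|z|\to\infty$; $(N_3)$: $\mu((0,\infty))=\infty$; $(N_4)$: $\mu((0,\infty))>0$; * $(F_1)$: $\int (f\vee0)^2ds>0$; $(F_2)$: on some interval $[a,b]$, $a<b$, $f$ is positive and has a continuous non-zero derivative; $(F_3)$: on some $(-\infty,b]$, $f$ is positive and convex and $\lim_{s\to-\infty}e^{-\gamma s}f(s)=+\infty$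 for some $\gamma>0$; $(F_4)$: on some $(-\infty,b)$, $f$ is positive and convex and $\lim_{s\to-\infty}e^{-\gamma s}f(s)=+\infty$ for every $\gamma>0$; * $(C)$: for some $\rho>0$ the (finite) restriction $\varkappa$ of $\mu$ to $[\rho,\infty)$ satisfies $\sup_{|z|\ge\varepsilon}\big|\int e^{iyz}\varkappa(dy)\big|<\varkappa(\mathbb R)$ for all $\varepsilon>0$. **Theorem.** For every $t\in\mathbb T$ the law of $Y_t$ has a density $p_t\in C_b^\infty(\mathbb R)$, and the following holds for every $t_0>0$. 1. Suppose $\mu$ is truncated, i.e. supported in a bounded set, and let $\sigma_+$ be the minimal $\sigma>0$ with $\mu((\sigma,\infty))=0$. Then for any constants $c_1>1/(\sigma_+F)$ and $c_2<1/(\sigma_+F)$ there is $y=y(c_1,c_2)$ such that for all $t\in\mathbb T$, $t\ge t_0$, and all $x$ with $x/\tau(t)>y$, $$\exp\Big(-c_1\frac{x}{\chi(t)}\ln\frac{x}{\tau(t)}\Big)\le p_t(x)\le\exp\Big(-c_2\frac{x}{\chi(t)}\ln\frac{x}{\tau(t)}\Big).$$ 2. Suppose $\mu$ is exponentially damped: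 for some $b>0$, $\beta>1$ and a polynomial $Q$ (positive for large arguments), $\frac1{Q(u)}e^{-bu^\beta}\le\mu([u,\infty))\le Q(u)e^{-bu^\beta}$ for all $u$ large enough. Then for any constants $$c_2<\Big(\beta^{-\frac1{\beta-1}}-\beta^{-\frac{\beta}{\beta-1}}\Big)^{-\frac{\beta-1}{\beta}}\,b^{\frac1\beta}\,F^{-1}<c_1$$ there is $y=y(c_1,c_2)$ such that for all $t\in\mathbb T$, $t\ge t_0$, and all $x$ with $x/\tau(t)>y$, $$\exp\Big(-c_1\frac{x}{\chi(t)}\Big(\ln\frac{x}{\tau(t)}\Big)^{\frac{\beta-1}{\beta}}\Big)\le p_t(x)\le\exp\Big(-c_2\frac{x}{\chi(t)}\Big(\ln\frac{x}{\tau(t)}\Big)^{\frac{\beta-1}{\beta}}\Big).$$ The number $y$ may depend on the data $\mu,f,\theta,\chi,\mathbb T,t_0$, but not on $t$ and $x$. -/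

import Mathlib

open MeasureTheory ProbabilityTheory Filter Topology Set

noncomputable section

namespace LevyDensity

/-! ### Lévy measures and Lévy processes -/

/-- `μ` is a Lévy measure on `ℝ`: it does not charge `0` and `∫ (1 ∧ u²) μ(du) < ∞`. -/
def IsLevyMeasure (μ : Measure ℝ) : Prop :=
  μ {0} = 0 ∧ ∫⁻ u, ENNReal.ofReal (min 1 (u ^ 2)) ∂μ < ⊤

/-- Exponential integrability: `∫_{|y| ≥ 1} e^{C y} μ(dy) < ∞` for all real `C`. -/
def ExpIntegrable (μ : Measure ℝ) : Prop :=
  ∀ C : ℝ, IntegrableOn (fun y : ℝ => Real.exp (C * y)) {y : ℝ | 1 ≤ |y|} μ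

/-- The characteristic exponent `ψ(z) = ∫ (e^{iuz} - 1 - izu) μ(du)` of a centered Lévy process
without diffusion part. -/
def levyExponent (μ : Measure ℝ) (z : ℝ) : ℂ :=
  ∫ u : ℝ, (Complex.exp (Complex.I * (u : ℂ) * (z : ℂ)) - 1
    - Complex.I * (z : ℂ) * (u : ℂ)) ∂μ

/-- `Z`, indexed by a set `I` of times, is a (centered, purely discontinuous) Lévy process with
Lévy measure `μ`: its increments over disjoint intervals are independent, and `Z_t - Z_s`, `s ≤ t`,
has the characteristic function `exp ((t - s) ψ(z))`. For `I = ℝ` this is a two-sided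
Lévy process. -/
structure IsLevyProcess {Ω : Type*} [MeasurableSpace Ω] (P : Measure Ω) (μ : Measure ℝ)
    (I : Set ℝ) (Z : I → Ω → ℝ) : Prop where
  measurable : ∀ t : I, Measurable (Z t)
  indep : HasIndepIncrements Z P
  charFun_increment : ∀ s t : I, s ≤ t → ∀ z : ℝ,
    charFun (P.map (fun ω => Z t ω - Z s ω)) z
      = Complex.exp ((((t : ℝ) - (s : ℝ) : ℝ) : ℂ) * levyExponent μ z)

/-! ### Integrals of deterministic kernels -/

/-- A step kernel on `I`: the function equal to `coeff i` on `(node i, node (i+1)]` and to `0`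
elsewhere, for finitely many nodes `node 0 ≤ node 1 ≤ … ≤ node n` in `I`. -/
structure StepKernel (I : Set ℝ) where
  n : ℕ
  node : Fin (n + 1) → I
  mono : Monotone node
  coeff : Fin n → ℝ

/-- The step kernel as a function on `ℝ`. -/
def StepKernel.toFun {I : Set ℝ} (S : StepKernel I) (s : ℝ) : ℝ :=
  ∑ i : Fin S.n,
    (Ioc (S.node i.castSucc : ℝ) (S.node i.succ : ℝ)).indicator (fun _ => S.coeff i) s

/-- The elementary integral `∑ i, coeff i * (Z (node (i+1)) - Z (node i))` of a step kernel. -/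
def StepKernel.integral {I : Set ℝ} (S : StepKernel I) {Ω : Type*} (Z : I → Ω → ℝ) (ω : Ω) : ℝ :=
  ∑ i : Fin S.n, S.coeff i * (Z (S.node i.succ) ω - Z (S.node i.castSucc) ω)

/-- `Y = ∫_I g(s) dZ_s`: the integral of the deterministic square integrable kernel `g` against
the (square integrable, centered) process `Z`, i.e. the limit in probability of the elementary
integrals of step kernels that converge to `g` in `L²(I)`. -/
def IsLevyIntegral {Ω : Type*} [MeasurableSpace Ω] (P : Measure Ω) (I : Set ℝ)
    (Z : I → Ω → ℝ) (g : ℝ → ℝ) (Y : Ω → ℝ) : Prop :=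
  AEMeasurable Y P ∧ ∃ S : ℕ → StepKernel I,
    Tendsto (fun k => eLpNorm (fun s => (S k).toFun s - g s) 2 (volume.restrict I))
      atTop (𝓝 0) ∧
    TendstoInMeasure P (fun k => (S k).integral Z) atTop Y

/-- `p` is a probability density of the law `ν`, of class `C_b^∞`: smooth, and bounded together
with all its derivatives. -/
structure IsSmoothDensity (ν : Measure ℝ) (p : ℝ → ℝ) : Prop where
  nonneg : ∀ x, 0 ≤ p x
  smooth : ContDiff ℝ (⊤ : ℕ∞) p
  bounded : ∀ k : ℕ, ∃ C : ℝ, ∀ x, |iteratedDeriv k p x| ≤ C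
  density : ν = volume.withDensity (fun x => ENNReal.ofReal (p x))

/-! ### Conditions on the Lévy measure -/

/-- The Kallenberg condition: `∫_{|u| ≤ 1/|z|} (uz)² ν(du) ≫ ln |z|` as `|z| → ∞`. -/
def Kallenberg (ν : Measure ℝ) : Prop :=
  (fun z : ℝ => Real.log |z|) =o[Bornology.cobounded ℝ]
    (fun z : ℝ => ∫ u in {u : ℝ | |u| ≤ |z|⁻¹}, (u * z) ^ 2 ∂ν)

/-- The weaker condition `∫ ((uz)² ∧ 1) ν(du) ≫ ln |z|` as `|z| → ∞`. -/
def WeakKallenberg (ν : Measure ℝ) : Prop :=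
  (fun z : ℝ => Real.log |z|) =o[Bornology.cobounded ℝ]
    (fun z : ℝ => ∫ u : ℝ, min ((u * z) ^ 2) 1 ∂ν)

/-- Cramér's condition for a finite measure `ϰ`:
`sup_{|z| ≥ ε} |∫ e^{iyz} ϰ(dy)| < ϰ(ℝ)` for all `ε > 0`. -/
def Cramer (ϰ : Measure ℝ) : Prop :=
  IsFiniteMeasure ϰ ∧
    ∀ ε : ℝ, 0 < ε → (⨆ z : {z : ℝ // ε ≤ |z|}, ‖charFun ϰ (z : ℝ)‖) < ϰ.real univ

/-- The restriction of `μ` to the positive half-line satisfies the Kallenberg condition. -/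
def CondN1 (μ : Measure ℝ) : Prop := Kallenberg (μ.restrict (Ioi 0))

/-- The restriction of `μ` to the positive half-line satisfies `WeakKallenberg`. -/
def CondN2 (μ : Measure ℝ) : Prop := WeakKallenberg (μ.restrict (Ioi 0))

/-- `μ` has infinite mass on the positive half-line. -/
def CondN3 (μ : Measure ℝ) : Prop := μ (Ioi 0) = ⊤

/-- `μ` has positive mass on the positive half-line. -/
def CondN4 (μ : Measure ℝ) : Prop := 0 < μ (Ioi 0)

/-- For some `ρ > 0` the restriction of `μ` to `[ρ, ∞)` satisfies Cramér's condition. -/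
def CondC (μ : Measure ℝ) : Prop := ∃ ρ : ℝ, 0 < ρ ∧ Cramer (μ.restrict (Ici ρ))

/-- `μ` is truncated: supported in a bounded set. -/
def Truncated (μ : Measure ℝ) : Prop := ∃ R : ℝ, μ {u : ℝ | R < |u|} = 0

/-- `σ₊`: the minimal positive `σ` with `μ((σ, ∞)) = 0`. -/
def sigmaPlus (μ : Measure ℝ) : ℝ := sInf {σ : ℝ | 0 < σ ∧ μ (Ioi σ) = 0}

/-- `μ` is exponentially damped with parameters `b`, `β`: for some polynomial `Q` and all `u`
large enough, `e^{-b u^β} / Q(u) ≤ μ([u, ∞)) ≤ Q(u) e^{-b u^β}`. The positivity of `Q(u)` only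
excludes the zero polynomial, for which the division would be meaningless. -/
def ExponentiallyDamped (μ : Measure ℝ) (b β : ℝ) : Prop :=
  0 < b ∧ 1 < β ∧ ∃ Q : Polynomial ℝ, ∀ᶠ u : ℝ in atTop,
    0 < Q.eval u ∧
    ENNReal.ofReal (1 / Q.eval u * Real.exp (-b * u ^ β)) ≤ μ (Ici u) ∧
    μ (Ici u) ≤ ENNReal.ofReal (Q.eval u * Real.exp (-b * u ^ β))

/-! ### Conditions on the kernel -/

/-- `∫ (f ∨ 0)² ds > 0`. -/
def CondF1 (f : ℝ → ℝ) : Prop := 0 < ∫ s : ℝ, (max (f s) 0) ^ 2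

/-- On some interval `[a, b]`, `f` is positive and has a continuous non-zero derivative. -/
def CondF2 (f : ℝ → ℝ) : Prop :=
  ∃ a b : ℝ, a < b ∧ (∀ s ∈ Icc a b, 0 < f s) ∧
    ∃ f' : ℝ → ℝ, ContinuousOn f' (Icc a b) ∧
      ∀ s ∈ Icc a b, HasDerivWithinAt f (f' s) (Icc a b) s ∧ f' s ≠ 0

/-- On some `(-∞, b]`, `f` is positive, convex, and decays at most exponentially at `-∞`. -/
def CondF3 (f : ℝ → ℝ) : Prop :=
  ∃ b : ℝ, (∀ s ∈ Iic b, 0 < f s) ∧ ConvexOn ℝ (Iic b) f ∧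
    ∃ γ : ℝ, 0 < γ ∧ Tendsto (fun s => Real.exp (-γ * s) * f s) atBot atTop

/-- On some `(-∞, b)`, `f` is positive, convex, and decays subexponentially at `-∞`. -/
def CondF4 (f : ℝ → ℝ) : Prop :=
  ∃ b : ℝ, (∀ s ∈ Iio b, 0 < f s) ∧ ConvexOn ℝ (Iio b) f ∧
    ∀ γ : ℝ, 0 < γ → Tendsto (fun s => Real.exp (-γ * s) * f s) atBot atTop

/-- The standing assumptions on the non-negative kernel `f`: it is measurable, bounded, square
integrable, and its positive part does not vanish. -/
structure KernelAssumptions (f : ℝ → ℝ) : Prop where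
  measurable : Measurable f
  nonneg : ∀ s, 0 ≤ f s
  bounded : ∃ C : ℝ, ∀ s, |f s| ≤ C
  sq_integrable : Integrable (fun s => f s ^ 2)
  nondegenerate : 0 < ∫ s : ℝ, (max (f s) 0) ^ 2

/-- For some `i ∈ {1, 2, 3, 4}` the measure and the kernel satisfy the `i`-th conditions, and in
the case `i = 1` the measure also satisfies `CondC`. -/
def RegularityAssumptions (μ : Measure ℝ) (f : ℝ → ℝ) : Prop :=
  (CondN1 μ ∧ CondF1 f ∧ CondC μ) ∨ (CondN2 μ ∧ CondF2 f) ∨ (CondN3 μ ∧ CondF3 f) ∨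
    (CondN4 μ ∧ CondF4 f)

/-! ### Conditions on the scaling functions -/

/-- The assumptions on the scaling functions `θ, χ : T → (0, ∞)`: they are bounded on the part of
`T` in every segment `[a, b] ⊂ (0, ∞)` and bounded away from `0` on `T`, and as `t → ∞` in `T`,
`θ(t) → ∞` and `ln ((ln χ(t)) ∨ 1) ≪ ln θ(t)`. -/
structure ScalingAssumptions (T : Set ℝ) (θ χ : ℝ → ℝ) : Prop where
  away_from_zero : ∃ m : ℝ, 0 < m ∧ ∀ t ∈ T, m ≤ θ t ∧ m ≤ χ t
  bounded_on_segments : ∀ a b : ℝ, 0 < a → a ≤ b →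
    ∃ C : ℝ, ∀ t ∈ T ∩ Icc a b, θ t ≤ C ∧ χ t ≤ C
  theta_tendsto : Tendsto θ (atTop ⊓ 𝓟 T) atTop
  chi_growth : (fun t => Real.log (max (Real.log (χ t)) 1)) =o[atTop ⊓ 𝓟 T]
    (fun t => Real.log (θ t))

/-- The critical constant
`(β^{-1/(β-1)} - β^{-β/(β-1)})^{-(β-1)/β} b^{1/β} F⁻¹` of the exponentially damped case. -/
def dampedConst (b β F : ℝ) : ℝ :=
  (β ^ (-1 / (β - 1)) - β ^ (-β / (β - 1))) ^ (-(β - 1) / β) * b ^ (1 / β) * F⁻¹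

end LevyDensity


end

open LevyDensity

/-!
# Tails of the densities of rescaled Lévy integrals

Let `ν = kernelMeasure μ f` be the image of `μ ⊗ ds` under `(u, s) ↦ u f(s)`. Approximation of the
kernel by step functions gives `charFun Y_t z = exp (θ(t) ψ_ν(χ(t) z))` with the exponent `ψ_ν` of `ν`
(`charFun_scaledIntegral`). Hence `Y_t / χ(t)` is distributed as a Lévy process with Lévy measure `ν`
at time `θ(t)`, and everything reduces to bounds for the densities `q_s = levyDensity ν s` which are
uniform in the times `s ≥ m > 0`.

*Existence and smoothness.* The regularity conditions give
`log |z| = o(∫ (1 - cos (z y)) ν(dy))`, already for the positive jumps (`cosDecay_of_regularity`). For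
convex kernels the point is that the phase `|z| u f(s)` runs ever faster through its periods, so that
at least half of the time the cosine is nonpositive. Thus `|exp (s ψ_ν)|` decays faster than any
power, and Fourier inversion yields a density in `C_b^∞` (`isSmoothDensity_invDensity`).

*Upper bound.* Splitting off the small jumps during a time `m / 2`, one obtains a Chernoff bound
`q_s(x) ≤ C exp (-ξ x + s Λ(ξ) + C ξ² e^{2 η ξ})` with the cumulant `Λ` of `ν` and any `η > 0`
(`exists_levyDensity_le`). With `v = x / s` and `l = log v` it is applied to `ξ = κ l` in the truncated
case and to `ξ = κ l^{1 - 1/β}` in the damped case; as long as `κ` is below the critical constant, the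
cumulant is `O(l² v^ρ)` with some `ρ < 1` and does not contribute.

*Lower bound.* The level `s v` is reached by about `s v / a` jumps from `[a, b]`, followed by `O(b)` small
jumps which lead into an interval of fixed length, where the process at a time `m / 2` has a density
bounded from below; the compensator and the remaining jumps contribute `O(s)` with probability at least `1 / 2`. Since a compound Poisson law
assigns mass of the order `exp (-(s v / a) log (v / ν[a, b]))` to this event, one obtains
`exists_le_levyDensity`. In the truncated case `a` is close to `σ₊ F`. In the damped case `a` is a
multiple of `l^{1/β}`, chosen to balance the number of jumps against their intensity, and the optimal
multiple yields the constant `dampedConst` (`dampedConst_eq_div`), which is also the one for which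
Young's inequality (`mul_le_young`) is sharp.

The factor `1 / χ(t)` of the change of variables lies between `e^{-K θ(t)}` and a constant, which is
negligible (`exists_forall_scaled`).
-/

namespace LevyDensity

open scoped FourierTransform ENNReal

/-! ### Compound Poisson laws -/

/-- The `n`-fold convolution power of a measure on `ℝ`; the zeroth power is the Dirac mass at `0`. -/
noncomputable def convPow (κ : Measure ℝ) : ℕ → Measure ℝ
  | 0 => Measure.dirac 0
  | n + 1 => convPow κ n ∗ κ

instance (κ : Measure ℝ) [IsFiniteMeasure κ] (n : ℕ) : IsFiniteMeasure (convPow κ n) := by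
  induction n with
  | zero => unfold convPow; infer_instance
  | succ n ih => unfold convPow; infer_instance

/-- The compound Poisson law `e^{-κ(ℝ)} ∑ κ^{*n} / n!` with finite Lévy measure `κ`
(without compensation of the jumps). -/
noncomputable def compoundPoisson (κ : Measure ℝ) : Measure ℝ :=
  Measure.sum fun n : ℕ =>
    ENNReal.ofReal (Real.exp (-κ.real univ) / n.factorial) • convPow κ n

lemma lintegral_exp_conv (m κ : Measure ℝ) [SFinite m] [SFinite κ] (ξ : ℝ) :
    ∫⁻ x, ENNReal.ofReal (Real.exp (ξ * x)) ∂(m ∗ κ)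
      = (∫⁻ x, ENNReal.ofReal (Real.exp (ξ * x)) ∂m)
        * ∫⁻ x, ENNReal.ofReal (Real.exp (ξ * x)) ∂κ := by
  rw [Measure.lintegral_conv (by fun_prop)]
  simp_rw [mul_add, Real.exp_add, ENNReal.ofReal_mul (Real.exp_pos _).le]
  simp_rw [lintegral_const_mul' _ _ ENNReal.ofReal_ne_top]
  rw [lintegral_mul_const _ (by fun_prop)]

lemma lintegral_exp_convPow (κ : Measure ℝ) [IsFiniteMeasure κ] (ξ : ℝ) (n : ℕ) :
    ∫⁻ x, ENNReal.ofReal (Real.exp (ξ * x)) ∂(convPow κ n)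
      = (∫⁻ x, ENNReal.ofReal (Real.exp (ξ * x)) ∂κ) ^ n := by
  induction n with
  | zero => simp [convPow]
  | succ n ih => rw [convPow, lintegral_exp_conv, ih, pow_succ]

lemma lintegral_exp_compoundPoisson (κ : Measure ℝ) [IsFiniteMeasure κ] (ξ : ℝ)
    (h : Integrable (fun x => Real.exp (ξ * x)) κ) :
    ∫⁻ x, ENNReal.ofReal (Real.exp (ξ * x)) ∂(compoundPoisson κ)
      = ENNReal.ofReal (Real.exp ((∫ x, Real.exp (ξ * x) ∂κ) - κ.real univ)) := by
  have hl : ∫⁻ x, ENNReal.ofReal (Real.exp (ξ * x)) ∂κ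
      = ENNReal.ofReal (∫ x, Real.exp (ξ * x) ∂κ) :=
    (ofReal_integral_eq_lintegral_ofReal h (ae_of_all _ fun x => (Real.exp_pos _).le)).symm
  have hl0 : 0 ≤ ∫ x, Real.exp (ξ * x) ∂κ := integral_nonneg fun x => (Real.exp_pos _).le
  rw [compoundPoisson, lintegral_sum_measure]
  simp_rw [lintegral_smul_measure, lintegral_exp_convPow, hl, ← ENNReal.ofReal_pow hl0, smul_eq_mul]
  have hs : HasSum (fun n : ℕ => Real.exp (-κ.real univ) / n.factorial
      * (∫ x, Real.exp (ξ * x) ∂κ) ^ n) (Real.exp ((∫ x, Real.exp (ξ * x) ∂κ) - κ.real univ)) := by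
    have := (NormedSpace.expSeries_div_hasSum_exp (∫ x, Real.exp (ξ * x) ∂κ)).mul_left
      (Real.exp (-κ.real univ))
    rw [← Real.exp_eq_exp_ℝ, ← Real.exp_add] at this
    rw [sub_eq_neg_add]
    simpa only [mul_div_assoc, div_mul_eq_mul_div] using this
  rw [← hs.tsum_eq, ENNReal.ofReal_tsum_of_nonneg (fun n => by positivity) hs.summable]
  congr 1
  ext n
  rw [ENNReal.ofReal_mul (by positivity)]

instance (κ : Measure ℝ) [IsFiniteMeasure κ] : IsProbabilityMeasure (compoundPoisson κ) := by
  constructor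
  have := lintegral_exp_compoundPoisson κ 0 (by simp)
  simpa using this

lemma charFun_convPow (κ : Measure ℝ) [IsFiniteMeasure κ] (n : ℕ) (z : ℝ) :
    charFun (convPow κ n) z = charFun κ z ^ n := by
  induction n with
  | zero => simp [convPow]
  | succ n ih => rw [convPow, charFun_conv, ih, pow_succ]

lemma charFun_compoundPoisson (κ : Measure ℝ) [IsFiniteMeasure κ] (z : ℝ) :
    charFun (compoundPoisson κ) z = Complex.exp (charFun κ z - κ.real univ) := by
  have hint : Integrable (fun x : ℝ => Complex.exp (z * x * Complex.I)) (compoundPoisson κ) := by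
    refine (integrable_const (1 : ℝ)).mono' (by fun_prop) (ae_of_all _ fun x => ?_)
    rw [← Complex.ofReal_mul, Complex.norm_exp_ofReal_mul_I]
  rw [charFun_apply_real]
  have h1 := hasSum_integral_measure (μ := fun n : ℕ =>
    ENNReal.ofReal (Real.exp (-κ.real univ) / n.factorial) • convPow κ n) (f := fun x : ℝ =>
      Complex.exp (z * x * Complex.I)) hint
  have h2 := (NormedSpace.expSeries_div_hasSum_exp (charFun κ z)).mul_left
      (Complex.exp (-κ.real univ))
  rw [← Complex.exp_eq_exp_ℂ, ← Complex.exp_add] at h2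
  rw [sub_eq_neg_add]
  refine h1.unique ?_
  have h3 : ∀ n : ℕ, ∫ x : ℝ, Complex.exp (z * x * Complex.I)
      ∂(ENNReal.ofReal (Real.exp (-κ.real univ) / n.factorial) • convPow κ n)
      = Complex.exp (-κ.real univ) * (charFun κ z ^ n / n.factorial) := fun n => by
    rw [integral_smul_measure, ← charFun_apply_real, charFun_convPow,
      ENNReal.toReal_ofReal (by positivity), Complex.real_smul]
    push_cast
    ring
  simpa only [h3] using h2

/-! ### The characteristic exponent -/

/-- The second order remainder `e^{ix} - 1 - ix` of the exponential on the imaginary axis. -/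
noncomputable def expRem (x : ℝ) : ℂ := Complex.exp (Complex.I * x) - 1 - Complex.I * x

@[fun_prop]
lemma continuous_expRem : Continuous expRem := by unfold expRem; fun_prop

lemma hasDerivAt_expRem (x : ℝ) :
    HasDerivAt expRem (Complex.I * (Complex.exp (Complex.I * x) - 1)) x := by
  have h1 : HasDerivAt (fun y : ℝ => Complex.I * (y : ℂ)) Complex.I x := by
    simpa using (HasDerivAt.ofReal_comp (hasDerivAt_id x)).const_mul Complex.I
  rw [mul_sub, mul_one, mul_comm]
  exact ((h1.cexp).sub_const 1).sub h1

lemma norm_expRem_sub_le (x y : ℝ) : ‖expRem x - expRem y‖ ≤ max |x| |y| * |x - y| := by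
  have hb : ∀ t ∈ uIcc y x, ‖Complex.I * (Complex.exp (Complex.I * t) - 1)‖ ≤ max |x| |y| := by
    intro t ht
    rw [norm_mul, Complex.norm_I, one_mul]
    refine (Real.norm_exp_I_mul_ofReal_sub_one_le).trans ?_
    rw [Real.norm_eq_abs]
    rcases le_total y x with h | h
    · rw [uIcc_of_le h] at ht
      rw [max_comm]
      exact abs_le_max_abs_abs ht.1 ht.2
    · rw [uIcc_of_ge h] at ht
      exact abs_le_max_abs_abs ht.1 ht.2
  have := (convex_uIcc y x).norm_image_sub_le_of_norm_hasDerivWithin_le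
    (fun t _ => (hasDerivAt_expRem t).hasDerivWithinAt) hb left_mem_uIcc right_mem_uIcc
  simpa [Real.norm_eq_abs] using this

lemma norm_expRem_le (x : ℝ) : ‖expRem x‖ ≤ x ^ 2 := by
  have := norm_expRem_sub_le x 0
  have h0 : expRem 0 = 0 := by simp [expRem]
  rw [h0] at this
  simpa [sq, abs_mul_abs_self] using this

lemma levyExponent_eq (ν : Measure ℝ) (z : ℝ) : levyExponent ν z = ∫ u, expRem (z * u) ∂ν := by
  unfold levyExponent expRem
  congr 1
  ext u
  push_cast
  ring_nf

lemma integrable_expRem {ν : Measure ℝ} (hν : Integrable (fun y : ℝ => y ^ 2) ν) (z : ℝ) :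
    Integrable (fun u => expRem (z * u)) ν := by
  refine (hν.const_mul (z ^ 2)).mono'
    (continuous_expRem.comp (continuous_const.mul continuous_id)).aestronglyMeasurable
    (ae_of_all _ fun u => ?_)
  simpa [mul_pow] using norm_expRem_le (z * u)

lemma norm_levyExponent_sub_le {ν : Measure ℝ} (hν : Integrable (fun y : ℝ => y ^ 2) ν)
    (x y : ℝ) : ‖levyExponent ν x - levyExponent ν y‖
      ≤ max |x| |y| * |x - y| * ∫ u, u ^ 2 ∂ν := by
  rw [levyExponent_eq, levyExponent_eq,
    ← integral_sub (integrable_expRem hν x) (integrable_expRem hν y), ← integral_const_mul]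
  refine norm_integral_le_of_norm_le (hν.const_mul _) (ae_of_all _ fun u => ?_)
  refine (norm_expRem_sub_le _ _).trans (le_of_eq ?_)
  rw [← sub_mul, abs_mul, abs_mul, abs_mul, ← max_mul_of_nonneg _ _ (abs_nonneg u), ← sq_abs u]
  ring

lemma continuous_levyExponent {ν : Measure ℝ} (hν : Integrable (fun y : ℝ => y ^ 2) ν) :
    Continuous (levyExponent ν) := by
  rw [funext (levyExponent_eq ν)]
  refine continuous_iff_continuousAt.mpr fun z => ?_
  refine continuousAt_of_dominated (bound := fun u => (|z| + 1) ^ 2 * u ^ 2)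
    (Eventually.of_forall fun x =>
      (continuous_expRem.comp (continuous_const.mul continuous_id)).aestronglyMeasurable) ?_
    (hν.const_mul _) (ae_of_all _ fun u =>
      (continuous_expRem.comp (continuous_id.mul continuous_const)).continuousAt)
  filter_upwards [Metric.ball_mem_nhds z one_pos] with x hx
  refine ae_of_all _ fun u => (norm_expRem_le _).trans ?_
  rw [mul_pow]
  refine mul_le_mul_of_nonneg_right ?_ (sq_nonneg u)
  rw [← sq_abs x]
  have : |x - z| < 1 := by simpa [Real.dist_eq] using hx
  have h2 := abs_sub_abs_le_abs_sub x z
  exact pow_le_pow_left₀ (abs_nonneg x) (by linarith) 2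

lemma re_levyExponent {ν : Measure ℝ} (hν : Integrable (fun y : ℝ => y ^ 2) ν) (z : ℝ) :
    (levyExponent ν z).re = -∫ u, (1 - Real.cos (z * u)) ∂ν := by
  rw [levyExponent_eq, ← integral_neg]
  have := integral_re (𝕜 := ℂ) (integrable_expRem hν z)
  simp only [RCLike.re_eq_complex_re] at this
  rw [← this]
  congr 1
  ext u
  have : Complex.exp (Complex.I * ((z * u : ℝ) : ℂ)) = Complex.exp (((z * u : ℝ) : ℂ) * Complex.I) := by
    rw [mul_comm]
  rw [expRem, this, Complex.sub_re, Complex.sub_re, Complex.exp_ofReal_mul_I_re]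
  simp

/-! ### Existence of infinitely divisible laws -/

/-- Lévy's continuity theorem without an a priori limit law: continuity of the limit `φ` at `0` gives
tightness, and a cluster point of the sequence has characteristic function `φ`. -/
lemma exists_tendsto_of_tendsto_charFun {m : ℕ → ProbabilityMeasure ℝ} {φ : ℝ → ℂ}
    (hφ : ContinuousAt φ 0) (h : ∀ z, Tendsto (fun n => charFun (m n : Measure ℝ) z) atTop (𝓝 (φ z))) :
    ∃ m₀ : ProbabilityMeasure ℝ, charFun (m₀ : Measure ℝ) = φ ∧ Tendsto m atTop (𝓝 m₀) := by
  have htight : IsTightMeasureSet (𝓧 := ℝ) {((m n : ProbabilityMeasure ℝ) : Measure ℝ) | n} :=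
    isTightMeasureSet_of_tendsto_charFun hφ h
  have hcomp : IsCompact (closure {m n | n}) :=
    isCompact_closure_of_isTightMeasureSet (by simpa using htight)
  -- an ultrafilter replaces the choice of a convergent subsequence
  let U : Ultrafilter ℕ := Ultrafilter.of atTop
  have hU : (U : Filter ℕ) ≤ atTop := Ultrafilter.of_le atTop
  obtain ⟨m₀, -, hm₀⟩ := hcomp.ultrafilter_le_nhds (U.map m)
    (le_trans (by simp) (monotone_principal subset_closure))
  have hm₀' : Tendsto m U (𝓝 m₀) := hm₀
  have hc : charFun (m₀ : Measure ℝ) = φ := by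
    ext z
    rw [ProbabilityMeasure.tendsto_iff_forall_integral_rclike_tendsto ℂ] at hm₀'
    have h1 := hm₀' (BoundedContinuousFunction.innerProbChar z)
    simp_rw [← charFun_eq_integral_innerProbChar] at h1
    exact tendsto_nhds_unique h1 ((h z).mono_left hU)
  exact ⟨m₀, hc, ProbabilityMeasure.tendsto_of_tendsto_charFun (by simpa [hc] using h)⟩

/-- Fatou's lemma along a weakly convergent sequence of laws. -/
lemma lintegral_le_of_tendsto {m : ℕ → ProbabilityMeasure ℝ} {m₀ : ProbabilityMeasure ℝ}
    (h : Tendsto m atTop (𝓝 m₀)) {g : ℝ → ℝ} (hg : Continuous g) (hg0 : ∀ x, 0 ≤ g x) {C : ℝ≥0∞}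
    (hC : ∀ n, ∫⁻ x, ENNReal.ofReal (g x) ∂(m n : Measure ℝ) ≤ C) :
    ∫⁻ x, ENNReal.ofReal (g x) ∂(m₀ : Measure ℝ) ≤ C := by
  refine (lintegral_le_liminf_lintegral_of_forall_isOpen_measure_le_liminf_measure hg hg0
    (fun G hG => ProbabilityMeasure.le_liminf_measure_open_of_tendsto h hG)).trans ?_
  exact (liminf_le_limsup).trans (limsup_le_of_le (h := Eventually.of_forall hC))

/-- A finite measure of jumps gives, after centering, an infinitely divisible law. -/
lemma exists_infDiv_of_finite (κ : Measure ℝ) [IsFiniteMeasure κ]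
    (hκ : Integrable (fun y : ℝ => y ^ 2) κ) :
    ∃ m : ProbabilityMeasure ℝ, (∀ z, charFun (m : Measure ℝ) z = Complex.exp (levyExponent κ z)) ∧
      ∀ ξ : ℝ, Integrable (fun y => Real.exp (ξ * y) - 1 - ξ * y) κ →
        ∫⁻ x, ENNReal.ofReal (Real.exp (ξ * x)) ∂(m : Measure ℝ)
          ≤ ENNReal.ofReal (Real.exp (∫ y, (Real.exp (ξ * y) - 1 - ξ * y) ∂κ)) := by
  have hid : Integrable (fun y : ℝ => y) κ := by
    refine ((integrable_const (1 : ℝ)).add hκ).mono' (by fun_prop) (ae_of_all _ fun y => ?_)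
    simp only [Pi.add_apply, Real.norm_eq_abs]
    nlinarith [sq_abs y, sq_nonneg (|y| - 1)]
  set c : ℝ := ∫ y, y ∂κ with hc
  have hm : IsProbabilityMeasure ((compoundPoisson κ).map (· + -c)) :=
    Measure.isProbabilityMeasure_map (by fun_prop)
  refine ⟨⟨(compoundPoisson κ).map (· + -c), hm⟩, fun z => ?_, fun ξ hξ => ?_⟩
  · simp only [ProbabilityMeasure.coe_mk]
    rw [charFun_map_add_const, charFun_compoundPoisson, ← Complex.exp_add, levyExponent_eq]
    congr 1
    have h1 : Integrable (fun y : ℝ => Complex.exp (z * y * Complex.I)) κ := by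
      refine (integrable_const (1 : ℝ)).mono' (by fun_prop) (ae_of_all _ fun x => ?_)
      rw [← Complex.ofReal_mul, Complex.norm_exp_ofReal_mul_I]
    have h2 : Integrable (fun y : ℝ => (y : ℂ)) κ := hid.ofReal
    have : ∀ u : ℝ, expRem (z * u)
        = Complex.exp (z * u * Complex.I) - 1 - (Complex.I * z) * (u : ℂ) := fun u => by
      unfold expRem; push_cast; ring_nf
    simp_rw [this]
    have h3 : Integrable (fun y : ℝ => Complex.exp (z * y * Complex.I) - 1) κ :=
      h1.sub (integrable_const _)
    rw [integral_sub h3 (h2.const_mul _), integral_sub h1 (integrable_const _),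
      integral_const_mul, integral_complex_ofReal, ← hc, charFun_apply_real]
    simp
    ring
  · simp only [ProbabilityMeasure.coe_mk]
    rw [lintegral_map (by fun_prop) (by fun_prop)]
    have h1 : Integrable (fun y : ℝ => Real.exp (ξ * y)) κ := by
      refine ((hξ.add (hid.const_mul ξ)).add (integrable_const (1 : ℝ))).congr
        (ae_of_all _ fun y => ?_)
      simp
    have h2 : Integrable (fun y : ℝ => Real.exp (ξ * y) - 1) κ := h1.sub (integrable_const _)
    simp_rw [mul_add, Real.exp_add, ENNReal.ofReal_mul (Real.exp_pos _).le]
    rw [lintegral_mul_const _ (by fun_prop), lintegral_exp_compoundPoisson κ ξ h1,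
      ← ENNReal.ofReal_mul (Real.exp_pos _).le, ← Real.exp_add]
    refine le_of_eq ?_
    congr 2
    rw [integral_sub h2 (hid.const_mul _), integral_sub h1 (integrable_const _),
      integral_const_mul, ← hc]
    simp
    ring

lemma exp_sub_one_sub_nonneg (x : ℝ) : 0 ≤ Real.exp x - 1 - x := by
  linarith [Real.add_one_le_exp x]

/-- For a measure `ν` with finite second moment there is a centered infinitely divisible law
with Lévy measure `ν`; its exponential moments are bounded by the expected formula. -/
theorem exists_infDiv {ν : Measure ℝ} (hν : Integrable (fun y : ℝ => y ^ 2) ν) :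
    ∃ m : ProbabilityMeasure ℝ, (∀ z, charFun (m : Measure ℝ) z = Complex.exp (levyExponent ν z)) ∧
      ∀ ξ : ℝ, Integrable (fun y => Real.exp (ξ * y) - 1 - ξ * y) ν →
        ∫⁻ x, ENNReal.ofReal (Real.exp (ξ * x)) ∂(m : Measure ℝ)
          ≤ ENNReal.ofReal (Real.exp (∫ y, (Real.exp (ξ * y) - 1 - ξ * y) ∂ν)) := by
  -- approximate `ν` by finite measures, removing the jumps near the origin
  let S : ℕ → Set ℝ := fun n => {y | ((n : ℝ) + 1)⁻¹ ≤ y ^ 2}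
  have hS : ∀ n, MeasurableSet (S n) := fun n => measurableSet_le (by fun_prop) (by fun_prop)
  have hfin : ∀ n, IsFiniteMeasure (ν.restrict (S n)) := fun n => by
    constructor
    rw [Measure.restrict_apply_univ]
    have := hν.measure_norm_ge_lt_top (ε := ((n : ℝ) + 1)⁻¹) (by positivity)
    refine lt_of_le_of_lt (measure_mono fun y hy => ?_) this
    simpa [S] using hy
  choose m hm1 hm2 using fun n => exists_infDiv_of_finite (ν.restrict (S n)) hν.restrict
  have hlim : ∀ z, Tendsto (fun n => levyExponent (ν.restrict (S n)) z) atTop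
      (𝓝 (levyExponent ν z)) := by
    intro z
    simp_rw [levyExponent_eq, ← integral_indicator (hS _)]
    refine tendsto_integral_of_dominated_convergence (fun u => ‖expRem (z * u)‖)
      (fun n => (integrable_expRem hν z).aestronglyMeasurable.indicator (hS n))
      (integrable_expRem hν z).norm
      (fun n => ae_of_all _ fun u => norm_indicator_le_norm_self _ _) (ae_of_all _ fun u => ?_)
    rcases eq_or_ne u 0 with rfl | hu
    · have : expRem 0 = 0 := by simp [expRem]
      simp [indicator_apply, this]
    · refine tendsto_const_nhds.congr' ?_
      have : Tendsto (fun n : ℕ => ((n : ℝ) + 1)⁻¹) atTop (𝓝 0) := by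
        simpa using tendsto_one_div_add_atTop_nhds_zero_nat (𝕜 := ℝ)
      filter_upwards [this.eventually (gt_mem_nhds (show 0 < u ^ 2 by positivity))] with n hn
      rw [indicator_of_mem]
      exact hn.le
  obtain ⟨m₀, hm₀, hlim₀⟩ := exists_tendsto_of_tendsto_charFun (m := m)
    (φ := fun z => Complex.exp (levyExponent ν z))
    (Complex.continuous_exp.comp (continuous_levyExponent hν)).continuousAt
    (fun z => by
      simp only [hm1]; exact (Complex.continuous_exp.tendsto _).comp (hlim z))
  refine ⟨m₀, fun z => by rw [hm₀], fun ξ hξ => ?_⟩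
  refine lintegral_le_of_tendsto hlim₀ (by fun_prop) (fun x => (Real.exp_pos _).le) fun n => ?_
  refine (hm2 n ξ hξ.restrict).trans (ENNReal.ofReal_le_ofReal (Real.exp_le_exp.mpr ?_))
  exact setIntegral_le_integral hξ (ae_of_all _ fun y => exp_sub_one_sub_nonneg _)

/-! ### Densities from integrable characteristic functions -/

/-- The function `x ↦ (2π)⁻¹ ∫ e^{-izx} φ(z) dz`, which is the continuous density of a law with
integrable characteristic function `φ`. The real part only serves to have a real valued function. -/
noncomputable def invDensity (φ : ℝ → ℂ) (x : ℝ) : ℝ :=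
  (2 * Real.pi)⁻¹ * (𝓕 φ ((2 * Real.pi)⁻¹ * x)).re

lemma fourier_two_pi_inv (φ : ℝ → ℂ) (x : ℝ) :
    𝓕 φ ((2 * Real.pi)⁻¹ * x) = ∫ z : ℝ, Complex.exp (-(z * x : ℝ) * Complex.I) * φ z := by
  rw [Real.fourier_real_eq_integral_exp_smul]
  congr 1
  ext z
  rw [smul_eq_mul]
  congr 2
  push_cast
  field_simp

lemma norm_fourier_le {φ : ℝ → ℂ} (w : ℝ) : ‖𝓕 φ w‖ ≤ ∫ z, ‖φ z‖ :=
  VectorFourier.norm_fourierIntegral_le_integral_norm _ _ _ _ _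

lemma contDiff_invDensity {φ : ℝ → ℂ}
    (hφ : ∀ k : ℕ, Integrable fun z : ℝ => |z| ^ k * ‖φ z‖) :
    ContDiff ℝ (⊤ : ℕ∞) (invDensity φ) := by
  have h1 : ContDiff ℝ (⊤ : ℕ∞) (𝓕 φ) := Real.contDiff_fourier fun n _ => by simpa using hφ n
  have h2 : ContDiff ℝ (⊤ : ℕ∞) fun x : ℝ => (𝓕 φ ((2 * Real.pi)⁻¹ * x)).re :=
    Complex.reCLM.contDiff.comp (h1.comp (contDiff_const.mul contDiff_id))
  exact contDiff_const.mul h2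

lemma bounded_iteratedDeriv_invDensity {φ : ℝ → ℂ} (hm : AEStronglyMeasurable φ)
    (hφ : ∀ k : ℕ, Integrable fun z : ℝ => |z| ^ k * ‖φ z‖) (k : ℕ) :
    ∃ C : ℝ, ∀ x, |iteratedDeriv k (invDensity φ) x| ≤ C := by
  have h1 : ContDiff ℝ (⊤ : ℕ∞) (𝓕 φ) := Real.contDiff_fourier fun n _ => by simpa using hφ n
  have h2 : ContDiff ℝ (⊤ : ℕ∞) fun x : ℝ => (𝓕 φ x).re := Complex.reCLM.contDiff.comp h1
  have hint : ∀ n : ℕ, Integrable fun x : ℝ => x ^ n • φ x := fun n => by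
    refine (hφ n).mono' (by fun_prop) (ae_of_all _ fun x => ?_)
    simp
  have hit := Real.iteratedDeriv_fourier (f := φ) (N := ⊤) (n := k) (fun n _ => hint n) le_top
  refine ⟨|(2 * Real.pi)⁻¹| * (|(2 * Real.pi)⁻¹| ^ k *
    ∫ z, ‖(fun x : ℝ => (-2 * Real.pi * Complex.I * x) ^ k • φ x) z‖), fun x => ?_⟩
  have e1 : iteratedDeriv k (invDensity φ) x = (2 * Real.pi)⁻¹
      * (((2 * Real.pi)⁻¹) ^ k * iteratedDeriv k (fun x => (𝓕 φ x).re) ((2 * Real.pi)⁻¹ * x)) := by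
    unfold invDensity
    rw [iteratedDeriv_const_mul_field, iteratedDeriv_comp_const_mul
      (f := fun x => (𝓕 φ x).re) (h2.of_le (by exact_mod_cast le_top))]
  have hre : ‖iteratedDeriv k (fun x => (𝓕 φ x).re) ((2 * Real.pi)⁻¹ * x)‖
      ≤ ‖iteratedDeriv k (𝓕 φ) ((2 * Real.pi)⁻¹ * x)‖ := by
    rw [← norm_iteratedFDeriv_eq_norm_iteratedDeriv, ← norm_iteratedFDeriv_eq_norm_iteratedDeriv]
    have := Complex.reCLM.norm_iteratedFDeriv_comp_left (f := 𝓕 φ) (x := (2 * Real.pi)⁻¹ * x)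
      h1.contDiffAt (n := k) (by exact_mod_cast le_top)
    rwa [Complex.reCLM_norm, one_mul] at this
  rw [e1, abs_mul, abs_mul, abs_pow]
  refine mul_le_mul_of_nonneg_left (mul_le_mul_of_nonneg_left ?_ (by positivity)) (abs_nonneg _)
  rw [← Real.norm_eq_abs]
  refine hre.trans ?_
  rw [hit]
  exact norm_fourier_le _

/-- Convolution of laws at the level of continuous densities. -/
lemma fourier_mul_charFun {φ : ℝ → ℂ} (hφ : Integrable φ) (m : Measure ℝ) [IsFiniteMeasure m]
    (x : ℝ) : 𝓕 (fun z => φ z * charFun m z) ((2 * Real.pi)⁻¹ * x)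
      = ∫ y, 𝓕 φ ((2 * Real.pi)⁻¹ * (x - y)) ∂m := by
  simp_rw [fourier_two_pi_inv, charFun_apply_real, ← integral_const_mul]
  rw [integral_integral_swap]
  · congr 1
    ext y
    congr 1
    ext z
    rw [mul_left_comm, mul_comm (φ z), ← Complex.exp_add]
    congr 2
    push_cast
    ring
  · simp_rw [Function.uncurry_def]
    have h1 : Integrable (fun p : ℝ × ℝ => φ p.1) (volume.prod m) := hφ.comp_fst m
    refine h1.norm.mono' ?_ (ae_of_all _ fun p => ?_)
    · exact (Measurable.aestronglyMeasurable (by fun_prop)).mul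
        (h1.aestronglyMeasurable.mul (Measurable.aestronglyMeasurable (by fun_prop)))
    · rw [norm_mul, norm_mul, ← Complex.ofReal_neg, ← Complex.ofReal_mul,
        Complex.norm_exp_ofReal_mul_I, Complex.norm_exp_ofReal_mul_I, one_mul, mul_one]

lemma invDensity_mul_charFun {φ : ℝ → ℂ} (hφ : Integrable φ) (m : Measure ℝ) [IsFiniteMeasure m]
    (x : ℝ) : invDensity (fun z => φ z * charFun m z) x = ∫ y, invDensity φ (x - y) ∂m := by
  unfold invDensity
  rw [fourier_mul_charFun hφ, integral_const_mul]
  congr 1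
  have hint : Integrable (fun y => 𝓕 φ ((2 * Real.pi)⁻¹ * (x - y))) m := by
    have hc : Continuous (𝓕 φ) := VectorFourier.fourierIntegral_continuous
        Real.continuous_fourierChar (by fun_prop) hφ
    exact (integrable_const (∫ z, ‖φ z‖)).mono' (by fun_prop)
      (ae_of_all _ fun y => norm_fourier_le _)
  have := integral_re (𝕜 := ℂ) hint
  simpa using this.symm

lemma fourier_charFun_gaussianReal {v : NNReal} (hv : v ≠ 0) (x : ℝ) :
    𝓕 (charFun (gaussianReal 0 v)) ((2 * Real.pi)⁻¹ * x)
      = ((2 * Real.pi * gaussianPDFReal 0 v x : ℝ) : ℂ) := by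
  have hv' : (0 : ℝ) < v := by positivity
  have h1 : charFun (gaussianReal 0 v⁻¹) (-x) = Complex.exp (-x ^ 2 / (2 * v)) := by
    rw [charFun_gaussianReal]
    congr 1
    push_cast
    field_simp
    ring
  rw [charFun_apply_real, integral_gaussianReal_eq_integral_smul (by simpa using hv)] at h1
  have hs : 0 < Real.sqrt (2 * Real.pi * v) := by positivity
  have hsq : Real.sqrt (2 * Real.pi * v) ^ 2 = 2 * Real.pi * v := Real.sq_sqrt (by positivity)
  have hs2 : Real.sqrt (2 * Real.pi * (v⁻¹ : NNReal)) = Real.sqrt (2 * Real.pi * v) / v := by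
    rw [Real.sqrt_eq_iff_mul_self_eq (by positivity) (by positivity), NNReal.coe_inv, ← sq,
      div_pow, hsq]
    field_simp
  rw [fourier_two_pi_inv]
  have h2 : ∀ z : ℝ, Complex.exp (-(z * x : ℝ) * Complex.I) * charFun (gaussianReal 0 v) z
      = ((Real.sqrt (2 * Real.pi * v) / v : ℝ) : ℂ) * (gaussianPDFReal 0 v⁻¹ z
        • Complex.exp (((-x : ℝ) : ℂ) * z * Complex.I)) := by
    intro z
    rw [charFun_gaussianReal, gaussianPDFReal, hs2, Complex.real_smul]
    push_cast
    rw [← mul_assoc, ← mul_assoc, mul_inv_cancel₀, one_mul, mul_comm]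
    · congr 2
      · field_simp
        simp [sq]
        ring
      · ring
    · exact_mod_cast (div_pos hs hv').ne'
  simp_rw [h2]
  rw [integral_const_mul, h1, gaussianPDFReal]
  push_cast
  rw [← mul_assoc]
  congr 1
  · have e : Real.sqrt (2 * Real.pi * v) / v = 2 * Real.pi * (Real.sqrt (2 * Real.pi * v))⁻¹ := by
      rw [div_eq_iff hv'.ne']
      calc Real.sqrt (2 * Real.pi * v)
          = Real.sqrt (2 * Real.pi * v) ^ 2 * (Real.sqrt (2 * Real.pi * v))⁻¹ := by
            rw [sq, mul_inv_cancel_right₀ hs.ne']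
        _ = _ := by rw [hsq]; ring
    have e' := congrArg Complex.ofReal e
    push_cast at e'
    exact e'
  · simp

/-- The densities of `m ∗ N(0, 1/(n+1))`, which are explicit, converge to `invDensity (charFun m)`;
hence the latter is nonnegative, and the Fourier transform of `charFun m` is real. -/
lemma tendsto_gaussian_smoothing {m : Measure ℝ} [IsProbabilityMeasure m] (hφ : Integrable (charFun m))
    (x : ℝ) :
    Tendsto (fun n : ℕ => 2 * Real.pi * ∫ y, gaussianPDFReal 0 ((n : NNReal) + 1)⁻¹ (x - y) ∂m)
      atTop (𝓝 (2 * Real.pi * invDensity (charFun m) x)) ∧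
    0 ≤ invDensity (charFun m) x ∧
    𝓕 (charFun m) ((2 * Real.pi)⁻¹ * x) = ((2 * Real.pi * invDensity (charFun m) x : ℝ) : ℂ) := by
  have hv : ∀ n : ℕ, ((n : NNReal) + 1)⁻¹ ≠ 0 := fun n => by positivity
  have hgint : ∀ n : ℕ, Integrable (charFun (gaussianReal 0 ((n : NNReal) + 1)⁻¹)) := by
    intro n
    have := integrable_exp_neg_mul_sq (b := ((n : ℝ) + 1)⁻¹ / 2) (by positivity)
    refine this.mono' (by fun_prop) (ae_of_all _ fun z => le_of_eq ?_)
    have e : ((z : ℂ) * (0 : ℝ) * Complex.I - (((n : NNReal) + 1)⁻¹ : NNReal) * (z : ℂ) ^ 2 / 2)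
        = ((-(((n : ℝ) + 1)⁻¹ / 2) * z ^ 2 : ℝ) : ℂ) := by push_cast; ring
    rw [charFun_gaussianReal, e, ← Complex.ofReal_exp, Complex.norm_real, Real.norm_eq_abs,
      Real.abs_exp]
  have h1 : ∀ n : ℕ, 𝓕 (fun z => charFun (gaussianReal 0 ((n : NNReal) + 1)⁻¹) z * charFun m z)
      ((2 * Real.pi)⁻¹ * x)
      = ((2 * Real.pi * ∫ y, gaussianPDFReal 0 ((n : NNReal) + 1)⁻¹ (x - y) ∂m : ℝ) : ℂ) := by
    intro n
    rw [fourier_mul_charFun (hgint n)]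
    simp_rw [fourier_charFun_gaussianReal (hv n)]
    rw [integral_complex_ofReal, integral_const_mul]
  have h2 : Tendsto (fun n : ℕ => 𝓕 (fun z => charFun (gaussianReal 0 ((n : NNReal) + 1)⁻¹) z
      * charFun m z) ((2 * Real.pi)⁻¹ * x)) atTop (𝓝 (𝓕 (charFun m) ((2 * Real.pi)⁻¹ * x))) := by
    simp_rw [fourier_two_pi_inv]
    refine tendsto_integral_of_dominated_convergence (fun z => ‖charFun m z‖)
      (fun n => by fun_prop) hφ.norm (fun n => ae_of_all _ fun z => ?_) (ae_of_all _ fun z => ?_)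
    · rw [norm_mul, norm_mul, ← Complex.ofReal_neg, Complex.norm_exp_ofReal_mul_I, one_mul]
      exact mul_le_of_le_one_left (norm_nonneg _) (norm_charFun_le_one _)
    · refine Tendsto.const_mul _ ?_
      have h0 : Tendsto (fun n : ℕ => charFun (gaussianReal 0 ((n : NNReal) + 1)⁻¹) z) atTop
          (𝓝 (Complex.exp (z * (0 : ℝ) * Complex.I - ((0 : ℝ) : ℂ) * z ^ 2 / 2))) := by
        simp_rw [charFun_gaussianReal]
        refine (Complex.continuous_exp.tendsto _).comp ?_
        refine tendsto_const_nhds.sub ((Tendsto.mul_const _ ?_).div_const _)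
        refine (Complex.continuous_ofReal.tendsto _).comp ?_
        push_cast
        simpa using tendsto_one_div_add_atTop_nhds_zero_nat (𝕜 := ℝ)
      simpa using h0.mul_const (charFun m z)
  simp_rw [h1] at h2
  have h3 := (Complex.continuous_re.tendsto _).comp h2
  have h4 := (Complex.continuous_im.tendsto _).comp h2
  have h5 : 2 * Real.pi * invDensity (charFun m) x = (𝓕 (charFun m) ((2 * Real.pi)⁻¹ * x)).re := by
    unfold invDensity
    field_simp
  have h6 : (𝓕 (charFun m) ((2 * Real.pi)⁻¹ * x)).im = 0 := by
    refine tendsto_nhds_unique h4 ?_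
    refine tendsto_const_nhds.congr fun n => ?_
    rw [Function.comp_apply, Complex.ofReal_im]
  have h7 : Tendsto (fun n : ℕ => 2 * Real.pi *
      ∫ y, gaussianPDFReal 0 ((n : NNReal) + 1)⁻¹ (x - y) ∂m)
      atTop (𝓝 (2 * Real.pi * invDensity (charFun m) x)) := by
    rw [h5]
    exact h3.congr fun n => by rw [Function.comp_apply, Complex.ofReal_re]
  refine ⟨h7, ?_, ?_⟩
  · have := ge_of_tendsto' h7 (b := (0 : ℝ)) fun n => mul_nonneg (by positivity)
      (integral_nonneg fun y => gaussianPDFReal_nonneg _ _ _)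
    exact nonneg_of_mul_nonneg_right this (by positivity)
  · rw [h5]
    exact Complex.ext (Complex.ofReal_re _).symm (h6.trans (Complex.ofReal_im _).symm)

/-- By Fatou's lemma, since the Gaussian smoothings are probability densities. -/
lemma integrable_invDensity {m : Measure ℝ} [IsProbabilityMeasure m] (hφ : Integrable (charFun m))
    (hc : Continuous (invDensity (charFun m))) : Integrable (invDensity (charFun m)) := by
  refine ⟨hc.aestronglyMeasurable, ?_⟩
  rw [hasFiniteIntegral_iff_ofReal (ae_of_all _ fun x => (tendsto_gaussian_smoothing hφ x).2.1)]
  have hpi : (0 : ℝ) < 2 * Real.pi := by positivity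
  have hlim : ∀ x, Tendsto (fun n : ℕ => ENNReal.ofReal
      (∫ y, gaussianPDFReal 0 ((n : NNReal) + 1)⁻¹ (x - y) ∂m)) atTop
      (𝓝 (ENNReal.ofReal (invDensity (charFun m) x))) := fun x => by
    have h1 := (tendsto_gaussian_smoothing hφ x).1.const_mul (2 * Real.pi)⁻¹
    simp_rw [inv_mul_cancel_left₀ hpi.ne'] at h1
    exact (ENNReal.continuous_ofReal.tendsto _).comp h1
  have hone : ∀ n : ℕ, ∫⁻ x, ENNReal.ofReal
      (∫ y, gaussianPDFReal 0 ((n : NNReal) + 1)⁻¹ (x - y) ∂m) = 1 := by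
    intro n
    have hv : ((n : NNReal) + 1)⁻¹ ≠ 0 := by positivity
    have hb : ∀ x, gaussianPDFReal 0 ((n : NNReal) + 1)⁻¹ x
        ≤ gaussianPDFReal 0 ((n : NNReal) + 1)⁻¹ 0 := fun x => by
      unfold gaussianPDFReal
      refine mul_le_mul_of_nonneg_left (Real.exp_le_exp.mpr ?_) (by positivity)
      exact div_le_div_of_nonneg_right (by nlinarith [sq_nonneg x]) (by positivity)
    have : ∀ x, ENNReal.ofReal (∫ y, gaussianPDFReal 0 ((n : NNReal) + 1)⁻¹ (x - y) ∂m)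
        = ∫⁻ y, ENNReal.ofReal (gaussianPDFReal 0 ((n : NNReal) + 1)⁻¹ (x - y)) ∂m := fun x => by
      rw [ofReal_integral_eq_lintegral_ofReal]
      · refine (integrable_const (gaussianPDFReal 0 ((n : NNReal) + 1)⁻¹ 0)).mono'
          (Measurable.aestronglyMeasurable (by fun_prop)) (ae_of_all _ fun y => ?_)
        rw [Real.norm_eq_abs, abs_of_nonneg (gaussianPDFReal_nonneg _ _ _)]
        exact hb _
      · exact ae_of_all _ fun y => gaussianPDFReal_nonneg _ _ _
    simp_rw [this]
    rw [lintegral_lintegral_swap (by fun_prop)]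
    have h2 : ∀ y, ∫⁻ x, ENNReal.ofReal (gaussianPDFReal 0 ((n : NNReal) + 1)⁻¹ (x - y)) = 1 :=
      fun y => by
        rw [lintegral_sub_right_eq_self
          (fun x => ENNReal.ofReal (gaussianPDFReal 0 ((n : NNReal) + 1)⁻¹ x)) y]
        exact lintegral_gaussianPDFReal_eq_one 0 hv
    simp [h2]
  calc ∫⁻ x, ENNReal.ofReal (invDensity (charFun m) x)
      = ∫⁻ x, liminf (fun n : ℕ => ENNReal.ofReal
        (∫ y, gaussianPDFReal 0 ((n : NNReal) + 1)⁻¹ (x - y) ∂m)) atTop := by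
        congr 1; ext x; exact (hlim x).liminf_eq.symm
    _ ≤ liminf (fun n : ℕ => ∫⁻ x, ENNReal.ofReal
        (∫ y, gaussianPDFReal 0 ((n : NNReal) + 1)⁻¹ (x - y) ∂m)) atTop := by
        refine lintegral_liminf_le' fun n => ?_
        refine (ENNReal.measurable_ofReal.comp ?_).aemeasurable
        exact (StronglyMeasurable.integral_prod_right (f := fun x y =>
          gaussianPDFReal 0 ((n : NNReal) + 1)⁻¹ (x - y)) (by
            refine Measurable.stronglyMeasurable ?_
            unfold Function.uncurry
            fun_prop)).measurable
    _ = 1 := by simp [hone]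
    _ < ⊤ := ENNReal.one_lt_top

/-- By Fourier inversion both sides have the same characteristic function. -/
lemma eq_withDensity_invDensity {m : Measure ℝ} [IsProbabilityMeasure m]
    (hφ : Integrable (charFun m)) (hc : Continuous (invDensity (charFun m))) :
    m = volume.withDensity fun x => ENNReal.ofReal (invDensity (charFun m) x) := by
  have hint := integrable_invDensity hφ hc
  have hpi : (0 : ℝ) < 2 * Real.pi := by positivity
  have hfin : IsFiniteMeasure (volume.withDensity fun x =>
      ENNReal.ofReal (invDensity (charFun m) x)) :=
    isFiniteMeasure_withDensity_ofReal hint.2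
  have hF : ∀ w, 𝓕 (charFun m) w
      = ((2 * Real.pi * invDensity (charFun m) (2 * Real.pi * w) : ℝ) : ℂ) := fun w => by
    have := (tendsto_gaussian_smoothing hφ (2 * Real.pi * w)).2.2
    rwa [inv_mul_cancel_left₀ hpi.ne'] at this
  have hFint : Integrable (𝓕 (charFun m)) := by
    rw [funext hF]
    exact ((hint.comp_mul_left' hpi.ne').const_mul _).ofReal
  have hinv := Continuous.fourierInv_fourier_eq (f := charFun m) continuous_charFun hφ hFint
  refine Measure.ext_of_charFun ?_
  ext z
  let F : ℝ → ℂ := fun x => (2 * Real.pi : ℂ) * ((invDensity (charFun m) x : ℝ) : ℂ)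
      * Complex.exp (z * x * Complex.I)
  have h1 : charFun m z = ∫ w, F (2 * Real.pi * w) := by
    rw [← congrFun hinv z, Real.fourierInv_eq']
    congr 1
    ext w
    rw [hF, smul_eq_mul, mul_comm]
    simp only [RCLike.inner_apply, conj_trivial, F]
    push_cast
    congr 2
    ring
  rw [h1, Measure.integral_comp_mul_left F, charFun_apply_real,
    integral_withDensity_eq_integral_toReal_smul (by fun_prop) (by simp), ← integral_smul]
  congr 1
  ext x
  rw [ENNReal.toReal_ofReal (tendsto_gaussian_smoothing hφ x).2.1, Complex.real_smul, Complex.real_smul,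
    abs_of_pos (by positivity)]
  simp only [F]
  have : (Real.pi : ℂ) ≠ 0 := by exact_mod_cast Real.pi_ne_zero
  push_cast
  field_simp

/-- A law whose characteristic function decays faster than any power has a density in
`C_b^∞`. -/
theorem isSmoothDensity_invDensity {m : Measure ℝ} [IsProbabilityMeasure m]
    (hφ : ∀ k : ℕ, Integrable fun z : ℝ => |z| ^ k * ‖charFun m z‖) :
    IsSmoothDensity m (invDensity (charFun m)) := by
  have h0 : Integrable (charFun m) := by
    have := hφ 0
    simp only [pow_zero, one_mul] at this
    exact (integrable_norm_iff (by fun_prop)).mp this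
  have hs := contDiff_invDensity hφ
  exact ⟨fun x => (tendsto_gaussian_smoothing h0 x).2.1, hs,
    bounded_iteratedDeriv_invDensity (by fun_prop) hφ, eq_withDensity_invDensity h0 hs.continuous⟩

/-! ### Windows hit by compound Poisson laws -/

lemma conv_Ioc (m κ : Measure ℝ) [SFinite m] [SFinite κ] (c d : ℝ) :
    (m ∗ κ) (Ioc c d) = ∫⁻ j, m (Ioc (c - j) (d - j)) ∂κ := by
  rw [Measure.conv_comm, ← lintegral_indicator_one measurableSet_Ioc,
    Measure.lintegral_conv (measurable_one.indicator measurableSet_Ioc)]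
  congr 1
  ext j
  rw [← lintegral_indicator_one measurableSet_Ioc]
  congr 1
  ext x
  simp only [indicator_apply, mem_Ioc, sub_lt_iff_lt_add', le_sub_iff_add_le', Pi.one_apply]

/-- Adding up jumps from `[a, b]` until the next one would exceed the level `y ≥ 0` leaves a gap
smaller than `b` and takes at most `y / a` jumps. In terms of the unnormalized jump measure `κ`,
this is a lower bound for the total mass that its convolution powers give to `(y - b, y]`. -/
lemma pow_le_sum_convPow_Ioc (κ : Measure ℝ) [IsFiniteMeasure κ] {a b : ℝ}
    (hab : a ≤ b) (hκ : κ (Icc a b)ᶜ = 0) (N : ℕ) {y : ℝ} (hy : 0 ≤ y) (hyN : y < (N + 1) * a) :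
    κ univ ^ N ≤ ∑ k ∈ Finset.range (N + 1), κ univ ^ (N - k) * convPow κ k (Ioc (y - b) y) := by
  induction N generalizing y with
  | zero =>
    have : (0 : ℝ) ∈ Ioc (y - b) y := ⟨by norm_num at hyN; linarith, hy⟩
    simp [convPow, Measure.dirac_apply' _ measurableSet_Ioc, indicator_of_mem this]
  | succ N ih =>
    rw [Finset.sum_range_succ']
    rcases lt_or_ge y b with hyb | hyb
    · have : (0 : ℝ) ∈ Ioc (y - b) y := ⟨by linarith, hy⟩
      refine le_trans (le_of_eq ?_) le_add_self
      simp [convPow, Measure.dirac_apply' _ measurableSet_Ioc, indicator_of_mem this]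
    · refine le_trans ?_ le_self_add
      have hmeas : ∀ k : ℕ, Measurable fun j => convPow κ k (Ioc (y - b - j) (y - j)) := by
        intro k
        have hs : MeasurableSet ({p : ℝ × ℝ | y - b - p.1 < p.2} ∩ {p | p.2 ≤ y - p.1}) :=
          (measurableSet_lt (by fun_prop) (by fun_prop)).inter
            (measurableSet_le (by fun_prop) (by fun_prop))
        exact measurable_measure_prodMk_left hs
      calc κ univ ^ (N + 1) = ∫⁻ _, κ univ ^ N ∂κ := by rw [lintegral_const, pow_succ]
        _ ≤ ∫⁻ j, ∑ k ∈ Finset.range (N + 1),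
              κ univ ^ (N - k) * convPow κ k (Ioc (y - b - j) (y - j)) ∂κ := by
            refine lintegral_mono_ae ?_
            filter_upwards [(measure_eq_zero_iff_ae_notMem.mp hκ)] with j hj
            simp only [mem_compl_iff, not_not] at hj
            have := ih (y := y - j) (by linarith [hj.2]) (by push_cast at hyN; linarith [hj.1])
            rwa [sub_right_comm] at this
        _ = ∑ k ∈ Finset.range (N + 1),
              κ univ ^ (N + 1 - (k + 1)) * convPow κ (k + 1) (Ioc (y - b) y) := by
            rw [lintegral_finsetSum _ (fun k _ => (hmeas k).const_mul _)]
            refine Finset.sum_congr rfl fun k _ => ?_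
            rw [lintegral_const_mul _ (hmeas k), convPow, conv_Ioc, Nat.add_sub_add_right]

/-- A compound Poisson law with jumps in `[a, b]` charges every window `(y - b, y]` with `y ≥ 0`;
the bound is monotone in an upper bound `B` of the level. The weights `1 / k!` are compared with the
geometric ones of `pow_le_sum_convPow_Ioc`, with `N = ⌊y / a⌋`. -/
lemma ofReal_exp_le_compoundPoisson_Ioc (κ : Measure ℝ) [IsFiniteMeasure κ] {a b : ℝ} (ha : 0 < a)
    (hab : a ≤ b) (hκ : κ (Icc a b)ᶜ = 0) (hpos : 0 < κ.real univ) {y B : ℝ} (hy : 0 ≤ y)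
    (hyB : y ≤ B) :
    ENNReal.ofReal (Real.exp (-κ.real univ - B / a * Real.log (1 + B / (a * κ.real univ))))
      ≤ compoundPoisson κ (Ioc (y - b) y) := by
  set l := κ.real univ with hl
  have hlu : κ univ = ENNReal.ofReal l := by rw [hl, ofReal_measureReal]
  set N := ⌊y / a⌋₊ with hN
  have hN1 : y < (N + 1) * a := by
    rw [← div_lt_iff₀ ha]; exact Nat.lt_floor_add_one _
  have hN2 : (N : ℝ) ≤ B / a :=
    (Nat.floor_le (by positivity)).trans (div_le_div_of_nonneg_right hyB ha.le)
  have key := pow_le_sum_convPow_Ioc κ hab hκ N hy hN1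
  have hD : (0 : ℝ) < l + N := by positivity
  have hfac : ∀ k ∈ Finset.range (N + 1),
      ENNReal.ofReal (Real.exp (-l) / (l + N) ^ N) *
        (κ univ ^ (N - k) * convPow κ k (Ioc (y - b) y))
      ≤ ENNReal.ofReal (Real.exp (-l) / k.factorial) * convPow κ k (Ioc (y - b) y) := by
    intro k hk
    have hkN : k ≤ N := by simpa [Nat.lt_succ_iff] using hk
    rw [← mul_assoc, hlu, ← ENNReal.ofReal_pow hpos.le, ← ENNReal.ofReal_mul (by positivity)]
    refine mul_le_mul_left ?_ _
    refine ENNReal.ofReal_le_ofReal ?_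
    rw [div_mul_eq_mul_div, div_le_div_iff₀ (by positivity) (by positivity), mul_assoc]
    refine mul_le_mul_of_nonneg_left ?_ (Real.exp_pos _).le
    have h1 : (k.factorial : ℝ) ≤ (l + N) ^ k := by
      calc (k.factorial : ℝ) ≤ (k : ℝ) ^ k := by exact_mod_cast Nat.factorial_le_pow k
        _ ≤ (l + N) ^ k := by
          have : (k : ℝ) ≤ N := by exact_mod_cast hkN
          gcongr; linarith
    calc l ^ (N - k) * (k.factorial : ℝ) ≤ (l + N) ^ (N - k) * (l + N) ^ k := by
          gcongr; linarith [Nat.cast_nonneg (α := ℝ) N]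
      _ = (l + N) ^ N := by rw [← pow_add, Nat.sub_add_cancel hkN]
  have h1 : ENNReal.ofReal (Real.exp (-l) * (l / (l + N)) ^ N) ≤ compoundPoisson κ (Ioc (y - b) y) := by
    calc ENNReal.ofReal (Real.exp (-l) * (l / (l + N)) ^ N)
        = ENNReal.ofReal (Real.exp (-l) / (l + N) ^ N) * κ univ ^ N := by
          rw [hlu, ← ENNReal.ofReal_pow hpos.le, ← ENNReal.ofReal_mul (by positivity), div_pow]
          congr 1; ring
      _ ≤ ENNReal.ofReal (Real.exp (-l) / (l + N) ^ N) * ∑ k ∈ Finset.range (N + 1),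
            κ univ ^ (N - k) * convPow κ k (Ioc (y - b) y) := mul_le_mul_right key _
      _ ≤ ∑ k ∈ Finset.range (N + 1),
            ENNReal.ofReal (Real.exp (-l) / k.factorial) * convPow κ k (Ioc (y - b) y) := by
          rw [Finset.mul_sum]; exact Finset.sum_le_sum hfac
      _ ≤ compoundPoisson κ (Ioc (y - b) y) := by
          rw [compoundPoisson, Measure.sum_apply _ measurableSet_Ioc]
          simp only [Measure.smul_apply, smul_eq_mul]
          exact ENNReal.sum_le_tsum _
  refine le_trans (ENNReal.ofReal_le_ofReal ?_) h1
  rw [sub_eq_add_neg, Real.exp_add]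
  refine mul_le_mul_of_nonneg_left ?_ (Real.exp_pos _).le
  have h2 : (l / (l + N)) ^ N = Real.exp (-(N * Real.log (1 + N / l))) := by
    rw [Real.exp_neg, mul_comm, ← Real.rpow_def_of_pos (by positivity), Real.rpow_natCast, ← inv_pow]
    congr 1
    field_simp
  rw [h2, Real.exp_le_exp, neg_le_neg_iff]
  have hB : 0 ≤ B := hy.trans hyB
  have h3 : Real.log (1 + N / l) ≤ Real.log (1 + B / (a * l)) := by
    refine Real.log_le_log (by positivity) ?_
    rw [← div_div]
    gcongr
  have h4 : 0 ≤ Real.log (1 + N / l) := Real.log_nonneg (by simp; positivity)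
  exact mul_le_mul hN2 h3 h4 (by positivity)

/-- Large jumps from `[a, b]` followed by small jumps from `[r, δ]` reach every window of length
`δ` at any level `y ∈ [0, B]`. -/
lemma ofReal_exp_le_conv_compoundPoisson_Ioc (κ κ' : Measure ℝ) [IsFiniteMeasure κ]
    [IsFiniteMeasure κ'] {a b r δ : ℝ} (ha : 0 < a) (hab : a ≤ b) (hr : 0 < r) (hrδ : r ≤ δ)
    (hκ : κ (Icc a b)ᶜ = 0) (hκ' : κ' (Icc r δ)ᶜ = 0)
    (hpos : 0 < κ.real univ) (hpos' : 0 < κ'.real univ) {y B : ℝ} (hy : 0 ≤ y) (hyB : y ≤ B) :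
    ENNReal.ofReal (Real.exp (
      (-κ'.real univ - b / r * Real.log (1 + b / (r * κ'.real univ))) +
      (-κ.real univ - B / a * Real.log (1 + B / (a * κ.real univ)))))
      ≤ (compoundPoisson κ' ∗ compoundPoisson κ) (Ioc (y - δ) y) := by
  rw [conv_Ioc, Real.exp_add, ENNReal.ofReal_mul (Real.exp_pos _).le]
  calc _ ≤ ENNReal.ofReal (Real.exp (-κ'.real univ - b / r * Real.log (1 + b / (r * κ'.real univ))))
        * compoundPoisson κ (Ioc (y - b) y) :=
        mul_le_mul_right (ofReal_exp_le_compoundPoisson_Ioc κ ha hab hκ hpos hy hyB) _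
    _ = ∫⁻ _ in Ioc (y - b) y, ENNReal.ofReal (Real.exp
        (-κ'.real univ - b / r * Real.log (1 + b / (r * κ'.real univ)))) ∂(compoundPoisson κ) := by
        rw [setLIntegral_const]
    _ ≤ ∫⁻ j in Ioc (y - b) y, compoundPoisson κ' (Ioc (y - δ - j) (y - j)) ∂(compoundPoisson κ) := by
        refine setLIntegral_mono' measurableSet_Ioc fun j hj => ?_
        have := ofReal_exp_le_compoundPoisson_Ioc κ' hr hrδ hκ' hpos' (y := y - j) (B := b)
          (by linarith [hj.2]) (by linarith [hj.1])
        rwa [sub_right_comm] at this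
    _ ≤ _ := setLIntegral_le_lintegral _ _

/-! ### Characteristic functions of Lévy integrals -/

lemma StepKernel.measurable_toFun {I : Set ℝ} (S : StepKernel I) : Measurable S.toFun := by
  unfold StepKernel.toFun
  exact Finset.measurable_sum _ fun i _ => measurable_const.indicator measurableSet_Ioc

/-- The intervals between consecutive nodes are disjoint, so that functions vanishing at `0` act
on step kernels coefficientwise. -/
lemma StepKernel.comp_toFun {I : Set ℝ} (S : StepKernel I) {h : ℝ → ℂ} (h0 : h 0 = 0) (s : ℝ) :
    h (S.toFun s) = ∑ i : Fin S.n, (Ioc (S.node i.castSucc : ℝ) (S.node i.succ : ℝ)).indicator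
      (fun _ => h (S.coeff i)) s := by
  have hdisj : ∀ i j : Fin S.n, s ∈ Ioc (S.node i.castSucc : ℝ) (S.node i.succ : ℝ) →
      s ∈ Ioc (S.node j.castSucc : ℝ) (S.node j.succ : ℝ) → j ≤ i := by
    intro i j hi hj
    by_contra! hij
    have h1 : S.node i.succ ≤ S.node j.castSucc := S.mono (by
      rw [Fin.le_def]; simpa using hij)
    have h2 : (S.node i.succ : ℝ) ≤ S.node j.castSucc := h1
    linarith [hi.2, hj.1]
  unfold StepKernel.toFun
  by_cases hs : ∃ i : Fin S.n, s ∈ Ioc (S.node i.castSucc : ℝ) (S.node i.succ : ℝ)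
  · obtain ⟨i, hi⟩ := hs
    have hne : ∀ j : Fin S.n, j ≠ i → s ∉ Ioc (S.node j.castSucc : ℝ) (S.node j.succ : ℝ) :=
      fun j hj hsj => hj (le_antisymm (hdisj i j hi hsj) (hdisj j i hsj hi))
    rw [Finset.sum_eq_single i (fun j _ hj => indicator_of_notMem (hne j hj) _) (by simp),
      Finset.sum_eq_single i (fun j _ hj => indicator_of_notMem (hne j hj) _) (by simp),
      indicator_of_mem hi, indicator_of_mem hi]
  · push Not at hs
    rw [Finset.sum_eq_zero fun j _ => indicator_of_notMem (hs j) _,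
      Finset.sum_eq_zero fun j _ => indicator_of_notMem (hs j) _, h0]

lemma levyExponent_zero (μ : Measure ℝ) : levyExponent μ 0 = 0 := by simp [levyExponent]

lemma StepKernel.integral_comp_toFun {I : Set ℝ} (hI : I.OrdConnected) (S : StepKernel I)
    {h : ℝ → ℂ} (h0 : h 0 = 0) :
    ∫ s in I, h (S.toFun s)
      = ∑ i : Fin S.n, (((S.node i.succ : ℝ) - (S.node i.castSucc : ℝ) : ℝ) : ℂ) * h (S.coeff i) := by
  have hsub : ∀ i : Fin S.n, Ioc (S.node i.castSucc : ℝ) (S.node i.succ : ℝ) ⊆ I := fun i =>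
    Ioc_subset_Icc_self.trans (hI.out (S.node i.castSucc).2 (S.node i.succ).2)
  simp_rw [S.comp_toFun h0]
  have hint : ∀ i : Fin S.n, IntegrableOn (fun _ : ℝ => h (S.coeff i))
      (Ioc (S.node i.castSucc : ℝ) (S.node i.succ : ℝ)) (volume.restrict I) := fun i =>
    integrableOn_const (ne_of_lt (lt_of_le_of_lt (Measure.restrict_apply_le _ _)
      (by simp)))
  rw [integral_finsetSum _ fun i _ => (integrable_indicator_iff measurableSet_Ioc).mpr (hint i)]
  refine Finset.sum_congr rfl fun i _ => ?_
  rw [integral_indicator measurableSet_Ioc, Measure.restrict_restrict measurableSet_Ioc,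
    inter_eq_left.mpr (hsub i), setIntegral_const, measureReal_def, Real.volume_Ioc,
    ENNReal.toReal_ofReal, Complex.real_smul]
  have : S.node i.castSucc ≤ S.node i.succ := S.mono (Fin.castSucc_lt_succ).le
  exact sub_nonneg.mpr this

lemma charFun_stepKernel {Ω : Type*} [MeasurableSpace Ω] {P : Measure Ω} [IsProbabilityMeasure P]
    {μ : Measure ℝ} {I : Set ℝ} (hI : I.OrdConnected) {Z : I → Ω → ℝ}
    (hZ : IsLevyProcess P μ I Z) (S : StepKernel I) (z : ℝ) :
    charFun (P.map (S.integral Z)) z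
      = Complex.exp (∫ s in I, levyExponent μ (z * S.toFun s)) := by
  have hm : ∀ i : Fin S.n, Measurable fun ω => Z (S.node i.succ) ω - Z (S.node i.castSucc) ω :=
    fun i => (hZ.measurable _).sub (hZ.measurable _)
  have hind := (hZ.indep S.n S.node S.mono).comp (fun i x => S.coeff i * x)
    (fun i => by fun_prop)
  have := hind.charFun_map_fun_sum_eq_prod (fun i => ((hm i).const_mul _).aemeasurable)
  have h1 : S.integral Z = fun ω => ∑ i : Fin S.n, S.coeff i *
      (Z (S.node i.succ) ω - Z (S.node i.castSucc) ω) := rfl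
  rw [h1, this, Finset.prod_apply, S.integral_comp_toFun hI (h := fun y => levyExponent μ (z * y))
    (by simp [levyExponent_zero]), Complex.exp_sum]
  refine Finset.prod_congr rfl fun i _ => ?_
  have h2 := charFun_map_mul_comp (μ := P) (hm i).aemeasurable (S.coeff i) z
  rw [h2, hZ.charFun_increment _ _ (S.mono (Fin.castSucc_lt_succ).le), mul_comm z]

/-- The exponent grows at most quadratically with a quadratic modulus of continuity, so that
`g ↦ ∫ levyExponent μ (z g)` is continuous on `L²`. -/
lemma tendsto_integral_levyExponent {μ : Measure ℝ} (hμ : Integrable (fun y : ℝ => y ^ 2) μ)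
    {ρ : Measure ℝ} {g : ℝ → ℝ} (hg : MemLp g 2 ρ) {S : ℕ → ℝ → ℝ} (hS : ∀ k, Measurable (S k))
    (hlim : Tendsto (fun k => eLpNorm (fun s => S k s - g s) 2 ρ) atTop (𝓝 0)) (z : ℝ) :
    Tendsto (fun k => ∫ s, levyExponent μ (z * S k s) ∂ρ) atTop
      (𝓝 (∫ s, levyExponent μ (z * g s) ∂ρ)) := by
  have hc := continuous_levyExponent hμ
  set V := ∫ u, u ^ 2 ∂μ with hV
  have hV0 : 0 ≤ V := integral_nonneg fun u => sq_nonneg u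
  have hgm := hg.aestronglyMeasurable
  have hdm : ∀ k, AEStronglyMeasurable (fun s => S k s - g s) ρ := fun k =>
    (hS k).aestronglyMeasurable.sub hgm
  have hψg : AEStronglyMeasurable (fun s => levyExponent μ (z * g s)) ρ :=
    hc.comp_aestronglyMeasurable (hgm.const_mul z)
  have hψS : ∀ k, AEStronglyMeasurable (fun s => levyExponent μ (z * S k s)) ρ := fun k =>
    hc.comp_aestronglyMeasurable ((hS k).aestronglyMeasurable.const_mul z)
  have hintg : Integrable (fun s => levyExponent μ (z * g s)) ρ := by
    refine ((hg.integrable_sq).const_mul (z ^ 2 * V)).mono' hψg (ae_of_all _ fun s => ?_)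
    have := norm_levyExponent_sub_le hμ (z * g s) 0
    rw [levyExponent_zero, sub_zero, sub_zero, abs_zero, max_eq_left (abs_nonneg _),
      abs_mul_abs_self] at this
    exact this.trans (le_of_eq (by ring))
  have hbound : ∀ k, eLpNorm ((fun s => levyExponent μ (z * S k s)) - fun s =>
      levyExponent μ (z * g s)) 1 ρ
      ≤ eLpNorm (fun s => (z ^ 2 * V) * (|S k s - g s| + |g s|)) 2 ρ
        * eLpNorm (fun s => S k s - g s) 2 ρ := by
    intro k
    refine le_trans (eLpNorm_mono_real (g := fun s => ((z ^ 2 * V) * (|S k s - g s| + |g s|))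
      * |S k s - g s|) fun s => ?_) ?_
    · refine (norm_levyExponent_sub_le hμ _ _).trans ?_
      rw [← mul_sub, abs_mul, abs_mul, abs_mul, ← mul_max_of_nonneg _ _ (abs_nonneg z)]
      have h1 : max |S k s| |g s| ≤ |S k s - g s| + |g s| := by
        refine max_le ?_ (by linarith [abs_nonneg (S k s - g s)])
        have := abs_add_le (S k s - g s) (g s)
        simpa using this
      have h2 : |z| * max |S k s| |g s| * (|z| * |S k s - g s|) * V
          = (z ^ 2 * V) * max |S k s| |g s| * |S k s - g s| := by
        rw [← sq_abs z]; ring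
      rw [h2]
      gcongr
    · have h3 := eLpNorm_smul_le_mul_eLpNorm (p := 2) (q := 2) (r := 1) (μ := ρ)
        (f := fun s => |S k s - g s|) (φ := fun s => (z ^ 2 * V) * (|S k s - g s| + |g s|))
        (by have := hdm k; exact this.norm)
        (((hdm k).norm.add hgm.norm).const_mul _)
      refine h3.trans (le_of_eq ?_)
      congr 1
      exact eLpNorm_norm (fun s => S k s - g s)
  have hbd2 : ∀ k, eLpNorm (fun s => (z ^ 2 * V) * (|S k s - g s| + |g s|)) 2 ρ
      ≤ ENNReal.ofReal (z ^ 2 * V) * (eLpNorm (fun s => S k s - g s) 2 ρ + eLpNorm g 2 ρ) := by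
    intro k
    have h1 := eLpNorm_const_smul (z ^ 2 * V) (fun s => |S k s - g s| + |g s|) 2 ρ
    have h2 : eLpNorm (fun s => (z ^ 2 * V) * (|S k s - g s| + |g s|)) 2 ρ
      = eLpNorm ((z ^ 2 * V) • fun s => |S k s - g s| + |g s|) 2 ρ := rfl
    rw [h2, h1, Real.enorm_eq_ofReal (by positivity)]
    refine mul_le_mul_right ?_ _
    refine (eLpNorm_add_le (hdm k).norm hgm.norm one_le_two).trans (le_of_eq ?_)
    congr 1
    · exact eLpNorm_norm (fun s => S k s - g s)
    · exact eLpNorm_norm g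
  have hzero : Tendsto (fun k => eLpNorm ((fun s => levyExponent μ (z * S k s)) - fun s =>
      levyExponent μ (z * g s)) 1 ρ) atTop (𝓝 0) := by
    have h1 : Tendsto (fun k => ENNReal.ofReal (z ^ 2 * V)
        * (eLpNorm (fun s => S k s - g s) 2 ρ + eLpNorm g 2 ρ)
        * eLpNorm (fun s => S k s - g s) 2 ρ) atTop
        (𝓝 (ENNReal.ofReal (z ^ 2 * V) * (0 + eLpNorm g 2 ρ) * 0)) := by
      refine ENNReal.Tendsto.mul (ENNReal.Tendsto.const_mul (hlim.add tendsto_const_nhds)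
        (Or.inr ENNReal.ofReal_ne_top)) (Or.inr (by simp)) hlim (Or.inr ?_)
      exact ENNReal.mul_ne_top ENNReal.ofReal_ne_top (by simpa using hg.eLpNorm_ne_top)
    rw [mul_zero] at h1
    exact tendsto_of_tendsto_of_tendsto_of_le_of_le tendsto_const_nhds h1 (fun k => zero_le)
      fun k => (hbound k).trans (mul_le_mul_left (hbd2 k) _)
  refine tendsto_integral_of_L1' _ hintg.1 ?_ hzero
  filter_upwards [hzero.eventually (gt_mem_nhds one_pos)] with k hk
  have : MemLp ((fun s => levyExponent μ (z * S k s)) - fun s => levyExponent μ (z * g s)) 1 ρ :=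
    ⟨(hψS k).sub hψg, hk.trans ENNReal.one_lt_top⟩
  simpa using (memLp_one_iff_integrable.mp this).add hintg

/-- The characteristic function of `∫_I g dZ`. -/
theorem charFun_levyIntegral {Ω : Type*} [MeasurableSpace Ω] {P : Measure Ω}
    [IsProbabilityMeasure P] {μ : Measure ℝ} (hμ : Integrable (fun y : ℝ => y ^ 2) μ)
    {I : Set ℝ} (hI : I.OrdConnected) {Z : I → Ω → ℝ} (hZ : IsLevyProcess P μ I Z) {g : ℝ → ℝ}
    (hg : MemLp g 2 (volume.restrict I)) {Y : Ω → ℝ} (hY : IsLevyIntegral P I Z g Y) (z : ℝ) :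
    charFun (P.map Y) z = Complex.exp (∫ s in I, levyExponent μ (z * g s)) := by
  obtain ⟨hYm, S, hS, hlim⟩ := hY
  have hSm : ∀ k, AEMeasurable ((S k).integral Z) P := fun k =>
    (Finset.measurable_sum _ fun i _ =>
      ((hZ.measurable _).sub (hZ.measurable _)).const_mul _).aemeasurable
  have h1 := (hlim.tendstoInDistribution_of_aemeasurable hSm hYm).tendsto
  have h2 := ProbabilityMeasure.tendsto_iff_tendsto_charFun.mp h1 z
  simp only [ProbabilityMeasure.coe_mk] at h2
  simp_rw [charFun_stepKernel hI hZ] at h2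
  exact tendsto_nhds_unique h2 ((Complex.continuous_exp.tendsto _).comp
    (tendsto_integral_levyExponent hμ hg (fun k => (S k).measurable_toFun) hS z))

/-! ### The jump measure of the integral -/

lemma IsLevyMeasure.sigmaFinite {μ : Measure ℝ} (hμ : IsLevyMeasure μ) : SigmaFinite μ := by
  refine ⟨⟨⟨fun n => {0} ∪ {u | ENNReal.ofReal ((n : ℝ) + 1)⁻¹ ≤ ENNReal.ofReal (min 1 (u ^ 2))},
    fun _ => trivial, fun n => ?_, ?_⟩⟩⟩
  · refine (measure_union_le _ _).trans_lt ?_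
    rw [hμ.1, zero_add]
    refine (meas_ge_le_lintegral_div (by fun_prop) ?_ ENNReal.ofReal_ne_top).trans_lt ?_
    · simp; positivity
    · exact ENNReal.div_lt_top hμ.2.ne (by simp; positivity)
  · refine eq_univ_of_forall fun u => ?_
    rw [mem_iUnion]
    rcases eq_or_ne u 0 with rfl | hu
    · exact ⟨0, Or.inl rfl⟩
    · have h1 : Tendsto (fun n : ℕ => ((n : ℝ) + 1)⁻¹) atTop (𝓝 0) := by
        simpa using tendsto_one_div_add_atTop_nhds_zero_nat (𝕜 := ℝ)
      obtain ⟨n, hn⟩ := (h1.eventually (gt_mem_nhds (show 0 < min 1 (u ^ 2) by positivity))).exists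
      exact ⟨n, Or.inr (ENNReal.ofReal_le_ofReal (le_of_lt hn))⟩

/-- All exponential moments of the large jumps are finite. The weight `y²` makes the condition one
on the whole measure, including the small jumps, and insensitive to mass at the origin. -/
def HasExpMoments (ν : Measure ℝ) : Prop :=
  ∀ c : ℝ, Integrable (fun y : ℝ => y ^ 2 * Real.exp (c * |y|)) ν

lemma IsLevyMeasure.hasExpMoments {μ : Measure ℝ} (hμ : IsLevyMeasure μ) (h : ExpIntegrable μ) :
    HasExpMoments μ := by
  intro c
  have hs : MeasurableSet {y : ℝ | 1 ≤ |y|} := measurableSet_le (by fun_prop) (by fun_prop)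
  have h0 : Integrable (fun u : ℝ => min 1 (u ^ 2)) μ := by
    refine ⟨by fun_prop, ?_⟩
    rw [hasFiniteIntegral_iff_ofReal (ae_of_all _ fun u => by positivity)]
    exact hμ.2
  rw [← integrableOn_univ, ← union_compl_self {y : ℝ | 1 ≤ |y|}]
  refine IntegrableOn.union ?_ ?_
  · refine Integrable.mono' (((h (|c| + 1)).add (h (-(|c| + 1)))).const_mul 2) (by fun_prop) ?_
    refine ae_of_all _ fun y => ?_
    rw [Real.norm_eq_abs, abs_of_nonneg (by positivity)]
    have h1 : y ^ 2 ≤ 2 * Real.exp |y| := by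
      have := Real.quadratic_le_exp_of_nonneg (abs_nonneg y)
      rw [sq_abs] at this
      linarith [abs_nonneg y]
    have h2 : Real.exp (c * |y|) ≤ Real.exp (|c| * |y|) :=
      Real.exp_le_exp.mpr (mul_le_mul_of_nonneg_right (le_abs_self c) (abs_nonneg y))
    have h3 : Real.exp |y| * Real.exp (|c| * |y|) ≤ Real.exp ((|c| + 1) * y)
        + Real.exp (-(|c| + 1) * y) := by
      rw [← Real.exp_add]
      rcases abs_cases y with ⟨hy, _⟩ | ⟨hy, _⟩ <;> rw [hy]
      · have : y + |c| * y = (|c| + 1) * y := by ring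
        rw [this]; linarith [Real.exp_pos (-(|c| + 1) * y)]
      · have : -y + |c| * -y = -(|c| + 1) * y := by ring
        rw [this]; linarith [Real.exp_pos ((|c| + 1) * y)]
    calc y ^ 2 * Real.exp (c * |y|) ≤ (2 * Real.exp |y|) * Real.exp (|c| * |y|) := by gcongr
      _ = 2 * (Real.exp |y| * Real.exp (|c| * |y|)) := by ring
      _ ≤ _ := by simp only [Pi.add_apply]; linarith
  · refine Integrable.mono' ((h0.const_mul (Real.exp |c|)).integrableOn) (by fun_prop) ?_
    refine (ae_restrict_iff' hs.compl).mpr (ae_of_all _ fun y hy => ?_)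
    simp only [mem_compl_iff, mem_ofPred_eq, not_le] at hy
    rw [Real.norm_eq_abs, abs_of_nonneg (by positivity), min_eq_right, mul_comm]
    · gcongr
      calc c * |y| ≤ |c| * |y| := mul_le_mul_of_nonneg_right (le_abs_self c) (abs_nonneg y)
        _ ≤ |c| := mul_le_of_le_one_right (abs_nonneg c) hy.le
    · rw [← sq_abs]; exact pow_le_one₀ (abs_nonneg y) hy.le

lemma HasExpMoments.integrable_sq {ν : Measure ℝ} (h : HasExpMoments ν) :
    Integrable (fun y : ℝ => y ^ 2) ν := by simpa using h 0

lemma HasExpMoments.mono {ν ν' : Measure ℝ} (h : HasExpMoments ν) (h' : ν' ≤ ν) :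
    HasExpMoments ν' := fun c => (h c).mono_measure h'

lemma HasExpMoments.smul {ν : Measure ℝ} (h : HasExpMoments ν) {c : ℝ≥0∞} (hc : c ≠ ⊤) :
    HasExpMoments (c • ν) := fun a => (h a).smul_measure hc

/-- The measure `∫ μ(f(s)⁻¹ ·) ds` of jumps of `∫ f dZ`. It may charge the origin with infinite
mass where `f` vanishes; all integrands that occur vanish at the origin. -/
noncomputable def kernelMeasure (μ : Measure ℝ) (f : ℝ → ℝ) : Measure ℝ :=
  (μ.prod volume).map fun p : ℝ × ℝ => p.1 * f p.2

lemma hasExpMoments_kernelMeasure {μ : Measure ℝ} [SFinite μ] (hμ : HasExpMoments μ) {f : ℝ → ℝ}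
    (hf : KernelAssumptions f) : HasExpMoments (kernelMeasure μ f) := by
  have hfm := hf.measurable
  intro c
  rw [kernelMeasure, integrable_map_measure (by fun_prop) (by fun_prop)]
  obtain ⟨C, hC⟩ := hf.bounded
  refine ((hμ (|c| * C)).mul_prod hf.sq_integrable).mono'
    (Measurable.aestronglyMeasurable (by fun_prop)) (ae_of_all _ fun p => ?_)
  simp only [Function.comp_apply]
  rw [Real.norm_eq_abs, abs_of_nonneg (by positivity), abs_mul, mul_pow]
  have h1 : c * (|p.1| * |f p.2|) ≤ |c| * C * |p.1| := by
    calc c * (|p.1| * |f p.2|) ≤ |c| * (|p.1| * C) := by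
          gcongr
          · exact le_abs_self c
          · exact hC _
      _ = _ := by ring
  calc p.1 ^ 2 * f p.2 ^ 2 * Real.exp (c * (|p.1| * |f p.2|))
      ≤ p.1 ^ 2 * f p.2 ^ 2 * Real.exp (|c| * C * |p.1|) := by gcongr
    _ = _ := by ring

lemma integrable_expRem_prod {μ : Measure ℝ} [SFinite μ] (hμ : HasExpMoments μ) {f : ℝ → ℝ}
    (hf : KernelAssumptions f) (z : ℝ) :
    Integrable (fun p : ℝ × ℝ => expRem (z * (p.1 * f p.2))) (μ.prod volume) := by
  have hfm := hf.measurable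
  have := integrable_expRem (hasExpMoments_kernelMeasure hμ hf).integrable_sq z
  rw [kernelMeasure, integrable_map_measure (Continuous.aestronglyMeasurable (by fun_prop))
    (by fun_prop)] at this
  exact this

lemma levyExponent_kernelMeasure {μ : Measure ℝ} [SFinite μ] (hμ : HasExpMoments μ) {f : ℝ → ℝ}
    (hf : KernelAssumptions f) (z : ℝ) :
    levyExponent (kernelMeasure μ f) z = ∫ s, levyExponent μ (z * f s) := by
  have hfm := hf.measurable
  rw [levyExponent_eq, kernelMeasure, integral_map (by fun_prop)
    (Continuous.aestronglyMeasurable (by fun_prop)),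
    integral_prod_symm _ (integrable_expRem_prod hμ hf z)]
  congr 1
  ext s
  rw [levyExponent_eq]
  congr 1
  ext u
  congr 1
  ring

/-- The characteristic function of the rescaled kernel integral. -/
theorem charFun_scaledIntegral {Ω : Type*} [MeasurableSpace Ω] {P : Measure Ω}
    [IsProbabilityMeasure P] {μ : Measure ℝ} [SFinite μ] (hμ : HasExpMoments μ)
    {I : Set ℝ} (hI : I.OrdConnected) {Z : I → Ω → ℝ} (hZ : IsLevyProcess P μ I Z) {f : ℝ → ℝ}
    (hf : KernelAssumptions f) {θ χ : ℝ} (hθ : 0 < θ) (hsupp : ∀ s, s ∉ I → f (s / θ) = 0)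
    {Y : Ω → ℝ} (hY : IsLevyIntegral P I Z (fun s => χ * f (s / θ)) Y) (z : ℝ) :
    charFun (P.map Y) z = Complex.exp (θ * levyExponent (kernelMeasure μ f) (χ * z)) := by
  have hfm := hf.measurable
  have hmem : MemLp (fun s => χ * f (s / θ)) 2 (volume.restrict I) := by
    rw [memLp_two_iff_integrable_sq (Measurable.aestronglyMeasurable (by fun_prop))]
    have h1 := ((hf.sq_integrable.comp_div hθ.ne').const_mul (χ ^ 2)).integrableOn (s := I)
    simpa only [mul_pow, IntegrableOn] using h1
  rw [charFun_levyIntegral hμ.integrable_sq hI hZ hmem hY z]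
  congr 1
  rw [setIntegral_eq_integral_of_forall_compl_eq_zero (fun s hs => by
    rw [hsupp s hs]; simp [levyExponent_zero])]
  rw [Measure.integral_comp_div (fun s => levyExponent μ (z * (χ * f s))) θ, abs_of_pos hθ,
    levyExponent_kernelMeasure hμ hf, Complex.real_smul]
  congr 2
  ext s
  congr 1
  ring

/-! ### Decay of characteristic functions: general facts -/

/-- The growth condition on the Lévy measure `ν` which makes `exp (s · levyExponent ν z)` decay
faster than any power of `|z|`, for every `s > 0`. -/
def CosDecay (ν : Measure ℝ) : Prop :=
  (fun z : ℝ => Real.log |z|) =o[Bornology.cobounded ℝ] fun z : ℝ => ∫ y, (1 - Real.cos (z * y)) ∂ν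

lemma one_sub_cos_nonneg (x : ℝ) : 0 ≤ 1 - Real.cos x := by linarith [Real.cos_le_one x]

lemma one_sub_cos_le_sq (x : ℝ) : 1 - Real.cos x ≤ x ^ 2 := by
  nlinarith [Real.one_sub_sq_div_two_le_cos (x := x), sq_nonneg x]

lemma integrable_one_sub_cos {ν : Measure ℝ} (hν : Integrable (fun y : ℝ => y ^ 2) ν) (z : ℝ) :
    Integrable (fun y => 1 - Real.cos (z * y)) ν := by
  refine (hν.const_mul (z ^ 2)).mono' (by fun_prop) (ae_of_all _ fun y => ?_)
  rw [Real.norm_eq_abs, abs_of_nonneg (one_sub_cos_nonneg _)]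
  simpa [mul_pow] using one_sub_cos_le_sq (z * y)

lemma tendsto_log_abs_cobounded :
    Tendsto (fun z : ℝ => Real.log |z|) (Bornology.cobounded ℝ) atTop :=
  Real.tendsto_log_atTop.comp tendsto_norm_cobounded_atTop

/-- The cosine integral necessarily tends to infinity, so that bounded errors are harmless. -/
lemma CosDecay.of_le_add {ν ν' : Measure ℝ} (h : CosDecay ν)
    (h' : ∃ C, 0 ≤ C ∧ ∀ z : ℝ, ∫ y, (1 - Real.cos (z * y)) ∂ν
      ≤ (∫ y, (1 - Real.cos (z * y)) ∂ν') + C) : CosDecay ν' := by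
  obtain ⟨C, hC0, hC⟩ := h'
  refine Asymptotics.isLittleO_iff.mpr fun ε hε => ?_
  have h1 := Asymptotics.isLittleO_iff.mp h (show 0 < ε / (1 + ε * C) by positivity)
  filter_upwards [h1, tendsto_log_abs_cobounded.eventually_ge_atTop 1] with z hz hz1
  have n1 : 0 ≤ ∫ y, (1 - Real.cos (z * y)) ∂ν := integral_nonneg fun y => one_sub_cos_nonneg _
  have n2 : 0 ≤ ∫ y, (1 - Real.cos (z * y)) ∂ν' := integral_nonneg fun y => one_sub_cos_nonneg _
  rw [Real.norm_eq_abs, Real.norm_eq_abs, abs_of_nonneg (by linarith), abs_of_nonneg n1,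
    div_mul_eq_mul_div, le_div_iff₀ (by positivity)] at hz
  rw [Real.norm_eq_abs, Real.norm_eq_abs, abs_of_nonneg (by linarith), abs_of_nonneg n2]
  have h2 := mul_le_mul_of_nonneg_left (hC z) hε.le
  have h3 : ε * C ≤ Real.log |z| * (ε * C) := le_mul_of_one_le_left (by positivity) hz1
  nlinarith

lemma CosDecay.mono {ν ν' : Measure ℝ} (h : CosDecay ν) (hle : ν ≤ ν')
    (hν' : Integrable (fun y : ℝ => y ^ 2) ν') : CosDecay ν' :=
  h.of_le_add ⟨0, le_rfl, fun z => by
    rw [add_zero]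
    exact integral_mono_measure hle (ae_of_all _ fun y => one_sub_cos_nonneg _)
      (integrable_one_sub_cos hν' z)⟩

/-- Removing finitely much mass does not affect the decay. -/
lemma CosDecay.restrict {ν : Measure ℝ} (h : CosDecay ν) (hν : Integrable (fun y : ℝ => y ^ 2) ν)
    {S : Set ℝ} (hS : MeasurableSet S) (hfin : ν Sᶜ ≠ ⊤) : CosDecay (ν.restrict S) := by
  refine h.of_le_add ⟨2 * ν.real Sᶜ, by positivity, fun z => ?_⟩
  rw [← integral_add_compl hS (integrable_one_sub_cos hν z)]
  refine add_le_add_right ?_ _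
  have : ∫ y in Sᶜ, (1 - Real.cos (z * y)) ∂ν ≤ ∫ y in Sᶜ, (2 : ℝ) ∂ν :=
    integral_mono (integrable_one_sub_cos hν z).integrableOn (integrableOn_const hfin)
      fun y => by linarith [Real.neg_one_le_cos (z * y)]
  rw [setIntegral_const, smul_eq_mul] at this
  linarith

/-- A jump measure on the positive half-line with cosine decay has arbitrarily small jumps. -/
lemma CosDecay.pos_Ioo {ν : Measure ℝ} (h : CosDecay (ν.restrict (Ioi 0)))
    (hν : Integrable (fun y : ℝ => y ^ 2) ν) {ε : ℝ} (hε : 0 < ε) : 0 < ν (Ioo 0 ε) := by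
  by_contra! hcon
  have h0 : ν (Ioo 0 ε) = 0 := le_antisymm hcon zero_le
  have hfin : ν (Ici ε) < ⊤ := by
    refine lt_of_le_of_lt (measure_mono fun y hy => ?_)
      (hν.measure_norm_ge_lt_top (ε := ε ^ 2) (by positivity))
    simp only [mem_Ici] at hy
    simp only [Real.norm_eq_abs, abs_pow, sq_abs, mem_ofPred_eq]
    exact pow_le_pow_left₀ hε.le hy 2
  have hfin' : ν (Ioi 0) < ⊤ := by
    rw [← Ioo_union_Ici_eq_Ioi hε]
    exact (measure_union_le _ _).trans_lt (by rw [h0, zero_add]; exact hfin)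
  have hb : ∀ z : ℝ, ∫ y in Ioi 0, (1 - Real.cos (z * y)) ∂ν ≤ 2 * ν.real (Ioi 0) := by
    intro z
    have : ∫ y in Ioi 0, (1 - Real.cos (z * y)) ∂ν ≤ ∫ y in Ioi 0, (2 : ℝ) ∂ν :=
      integral_mono (integrable_one_sub_cos hν z).integrableOn (integrableOn_const hfin'.ne)
        fun y => by linarith [Real.neg_one_le_cos (z * y)]
    rw [setIntegral_const, smul_eq_mul] at this
    linarith
  have h1 := Asymptotics.isLittleO_iff.mp h one_pos
  obtain ⟨z, hz1, hz2⟩ := (h1.and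
    (tendsto_log_abs_cobounded.eventually_gt_atTop (2 * ν.real (Ioi 0)))).exists
  have n1 : 0 ≤ ∫ y in Ioi 0, (1 - Real.cos (z * y)) ∂ν :=
    integral_nonneg fun y => one_sub_cos_nonneg _
  rw [Real.norm_eq_abs, Real.norm_eq_abs, abs_of_nonneg n1, one_mul] at hz1
  linarith [le_abs_self (Real.log |z|), hb z]

lemma norm_exp_levyExponent {ν : Measure ℝ} (hν : Integrable (fun y : ℝ => y ^ 2) ν) (s z : ℝ) :
    ‖Complex.exp (s * levyExponent ν z)‖ = Real.exp (-s * ∫ y, (1 - Real.cos (z * y)) ∂ν) := by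
  rw [Complex.norm_exp, Complex.re_ofReal_mul, re_levyExponent hν]
  congr 1
  ring

/-- Under the decay condition the characteristic functions decay faster than any power. -/
lemma CosDecay.integrable_pow_mul_norm {ν : Measure ℝ} (h : CosDecay ν)
    (hν : Integrable (fun y : ℝ => y ^ 2) ν) {s : ℝ} (hs : 0 < s) (k : ℕ) :
    Integrable fun z : ℝ => |z| ^ k * ‖Complex.exp (s * levyExponent ν z)‖ := by
  have hcont : Continuous fun z : ℝ => |z| ^ k * ‖Complex.exp (s * levyExponent ν z)‖ := by
    have := continuous_levyExponent hν
    fun_prop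
  refine (hcont.locallyIntegrable).integrable_of_isBigO_cocompact (g := fun z : ℝ => (1 + z ^ 2)⁻¹)
    ?_ (integrable_inv_one_add_sq.integrableAtFilter _)
  rw [← Metric.cobounded_eq_cocompact]
  refine Asymptotics.IsBigO.of_bound 2 ?_
  have h1 := Asymptotics.isLittleO_iff.mp h (show 0 < s / (k + 2) by positivity)
  filter_upwards [h1, tendsto_norm_cobounded_atTop.eventually_ge_atTop (1 : ℝ)] with z hz hz1
  rw [Real.norm_eq_abs] at hz1
  have hzpos : 0 < |z| := by linarith
  have n1 : 0 ≤ ∫ y, (1 - Real.cos (z * y)) ∂ν := integral_nonneg fun y => one_sub_cos_nonneg _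
  rw [Real.norm_eq_abs, Real.norm_eq_abs, abs_of_nonneg (Real.log_nonneg hz1), abs_of_nonneg n1,
    div_mul_eq_mul_div, le_div_iff₀ (by positivity)] at hz
  rw [norm_exp_levyExponent hν, Real.norm_eq_abs, Real.norm_eq_abs,
    abs_of_nonneg (show 0 ≤ |z| ^ k * Real.exp _ by positivity),
    abs_of_nonneg (show 0 ≤ (1 + z ^ 2)⁻¹ by positivity)]
  have h2 : Real.exp (-s * ∫ y, (1 - Real.cos (z * y)) ∂ν) ≤ (|z| ^ (k + 2))⁻¹ := by
    rw [← Real.exp_log (show 0 < (|z| ^ (k + 2))⁻¹ by positivity), Real.log_inv, Real.log_pow,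
      Real.exp_le_exp]
    push_cast
    linarith
  calc |z| ^ k * Real.exp (-s * ∫ y, (1 - Real.cos (z * y)) ∂ν)
      ≤ |z| ^ k * (|z| ^ (k + 2))⁻¹ := by gcongr
    _ = (z ^ 2)⁻¹ := by rw [pow_add, sq_abs]; field_simp
    _ ≤ 2 * (1 + z ^ 2)⁻¹ := by
      have : 1 ≤ z ^ 2 := by rw [← sq_abs]; exact one_le_pow₀ hz1
      rw [inv_eq_one_div, ← div_eq_mul_inv, div_le_div_iff₀ (by linarith) (by positivity)]
      linarith

/-! ### Decay of characteristic functions: the four cases -/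

/-- The contribution `∫ (1 - cos (w f(s))) ds` of the kernel to the decay. -/
noncomputable def kernelCos (f : ℝ → ℝ) (w : ℝ) : ℝ := ∫ s, (1 - Real.cos (w * f s))

lemma kernelCos_nonneg (f : ℝ → ℝ) (w : ℝ) : 0 ≤ kernelCos f w :=
  integral_nonneg fun _ => one_sub_cos_nonneg _

lemma KernelAssumptions.integrable_one_sub_cos {f : ℝ → ℝ} (hf : KernelAssumptions f) (w : ℝ) :
    Integrable fun s => 1 - Real.cos (w * f s) := by
  have hfm := hf.measurable
  refine (hf.sq_integrable.const_mul (w ^ 2)).mono' (Measurable.aestronglyMeasurable (by fun_prop))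
    (ae_of_all _ fun s => ?_)
  rw [Real.norm_eq_abs, abs_of_nonneg (one_sub_cos_nonneg _)]
  simpa [mul_pow] using one_sub_cos_le_sq (w * f s)

lemma KernelAssumptions.setIntegral_le_kernelCos {f : ℝ → ℝ} (hf : KernelAssumptions f) (w : ℝ)
    (S : Set ℝ) : ∫ s in S, (1 - Real.cos (w * f s)) ≤ kernelCos f w :=
  setIntegral_le_integral (hf.integrable_one_sub_cos w) (ae_of_all _ fun _ => one_sub_cos_nonneg _)

/-- The positive jumps of the integral come from the positive jumps of the process, because the
kernel is nonnegative; Fubini's theorem turns their cosine integral into one of `kernelCos f`. -/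
lemma integral_cos_kernelMeasure {μ : Measure ℝ} [SFinite μ] (hμ : HasExpMoments μ) {f : ℝ → ℝ}
    (hf : KernelAssumptions f) (z : ℝ) :
    Integrable (fun u => kernelCos f (z * u)) (μ.restrict (Ioi 0)) ∧
    ∫ y in Ioi 0, (1 - Real.cos (z * y)) ∂(kernelMeasure μ f)
      = ∫ u in Ioi 0, kernelCos f (z * u) ∂μ := by
  have hfm := hf.measurable
  have hint := integrable_one_sub_cos (hasExpMoments_kernelMeasure hμ hf).integrable_sq z
  rw [kernelMeasure, integrable_map_measure (by fun_prop) (by fun_prop)] at hint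
  have hint' : Integrable (fun p : ℝ × ℝ => 1 - Real.cos (z * (p.1 * f p.2)))
      ((μ.restrict (Ioi 0)).prod volume) := by
    refine Integrable.mono_measure hint ?_
    rw [← Measure.restrict_univ (μ := (volume : Measure ℝ)), Measure.prod_restrict]
    exact Measure.restrict_le_self.trans_eq (by rw [Measure.restrict_univ])
  have hk : ∀ u, ∫ s, (1 - Real.cos (z * (u * f s))) = kernelCos f (z * u) := fun u => by
    simp only [kernelCos, mul_assoc]
  refine ⟨by simpa only [hk] using hint'.integral_prod_left, ?_⟩
  rw [kernelMeasure, setIntegral_map measurableSet_Ioi (by fun_prop) (by fun_prop)]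
  simp_rw [← hk]
  rw [← integral_prod _ hint', ← Measure.restrict_univ (μ := (volume : Measure ℝ)),
    Measure.prod_restrict, Measure.restrict_univ,
    ← integral_indicator (measurableSet_Ioi.preimage (by fun_prop)),
    ← integral_indicator (measurableSet_Ioi.prod MeasurableSet.univ)]
  congr 1
  ext p
  -- the two domains of integration differ only where the integrand vanishes
  rcases eq_or_ne (f p.2) 0 with h0 | h0
  · simp [indicator_apply, h0]
  · have hpos : 0 < f p.2 := lt_of_le_of_ne (hf.nonneg _) h0.symm
    have e : p ∈ (fun p : ℝ × ℝ => p.1 * f p.2) ⁻¹' Ioi 0 ↔ p ∈ Ioi (0 : ℝ) ×ˢ (univ : Set ℝ) := by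
      simp [hpos]
    by_cases hp : p ∈ Ioi (0 : ℝ) ×ˢ (univ : Set ℝ)
    · rw [indicator_of_mem hp, indicator_of_mem (e.mpr hp)]
    · rw [indicator_of_notMem hp, indicator_of_notMem (mt e.mp hp)]

/-- If `f ≤ C`, then `1 - cos (z u f(s)) ≥ (2/π²) (z u f(s))²` for all `|u| ≤ 1 / |C z|`, and
Kallenberg's condition can be used at `C z`. -/
lemma cosDecay_of_kallenberg {μ : Measure ℝ} [SFinite μ] (hμ : HasExpMoments μ) {f : ℝ → ℝ}
    (hf : KernelAssumptions f) (h : CondN1 μ) :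
    CosDecay ((kernelMeasure μ f).restrict (Ioi 0)) := by
  obtain ⟨C₀, hC₀⟩ := hf.bounded
  obtain ⟨C, hC1, hC⟩ : ∃ C : ℝ, 1 ≤ C ∧ ∀ s, |f s| ≤ C :=
    ⟨max C₀ 1, le_max_right _ _, fun s => (hC₀ s).trans (le_max_left _ _)⟩
  have hf2 : 0 < ∫ s, f s ^ 2 := by
    have := hf.nondegenerate
    simpa only [max_eq_left (hf.nonneg _)] using this
  set A := ∫ s, f s ^ 2 with hA
  have htend : Tendsto (fun z : ℝ => C * z) (Bornology.cobounded ℝ) (Bornology.cobounded ℝ) := by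
    rw [← tendsto_norm_atTop_iff_cobounded]
    simp_rw [norm_mul]
    exact tendsto_norm_cobounded_atTop.const_mul_atTop (by rw [Real.norm_eq_abs]; positivity)
  have h1 := (h : _ =o[_] _).comp_tendsto htend
  unfold CosDecay
  refine Asymptotics.IsBigO.trans_isLittleO (g := fun z : ℝ => Real.log |C * z|) ?_
    (Asymptotics.IsLittleO.trans_isBigO h1 ?_)
  · refine Asymptotics.IsBigO.of_bound 1 ?_
    filter_upwards [tendsto_norm_cobounded_atTop.eventually_ge_atTop (1 : ℝ)] with z hz
    rw [Real.norm_eq_abs] at hz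
    have h2 : |z| ≤ |C * z| := by
      rw [abs_mul]; exact le_mul_of_one_le_left (abs_nonneg _) (hC1.trans (le_abs_self _))
    rw [one_mul, Real.norm_eq_abs, Real.norm_eq_abs, abs_of_nonneg (Real.log_nonneg hz),
      abs_of_nonneg (Real.log_nonneg (hz.trans h2))]
    exact Real.log_le_log (by linarith) h2
  · refine Asymptotics.IsBigO.of_bound (C ^ 2 / (2 / Real.pi ^ 2 * A)) (Eventually.of_forall fun z => ?_)
    have hc : 0 < 2 / Real.pi ^ 2 * A := by positivity
    simp only [Function.comp_apply]
    rw [(integral_cos_kernelMeasure hμ hf z).2, Real.norm_eq_abs, Real.norm_eq_abs,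
      abs_of_nonneg (integral_nonneg fun _ => sq_nonneg _),
      abs_of_nonneg (integral_nonneg fun _ => kernelCos_nonneg _ _), div_mul_eq_mul_div,
      le_div_iff₀ hc]
    set S : Set ℝ := {u : ℝ | |u| ≤ |C * z|⁻¹} with hS
    have hSm : MeasurableSet S := measurableSet_le (by fun_prop) (by fun_prop)
    have hpt : ∀ u ∈ S, (2 / Real.pi ^ 2 * A) * z ^ 2 * u ^ 2 ≤ kernelCos f (z * u) := by
      intro u hu
      have h3 : ∀ s, (2 / Real.pi ^ 2 * z ^ 2 * u ^ 2) * f s ^ 2 ≤ 1 - Real.cos (z * u * f s) := by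
        intro s
        have h4 : |z * u * f s| ≤ Real.pi := by
          have h5 : |z * u * f s| ≤ |C * z| * |u| := by
            rw [abs_mul, abs_mul, abs_mul, abs_of_pos (show 0 < C by linarith)]
            calc |z| * |u| * |f s| ≤ |z| * |u| * C := by gcongr; exact hC s
              _ = _ := by ring
          have h6 : |C * z| * |u| ≤ 1 := by
            calc |C * z| * |u| ≤ |C * z| * |C * z|⁻¹ := by gcongr; exact hu
              _ ≤ 1 := mul_inv_le_one
          linarith [Real.pi_gt_three]
        have := Real.cos_le_one_sub_mul_cos_sq h4
        calc _ = 2 / Real.pi ^ 2 * (z * u * f s) ^ 2 := by ring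
          _ ≤ _ := by linarith
      calc (2 / Real.pi ^ 2 * A) * z ^ 2 * u ^ 2
          = ∫ s, (2 / Real.pi ^ 2 * z ^ 2 * u ^ 2) * f s ^ 2 := by rw [integral_const_mul]; ring
        _ ≤ kernelCos f (z * u) := integral_mono (hf.sq_integrable.const_mul _)
            (hf.integrable_one_sub_cos _) h3
    calc (∫ u in S, (u * (C * z)) ^ 2 ∂(μ.restrict (Ioi 0))) * (2 / Real.pi ^ 2 * A)
        = C ^ 2 * ∫ u in S, (2 / Real.pi ^ 2 * A) * z ^ 2 * u ^ 2 ∂(μ.restrict (Ioi 0)) := by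
          have e : ∀ B : ℝ, (∫ u in S, (u * (C * z)) ^ 2 ∂(μ.restrict (Ioi 0))) * B
              = C ^ 2 * ∫ u in S, B * z ^ 2 * u ^ 2 ∂(μ.restrict (Ioi 0)) := fun B => by
            rw [← integral_mul_const, ← integral_const_mul]
            exact integral_congr_ae (ae_of_all _ fun u => by ring)
          exact e _
      _ ≤ C ^ 2 * ∫ u in S, kernelCos f (z * u) ∂(μ.restrict (Ioi 0)) := by
          refine mul_le_mul_of_nonneg_left (setIntegral_mono_on ?_ ?_ hSm hpt) (sq_nonneg C)
          · exact ((hμ.integrable_sq.restrict).const_mul _).integrableOn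
          · exact (integral_cos_kernelMeasure hμ hf z).1.integrableOn
      _ ≤ C ^ 2 * ∫ u in Ioi 0, kernelCos f (z * u) ∂μ :=
          mul_le_mul_of_nonneg_left (setIntegral_le_integral (integral_cos_kernelMeasure hμ hf z).1
            (ae_of_all _ fun u => kernelCos_nonneg _ _)) (sq_nonneg C)

/-- `|sin x| / |x|` stays away from `1` away from the origin. -/
lemma abs_sin_le_mul (x : ℝ) : |Real.sin x| ≤ |x| * (1 - min (x ^ 2) 1 / (2 * Real.pi ^ 2)) := by
  have hpi := Real.pi_gt_three
  have hm : min (x ^ 2) 1 / (2 * Real.pi ^ 2) ≤ 1 / 2 := by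
    rw [div_le_div_iff₀ (by positivity) (by norm_num)]
    nlinarith [min_le_right (x ^ 2) 1]
  rcases le_or_gt |x| 2 with hx | hx
  · have h1 : |x / 2| ≤ Real.pi := by rw [abs_div, abs_two]; linarith
    have h2 := Real.cos_le_one_sub_mul_cos_sq h1
    have h3 : 0 ≤ Real.cos (x / 2) := by
      refine Real.cos_nonneg_of_neg_pi_div_two_le_of_le ?_ ?_ <;>
      · have := abs_le.mp hx
        linarith
    have h4 : Real.sin x = 2 * Real.sin (x / 2) * Real.cos (x / 2) := by
      rw [← Real.sin_two_mul]; congr 1; ring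
    rw [h4, abs_mul, abs_mul, abs_two, abs_of_nonneg h3]
    have h5 : 2 * |Real.sin (x / 2)| ≤ |x| := by
      have := Real.abs_sin_le_abs (x := x / 2)
      rw [abs_div, abs_two] at this
      linarith
    refine mul_le_mul h5 (h2.trans ?_) h3 (abs_nonneg x)
    have h6 : min (x ^ 2) 1 / (2 * Real.pi ^ 2) ≤ x ^ 2 / (2 * Real.pi ^ 2) := by
      gcongr; exact min_le_left _ _
    have h7 : 2 / Real.pi ^ 2 * (x / 2) ^ 2 = x ^ 2 / (2 * Real.pi ^ 2) := by field_simp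
    linarith
  · calc |Real.sin x| ≤ 1 := Real.abs_sin_le_one x
      _ ≤ |x| * (1 - min (x ^ 2) 1 / (2 * Real.pi ^ 2)) := by nlinarith

/-- A kernel with a nonvanishing derivative `f'`, `|f'| ≤ D`, on `[a, b]` satisfies
`D ∫ (1 - cos (w f)) ≥ |∫ (1 - cos (w f)) f'|`, and the last integral is elementary. -/
lemma KernelAssumptions.exists_min_le_kernelCos {f : ℝ → ℝ} (hf : KernelAssumptions f)
    (h : CondF2 f) : ∃ c : ℝ, 0 < c ∧ ∀ w, c * min (w ^ 2) 1 ≤ kernelCos f w := by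
  obtain ⟨a, b, hab, -, f', hf'c, hf'⟩ := h
  have hfc : ContinuousOn f (Icc a b) := fun s hs => (hf' s hs).1.continuousWithinAt
  obtain ⟨D₀, hD₀⟩ := isCompact_Icc.exists_bound_of_continuousOn hf'c
  set D := max D₀ 1 with hD
  have hDpos : 0 < D := by positivity
  have hfD : ∀ s ∈ Icc a b, |f' s| ≤ D := fun s hs => (hD₀ s hs).trans (le_max_left _ _)
  have hderiv : ∀ s ∈ Ioo a b, HasDerivAt f (f' s) s := fun s hs =>
    (hf' s (Ioo_subset_Icc_self hs)).1.hasDerivAt (Icc_mem_nhds hs.1 hs.2)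
  -- the increment of `f` over `[a, b]` is not zero, since otherwise `f'` would vanish somewhere
  set Δ := f b - f a with hΔ
  have hΔ0 : Δ ≠ 0 := by
    intro h0
    obtain ⟨s, hs, hs'⟩ := exists_hasDerivAt_eq_slope f f' hab hfc hderiv
    rw [← hΔ, h0, zero_div] at hs'
    exact (hf' s (Ioo_subset_Icc_self hs)).2 hs'
  have hΔpos : 0 < |Δ| := abs_pos.mpr hΔ0
  have key : ∀ w, w ≠ 0 → |Δ| * (min ((w * Δ / 2) ^ 2) 1 / (2 * Real.pi ^ 2)) ≤ D * kernelCos f w := by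
    intro w hw
    have hint : ContinuousOn (fun s => (1 - Real.cos (w * f s)) * f' s) (Icc a b) :=
      (continuousOn_const.sub (Real.continuous_cos.comp_continuousOn
        (continuousOn_const.mul hfc))).mul hf'c
    have hFTC : ∫ s in a..b, (1 - Real.cos (w * f s)) * f' s
        = (f b - Real.sin (w * f b) / w) - (f a - Real.sin (w * f a) / w) := by
      refine intervalIntegral.integral_eq_sub_of_hasDerivAt_of_le hab.le
        (f := fun s => f s - Real.sin (w * f s) / w) ?_ (fun s hs => ?_) ?_
      · exact hfc.sub ((Real.continuous_sin.comp_continuousOn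
          (continuousOn_const.mul hfc)).div_const _)
      · have h1 := hderiv s hs
        have h2 := h1.sub (((h1.const_mul w).sin).div_const w)
        have e : f' s - Real.cos (w * f s) * (w * f' s) / w
            = (1 - Real.cos (w * f s)) * f' s := by field_simp
        rw [← e]
        exact h2
      · exact (hint.mono (by rw [uIcc_of_le hab.le])).intervalIntegrable
    have hle : |∫ s in a..b, (1 - Real.cos (w * f s)) * f' s| ≤ D * kernelCos f w := by
      rw [intervalIntegral.integral_of_le hab.le, ← Real.norm_eq_abs]
      calc ‖∫ s in Ioc a b, (1 - Real.cos (w * f s)) * f' s‖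
          ≤ ∫ s in Ioc a b, D * (1 - Real.cos (w * f s)) := by
            refine norm_integral_le_of_norm_le
              ((hf.integrable_one_sub_cos w).const_mul D).integrableOn
              ((ae_restrict_iff' measurableSet_Ioc).mpr (ae_of_all _ fun s hs => ?_))
            rw [norm_mul, Real.norm_eq_abs, Real.norm_eq_abs, abs_of_nonneg (one_sub_cos_nonneg _),
              mul_comm]
            exact mul_le_mul_of_nonneg_right (hfD s (Ioc_subset_Icc_self hs)) (one_sub_cos_nonneg _)
        _ = D * ∫ s in Ioc a b, (1 - Real.cos (w * f s)) := integral_const_mul _ _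
        _ ≤ D * kernelCos f w := by gcongr; exact hf.setIntegral_le_kernelCos w _
    refine le_trans ?_ hle
    have hsin : |Real.sin (w * f b) - Real.sin (w * f a)| ≤ 2 * |Real.sin (w * Δ / 2)| := by
      rw [Real.sin_sub_sin, abs_mul, abs_mul, abs_two]
      have : (w * f b - w * f a) / 2 = w * Δ / 2 := by rw [hΔ]; ring
      rw [this]
      exact mul_le_of_le_one_right (by positivity) (Real.abs_cos_le_one _)
    have h3 := abs_sin_le_mul (w * Δ / 2)
    set q := min ((w * Δ / 2) ^ 2) 1 / (2 * Real.pi ^ 2) with hq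
    have hwpos : 0 < |w| := abs_pos.mpr hw
    have h4 : |(Real.sin (w * f b) - Real.sin (w * f a)) / w| ≤ |Δ| * (1 - q) := by
      rw [abs_div, div_le_iff₀ hwpos]
      calc _ ≤ 2 * (|w * Δ / 2| * (1 - q)) := hsin.trans (by linarith)
        _ = _ := by rw [abs_div, abs_mul, abs_two]; ring
    rw [hFTC]
    have h5 : (f b - Real.sin (w * f b) / w) - (f a - Real.sin (w * f a) / w)
        = Δ - (Real.sin (w * f b) - Real.sin (w * f a)) / w := by rw [hΔ]; ring
    rw [h5]
    have h6 := abs_sub_abs_le_abs_sub Δ ((Real.sin (w * f b) - Real.sin (w * f a)) / w)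
    nlinarith
  refine ⟨|Δ| * (min ((Δ / 2) ^ 2) 1 / (2 * Real.pi ^ 2)) / D, by positivity, fun w => ?_⟩
  rcases eq_or_ne w 0 with rfl | hw
  · simp [kernelCos]
  have h1 : min ((Δ / 2) ^ 2) 1 * min (w ^ 2) 1 ≤ min ((w * Δ / 2) ^ 2) 1 := by
    refine le_min ?_ ?_
    · calc _ ≤ (Δ / 2) ^ 2 * w ^ 2 := by gcongr <;> exact min_le_left _ _
        _ = _ := by ring
    · exact mul_le_one₀ (min_le_right _ _) (by positivity) (min_le_right _ _)
  rw [div_mul_eq_mul_div, div_le_iff₀ hDpos, mul_comm (kernelCos f w)]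
  calc |Δ| * (min ((Δ / 2) ^ 2) 1 / (2 * Real.pi ^ 2)) * min (w ^ 2) 1
      = |Δ| * ((min ((Δ / 2) ^ 2) 1 * min (w ^ 2) 1) / (2 * Real.pi ^ 2)) := by ring
    _ ≤ |Δ| * (min ((w * Δ / 2) ^ 2) 1 / (2 * Real.pi ^ 2)) := by gcongr
    _ ≤ _ := key w hw

lemma cosDecay_of_weakKallenberg {μ : Measure ℝ} [SFinite μ] (hμ : HasExpMoments μ) {f : ℝ → ℝ}
    (hf : KernelAssumptions f) (h : CondN2 μ) (hF2 : CondF2 f) :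
    CosDecay ((kernelMeasure μ f).restrict (Ioi 0)) := by
  obtain ⟨c, hc, hcf⟩ := hf.exists_min_le_kernelCos hF2
  refine Asymptotics.IsLittleO.trans_isBigO h
    (Asymptotics.IsBigO.of_bound c⁻¹ (Eventually.of_forall fun z => ?_))
  rw [(integral_cos_kernelMeasure hμ hf z).2, Real.norm_eq_abs, Real.norm_eq_abs,
    abs_of_nonneg (integral_nonneg fun _ => by positivity),
    abs_of_nonneg (integral_nonneg fun _ => kernelCos_nonneg _ _), ← div_eq_inv_mul,
    le_div_iff₀ hc, mul_comm, ← integral_const_mul]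
  refine integral_mono ?_ (integral_cos_kernelMeasure hμ hf z).1 fun u => ?_
  · refine (((hμ.integrable_sq.restrict (s := Ioi 0)).const_mul (c * z ^ 2))).mono' (by fun_prop)
      (ae_of_all _ fun u => ?_)
    rw [Real.norm_eq_abs, abs_of_nonneg (by positivity), mul_assoc]
    gcongr
    exact (min_le_left _ _).trans (le_of_eq (by ring))
  · have := hcf (z * u)
    rw [mul_comm u z]
    exact this

/-! ### Decay for slowly decaying convex kernels -/

/-- A bounded convex function on a half-line unbounded to the left is increasing. -/
lemma monotoneOn_of_convexOn_of_bdd {f : ℝ → ℝ} {b C : ℝ} (hf : ConvexOn ℝ (Iic b) f)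
    (hC : ∀ s, |f s| ≤ C) : MonotoneOn f (Iic b) := by
  intro s hs t ht hst
  by_contra! hlt
  have hst' : s < t := lt_of_le_of_ne hst (by rintro rfl; exact lt_irrefl _ hlt)
  set k := (f s - f t) / (t - s) with hk
  have hkpos : 0 < k := div_pos (by linarith) (by linarith)
  set r := s - (2 * C + 1) / k with hr
  have hC0 : 0 ≤ C := (abs_nonneg _).trans (hC 0)
  have hrs : r < s := by rw [hr]; linarith [div_pos (show 0 < 2 * C + 1 by linarith) hkpos]
  have h1 := hf.slope_mono_adjacent (show r ∈ Iic b from (hrs.le.trans hs)) ht hrs hst'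
  have h2 : (f t - f s) / (t - s) = -k := by rw [hk, ← neg_div]; ring
  rw [h2, div_le_iff₀ (by linarith)] at h1
  have h3 : k * (s - r) = 2 * C + 1 := by rw [hr]; field_simp; ring
  linarith [abs_le.mp (hC r), abs_le.mp (hC s)]

/-- A convex increasing phase `g` which starts with a half period where `cos g ≤ 0` spends at least
half of the time where `cos g ≤ 0`: over one period, the second half is passed faster. -/
lemma half_le_integral_period {g : ℝ → ℝ} {b t₀ s : ℝ} (hg : ConvexOn ℝ (Iic b) g)
    (hmono : MonotoneOn g (Iic b)) (hcont : ContinuousOn g (Iic b)) (ht₀ : t₀ ≤ s) (hs : s ≤ b)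
    (n : ℕ) (h0 : g t₀ = Real.pi / 2 + 2 * Real.pi * n)
    (h1 : g s ≤ Real.pi / 2 + 2 * Real.pi * (n + 1)) :
    (s - t₀) / 2 ≤ ∫ x in t₀..s, (1 - Real.cos (g x)) := by
  have hpi := Real.pi_pos
  have hint : ∀ u v, u ≤ v → v ≤ b →
      IntervalIntegrable (fun x => 1 - Real.cos (g x)) volume u v := fun u v huv hv => by
    refine ContinuousOn.intervalIntegrable ?_
    rw [uIcc_of_le huv]
    exact continuousOn_const.sub (Real.continuous_cos.comp_continuousOn
      (hcont.mono fun x hx => hx.2.trans hv))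
  have hgood : ∀ v, t₀ ≤ v → v ≤ b → g v ≤ 3 * Real.pi / 2 + 2 * Real.pi * n →
      v - t₀ ≤ ∫ x in t₀..v, (1 - Real.cos (g x)) := by
    intro v hv hvb hgv
    calc v - t₀ = ∫ x in t₀..v, (1 : ℝ) := by simp
      _ ≤ ∫ x in t₀..v, (1 - Real.cos (g x)) := by
        refine intervalIntegral.integral_mono_on hv (by simp) (hint _ _ hv hvb) fun x hx => ?_
        have hx1 := hmono (show t₀ ∈ Iic b from hv.trans hvb) (show x ∈ Iic b from hx.2.trans hvb) hx.1
        have hx2 := hmono (show x ∈ Iic b from hx.2.trans hvb) (show v ∈ Iic b from hvb) hx.2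
        have : Real.cos (g x) = Real.cos (g x - n * (2 * Real.pi)) :=
          (Real.cos_sub_nat_mul_two_pi _ _).symm
        have h2 : Real.cos (g x - n * (2 * Real.pi)) ≤ 0 :=
          Real.cos_nonpos_of_pi_div_two_le_of_le (by linarith) (by linarith)
        linarith
  rcases le_or_gt (g s) (3 * Real.pi / 2 + 2 * Real.pi * n) with h | h
  · have := hgood s ht₀ hs h
    linarith
  · obtain ⟨t₁, ht₁, hgt₁⟩ := intermediate_value_Icc ht₀ (hcont.mono fun x hx => hx.2.trans hs)
      (show 3 * Real.pi / 2 + 2 * Real.pi * n ∈ Icc (g t₀) (g s) from ⟨by rw [h0]; linarith, h.le⟩)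
    have hlt1 : t₀ < t₁ := lt_of_le_of_ne ht₁.1 (by rintro rfl; linarith)
    have hlt2 : t₁ < s := lt_of_le_of_ne ht₁.2 (by rintro rfl; linarith)
    have hsl := hg.slope_mono_adjacent (show t₀ ∈ Iic b from ht₀.trans hs) hs hlt1 hlt2
    rw [hgt₁, h0, div_le_div_iff₀ (by linarith) (by linarith)] at hsl
    have h3 : s - t₁ ≤ t₁ - t₀ := by
      have h4 : (3 * Real.pi / 2 + 2 * Real.pi * n - (Real.pi / 2 + 2 * Real.pi * n)) * (s - t₁)
          = Real.pi * (s - t₁) := by ring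
      have h5 : (g s - (3 * Real.pi / 2 + 2 * Real.pi * n)) * (t₁ - t₀) ≤ Real.pi * (t₁ - t₀) :=
        mul_le_mul_of_nonneg_right (by linarith) (by linarith)
      exact le_of_mul_le_mul_left (by linarith) hpi
    have h6 := hgood t₁ hlt1.le (hlt2.le.trans hs) hgt₁.le
    have h7 : 0 ≤ ∫ x in t₁..s, (1 - Real.cos (g x)) :=
      intervalIntegral.integral_nonneg hlt2.le fun x _ => one_sub_cos_nonneg _
    rw [← intervalIntegral.integral_add_adjacent_intervals
      (hint t₀ t₁ hlt1.le (hlt2.le.trans hs)) (hint t₁ s hlt2.le hs)]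
    linarith

/-- `half_le_integral_period` added up over the periods of the phase `g`. -/
lemma half_le_integral_one_sub_cos {g : ℝ → ℝ} {b t₀ : ℝ} (hg : ConvexOn ℝ (Iic b) g)
    (hmono : MonotoneOn g (Iic b)) (hcont : ContinuousOn g (Iic b)) (h0 : g t₀ = Real.pi / 2)
    (n : ℕ) {s : ℝ} (ht₀ : t₀ ≤ s) (hs : s ≤ b) (h1 : g s ≤ Real.pi / 2 + 2 * Real.pi * n) :
    (s - t₀) / 2 ≤ ∫ x in t₀..s, (1 - Real.cos (g x)) := by
  have hpi := Real.pi_pos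
  have hint : ∀ u v, u ≤ v → v ≤ b →
      IntervalIntegrable (fun x => 1 - Real.cos (g x)) volume u v := fun u v huv hv => by
    refine ContinuousOn.intervalIntegrable ?_
    rw [uIcc_of_le huv]
    exact continuousOn_const.sub (Real.continuous_cos.comp_continuousOn
      (hcont.mono fun x hx => hx.2.trans hv))
  induction n generalizing s with
  | zero =>
    exact half_le_integral_period hg hmono hcont ht₀ hs 0 (by simpa using h0)
      (h1.trans (by simp; positivity))
  | succ n ih =>
    rcases le_or_gt (g s) (Real.pi / 2 + 2 * Real.pi * n) with h | h
    · exact ih ht₀ hs h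
    · obtain ⟨t, ht, hgt⟩ := intermediate_value_Icc ht₀ (hcont.mono fun x hx => hx.2.trans hs)
        (show Real.pi / 2 + 2 * Real.pi * n ∈ Icc (g t₀) (g s) from
          ⟨by rw [h0]; linarith [show 0 ≤ 2 * Real.pi * (n : ℝ) by positivity], h.le⟩)
      have h2 := ih ht.1 (ht.2.trans hs) hgt.le
      have h3 := half_le_integral_period hg hmono hcont ht.2 hs n hgt (by push_cast at h1; exact h1)
      rw [← intervalIntegral.integral_add_adjacent_intervals (hint t₀ t ht.1 (ht.2.trans hs))
        (hint t s ht.2 hs)]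
      linarith

/-- A convex kernel which decays at most like `e^{γ s}` at `-∞` contributes `log |w| / (2γ)`. -/
lemma KernelAssumptions.exists_log_le_kernelCos {f : ℝ → ℝ} (hf : KernelAssumptions f) {b γ : ℝ}
    (hconv : ConvexOn ℝ (Iio b) f) (hγ : 0 < γ)
    (hlim : Tendsto (fun s => Real.exp (-γ * s) * f s) atBot atTop) :
    ∃ C w₀ : ℝ, 0 < w₀ ∧ ∀ w, w₀ ≤ |w| → Real.log |w| / (2 * γ) - C ≤ kernelCos f w := by
  obtain ⟨C₀, hC₀⟩ := hf.bounded
  have hpi := Real.pi_pos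
  set b' := b - 1 with hb'
  have hsub : Iic b' ⊆ Iio b := fun x hx => by simp only [mem_Iic, mem_Iio] at *; linarith
  have hconv' : ConvexOn ℝ (Iic b') f := hconv.subset hsub (convex_Iic b')
  have hmono := monotoneOn_of_convexOn_of_bdd hconv' hC₀
  have hcont : ContinuousOn f (Iic b') := (hconv.continuousOn isOpen_Iio).mono hsub
  obtain ⟨s₀, hs₀⟩ := eventually_atBot.mp (hlim.eventually_ge_atTop 1)
  set s₁ := min s₀ b' with hs₁
  have hexp : ∀ s ≤ s₁, Real.exp (γ * s) ≤ f s := fun s hs => by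
    have := hs₀ s (hs.trans (min_le_left _ _))
    rwa [neg_mul, Real.exp_neg, ← div_eq_inv_mul, one_le_div (Real.exp_pos _)] at this
  -- by square integrability, `f` takes arbitrarily small values near `-∞`
  have hsmall : ∀ c > 0, ∀ s', ∃ s ≤ s', f s ≤ c := by
    intro c hc s'
    by_contra! hcon
    have h1 : IntegrableOn (fun _ : ℝ => c ^ 2) (Iic s') := by
      refine Integrable.mono' (hf.sq_integrable.integrableOn (s := Iic s')) (by fun_prop)
        ((ae_restrict_iff' measurableSet_Iic).mpr (ae_of_all _ fun s hs => ?_))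
      rw [Real.norm_eq_abs, abs_of_nonneg (sq_nonneg c)]
      exact pow_le_pow_left₀ hc.le (hcon s hs).le 2
    rw [integrableOn_const_iff] at h1
    simp [hc.ne'] at h1
  refine ⟨Real.log (Real.pi / 2) / (2 * γ) - s₁ / 2,
    Real.pi / 2 * Real.exp (-γ * s₁), by positivity, fun w hw => ?_⟩
  have hwpos : 0 < |w| := lt_of_lt_of_le (by positivity) hw
  have hlogw : Real.log (Real.pi / 2) - γ * s₁ ≤ Real.log |w| := by
    have := Real.log_le_log (by positivity) hw
    rwa [Real.log_mul (by positivity) (Real.exp_pos _).ne', Real.log_exp, neg_mul,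
      ← sub_eq_add_neg] at this
  set sw := (Real.log (Real.pi / 2) - Real.log |w|) / γ with hsw
  have hsw1 : sw ≤ s₁ := by rw [hsw, div_le_iff₀ hγ]; linarith
  have hgsw : Real.pi / 2 ≤ |w| * f sw := by
    have h1 := hexp sw hsw1
    have h2 : γ * sw = Real.log (Real.pi / 2) - Real.log |w| := by rw [hsw]; field_simp
    rw [h2, Real.exp_sub, Real.exp_log (by positivity), Real.exp_log hwpos, div_le_iff₀ hwpos] at h1
    linarith
  have hs₁b : s₁ ≤ b' := min_le_right _ _
  obtain ⟨s₂, hs₂, hfs₂⟩ := hsmall (Real.pi / 2 / |w|) (by positivity) sw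
  have hfs₂' : |w| * f s₂ ≤ Real.pi / 2 := by rwa [le_div_iff₀' hwpos] at hfs₂
  have hgconv : ConvexOn ℝ (Iic b') fun s => |w| * f s := by
    simpa using hconv'.smul (abs_nonneg w)
  have hgmono : MonotoneOn (fun s => |w| * f s) (Iic b') := fun x hx y hy hxy =>
    mul_le_mul_of_nonneg_left (hmono hx hy hxy) (abs_nonneg w)
  have hgcont : ContinuousOn (fun s => |w| * f s) (Iic b') := continuousOn_const.mul hcont
  obtain ⟨t₀, ht₀, hgt₀⟩ := intermediate_value_Icc hs₂
    (hgcont.mono fun x hx => hx.2.trans (hsw1.trans hs₁b)) ⟨hfs₂', hgsw⟩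
  obtain ⟨n, hn⟩ := exists_nat_ge (|w| * f s₁)
  have hmain := half_le_integral_one_sub_cos hgconv hgmono hgcont hgt₀ n (ht₀.2.trans hsw1) hs₁b (by
    have : (n : ℝ) ≤ 2 * Real.pi * n := le_mul_of_one_le_left (by positivity)
      (by linarith [Real.pi_gt_three])
    linarith)
  rw [intervalIntegral.integral_of_le (ht₀.2.trans hsw1)] at hmain
  have hcos : ∀ x, Real.cos (|w| * f x) = Real.cos (w * f x) := fun x => by
    rcases abs_choice w with h | h <;> rw [h]
    rw [neg_mul, Real.cos_neg]
  simp_rw [hcos] at hmain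
  have hfin := hf.setIntegral_le_kernelCos w (Ioc t₀ s₁)
  have h9 : (s₁ - sw) / 2 ≤ (s₁ - t₀) / 2 := by linarith [ht₀.2]
  have h10 : (s₁ - sw) / 2 = Real.log |w| / (2 * γ) - (Real.log (Real.pi / 2) / (2 * γ) - s₁ / 2) := by
    rw [hsw]; field_simp; ring
  linarith

lemma HasExpMoments.measure_Ici_lt_top {μ : Measure ℝ} (hμ : HasExpMoments μ) {η : ℝ}
    (hη : 0 < η) : μ (Ici η) < ⊤ := by
  refine lt_of_le_of_lt (measure_mono fun y hy => ?_)
    (hμ.integrable_sq.measure_norm_ge_lt_top (ε := η ^ 2) (by positivity))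
  simp only [mem_Ici] at hy
  simp only [Real.norm_eq_abs, abs_pow, sq_abs, mem_ofPred_eq]
  exact pow_le_pow_left₀ hη.le hy 2

/-- Decay for convex kernels, with the mass of the large jumps and the rate of decay of the kernel
balanced in the hypothesis. -/
lemma cosDecay_of_convex {μ : Measure ℝ} [SFinite μ] (hμ : HasExpMoments μ) {f : ℝ → ℝ}
    (hf : KernelAssumptions f) {b : ℝ} (hconv : ConvexOn ℝ (Iio b) f)
    (h : ∀ K : ℝ, ∃ γ η : ℝ, 0 < γ ∧ 0 < η ∧ K * γ ≤ μ.real (Ici η) ∧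
      Tendsto (fun s => Real.exp (-γ * s) * f s) atBot atTop) :
    CosDecay ((kernelMeasure μ f).restrict (Ioi 0)) := by
  refine Asymptotics.isLittleO_iff.mpr fun ε hε => ?_
  obtain ⟨γ, η, hγ, hη, hK, hlim⟩ := h (4 / ε)
  obtain ⟨C, w₀, hw₀, hC⟩ := hf.exists_log_le_kernelCos hconv hγ hlim
  set M := μ.real (Ici η) with hM
  have hM0 : 0 < M := lt_of_lt_of_le (by positivity) hK
  set C' := |C| + |Real.log η| / (2 * γ) with hC'
  filter_upwards [tendsto_log_abs_cobounded.eventually_ge_atTop (ε * (M * C')),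
    tendsto_log_abs_cobounded.eventually_ge_atTop 0,
    tendsto_norm_cobounded_atTop.eventually_ge_atTop (w₀ / η),
    tendsto_norm_cobounded_atTop.eventually_ge_atTop (1 : ℝ)] with z hz1 hz2 hz3 hz4
  rw [Real.norm_eq_abs] at hz3 hz4
  have hzpos : 0 < |z| := by linarith
  rw [(integral_cos_kernelMeasure hμ hf z).2, Real.norm_eq_abs, Real.norm_eq_abs,
    abs_of_nonneg (integral_nonneg fun _ => kernelCos_nonneg _ _), abs_of_nonneg hz2]
  have hpt : ∀ u ∈ Ici η, Real.log |z| / (2 * γ) - C' ≤ kernelCos f (z * u) := by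
    intro u hu
    have hu0 : 0 < u := lt_of_lt_of_le hη hu
    have habs : |z * u| = |z| * u := by rw [abs_mul, abs_of_pos hu0]
    have h1 : w₀ ≤ |z * u| := by
      rw [habs]
      calc w₀ = w₀ / η * η := by field_simp
        _ ≤ |z| * u := by gcongr; exact hu
    refine le_trans ?_ (hC _ h1)
    have h2 : Real.log |z| + Real.log η ≤ Real.log |z * u| := by
      rw [habs, Real.log_mul hzpos.ne' hu0.ne']
      have := Real.log_le_log hη hu
      linarith
    have h3 : (Real.log |z| - |Real.log η|) / (2 * γ) ≤ Real.log |z * u| / (2 * γ) := by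
      gcongr
      linarith [neg_abs_le (Real.log η)]
    rw [sub_div] at h3
    rw [hC']
    linarith [le_abs_self C]
  have hsub : Ici η ⊆ Ioi 0 := fun u hu => lt_of_lt_of_le hη hu
  have hint := (integral_cos_kernelMeasure hμ hf z).1
  have hlow : M * (Real.log |z| / (2 * γ) - C') ≤ ∫ u in Ioi 0, kernelCos f (z * u) ∂μ := by
    calc M * (Real.log |z| / (2 * γ) - C') = ∫ u in Ici η, (Real.log |z| / (2 * γ) - C') ∂μ := by
          rw [setIntegral_const, smul_eq_mul]
      _ ≤ ∫ u in Ici η, kernelCos f (z * u) ∂μ :=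
          setIntegral_mono_on (integrableOn_const (hμ.measure_Ici_lt_top hη).ne)
            (IntegrableOn.mono_set hint hsub) measurableSet_Ici hpt
      _ ≤ _ := setIntegral_mono_set hint (ae_of_all _ fun u => kernelCos_nonneg _ _)
            hsub.eventuallyLE
  have h4 : 2 * Real.log |z| ≤ ε * (M * (Real.log |z| / (2 * γ))) := by
    have h5 : 4 * γ ≤ ε * M := by
      rw [div_mul_eq_mul_div, div_le_iff₀ hε] at hK
      linarith
    calc 2 * Real.log |z| = (4 * γ) * (Real.log |z| / (2 * γ)) := by field_simp; ring
      _ ≤ (ε * M) * (Real.log |z| / (2 * γ)) := by gcongr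
      _ = _ := by ring
  have h6 := mul_le_mul_of_nonneg_left hlow hε.le
  nlinarith

/-- In each of the four cases the jumps of the integral satisfy the decay condition, already
because of the positive jumps. -/
theorem cosDecay_of_regularity {μ : Measure ℝ} [SFinite μ] (hμ : HasExpMoments μ) {f : ℝ → ℝ}
    (hf : KernelAssumptions f) (h : RegularityAssumptions μ f) :
    CosDecay ((kernelMeasure μ f).restrict (Ioi 0)) := by
  have hunion : (⋃ n : ℕ, Ici (((n : ℝ) + 1)⁻¹)) = Ioi (0 : ℝ) := by
    ext u
    simp only [mem_iUnion, mem_Ici, mem_Ioi]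
    constructor
    · rintro ⟨n, hn⟩
      exact lt_of_lt_of_le (by positivity) hn
    · intro hu
      have h1 : Tendsto (fun n : ℕ => ((n : ℝ) + 1)⁻¹) atTop (𝓝 0) := by
        simpa using tendsto_one_div_add_atTop_nhds_zero_nat (𝕜 := ℝ)
      obtain ⟨n, hn⟩ := (h1.eventually (gt_mem_nhds hu)).exists
      exact ⟨n, hn.le⟩
  have hanti : Monotone fun n : ℕ => Ici (((n : ℝ) + 1)⁻¹) := fun m n hmn =>
    Ici_subset_Ici.mpr (by gcongr)
  have htend : Tendsto (fun n : ℕ => μ (Ici (((n : ℝ) + 1)⁻¹))) atTop (𝓝 (μ (Ioi 0))) := by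
    rw [← hunion]
    exact tendsto_measure_iUnion_atTop hanti
  rcases h with ⟨h1, -, -⟩ | ⟨h2, h2'⟩ | ⟨h3, b, -, hconv, γ, hγ, hlim⟩ | ⟨h4, b, -, hconv, hlim⟩
  · exact cosDecay_of_kallenberg hμ hf h1
  · exact cosDecay_of_weakKallenberg hμ hf h2 h2'
  · refine cosDecay_of_convex hμ hf (hconv.subset Iio_subset_Iic_self (convex_Iio b)) fun K => ?_
    unfold CondN3 at h3
    rw [h3] at htend
    obtain ⟨n, hn⟩ := (htend.eventually
      (lt_mem_nhds (ENNReal.ofReal_lt_top (r := K * γ)))).exists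
    refine ⟨γ, ((n : ℝ) + 1)⁻¹, hγ, by positivity, ?_, hlim⟩
    exact (ENNReal.ofReal_le_iff_le_toReal (hμ.measure_Ici_lt_top (by positivity)).ne).mp hn.le
  · refine cosDecay_of_convex hμ hf hconv fun K => ?_
    obtain ⟨n, hn⟩ := (htend.eventually (lt_mem_nhds h4)).exists
    have hpos : 0 < μ.real (Ici (((n : ℝ) + 1)⁻¹)) :=
      ENNReal.toReal_pos hn.ne' (hμ.measure_Ici_lt_top (by positivity)).ne
    refine ⟨μ.real (Ici (((n : ℝ) + 1)⁻¹)) / (|K| + 1), ((n : ℝ) + 1)⁻¹, by positivity,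
      by positivity, ?_, hlim _ (by positivity)⟩
    rw [← mul_div_assoc, div_le_iff₀ (by positivity), mul_comm]
    exact mul_le_mul_of_nonneg_left (by linarith [le_abs_self K]) hpos.le

/-! ### Additivity of the exponents in the Lévy measure -/

lemma levyExponent_add {ν ν' : Measure ℝ} (hν : Integrable (fun y : ℝ => y ^ 2) ν)
    (hν' : Integrable (fun y : ℝ => y ^ 2) ν') (z : ℝ) :
    levyExponent (ν + ν') z = levyExponent ν z + levyExponent ν' z := by
  simp only [levyExponent_eq]
  exact integral_add_measure (integrable_expRem hν z) (integrable_expRem hν' z)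

lemma levyExponent_smul (ν : Measure ℝ) {s : ℝ} (hs : 0 ≤ s) (z : ℝ) :
    levyExponent (ENNReal.ofReal s • ν) z = s * levyExponent ν z := by
  simp only [levyExponent_eq, integral_smul_measure, ENNReal.toReal_ofReal hs]
  rw [Complex.real_smul]

/-- The cumulant `∫ (e^{ξ y} - 1 - ξ y) ν(dy)` of the centered infinitely divisible law with Lévy
measure `ν`. -/
noncomputable def cumulant (ν : Measure ℝ) (ξ : ℝ) : ℝ := ∫ y, (Real.exp (ξ * y) - 1 - ξ * y) ∂ν

lemma exp_sub_one_sub_le (x : ℝ) : Real.exp x - 1 - x ≤ x ^ 2 * Real.exp (max x 0) := by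
  have h4 : Real.exp (-x) * Real.exp x = 1 := by rw [← Real.exp_add]; simp
  have h5 : -x + 1 ≤ Real.exp (-x) := Real.add_one_le_exp (-x)
  have h7 : Real.exp x - 1 ≤ x * Real.exp x := by nlinarith [Real.exp_pos x]
  rcases le_total 0 x with hx | hx
  · rw [max_eq_left hx]
    nlinarith [Real.exp_pos x]
  · rw [max_eq_right hx, Real.exp_zero, mul_one]
    nlinarith [Real.add_one_le_exp x]

lemma cumulant_nonneg (ν : Measure ℝ) (ξ : ℝ) : 0 ≤ cumulant ν ξ :=
  integral_nonneg fun _ => exp_sub_one_sub_nonneg _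

lemma HasExpMoments.integrable_exp_sub {ν : Measure ℝ} (h : HasExpMoments ν) (ξ : ℝ) :
    Integrable (fun y => Real.exp (ξ * y) - 1 - ξ * y) ν := by
  refine ((h |ξ|).const_mul (ξ ^ 2)).mono' (by fun_prop) (ae_of_all _ fun y => ?_)
  rw [Real.norm_eq_abs, abs_of_nonneg (exp_sub_one_sub_nonneg _)]
  refine (exp_sub_one_sub_le _).trans ?_
  rw [mul_pow, mul_assoc, ← abs_mul]
  gcongr
  exact max_le (le_abs_self _) (abs_nonneg _)

lemma cumulant_mono {ν ν' : Measure ℝ} (hle : ν ≤ ν') (h : HasExpMoments ν') (ξ : ℝ) :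
    cumulant ν ξ ≤ cumulant ν' ξ :=
  integral_mono_measure hle (ae_of_all _ fun _ => exp_sub_one_sub_nonneg _) (h.integrable_exp_sub ξ)

lemma cumulant_smul (ν : Measure ℝ) {s : ℝ} (hs : 0 ≤ s) (ξ : ℝ) :
    cumulant (ENNReal.ofReal s • ν) ξ = s * cumulant ν ξ := by
  simp only [cumulant, integral_smul_measure, ENNReal.toReal_ofReal hs, smul_eq_mul]

/-- If the jumps are at most `η`, the cumulant grows at most like `ξ² e^{η ξ}`. -/
lemma cumulant_le {ν : Measure ℝ} (h : Integrable (fun y : ℝ => y ^ 2) ν) {η ξ : ℝ}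
    (hη : 0 ≤ η) (hξ : 0 ≤ ξ) (hν : ∀ᵐ y ∂ν, y ≤ η) :
    cumulant ν ξ ≤ ξ ^ 2 * Real.exp (η * ξ) * ∫ y, y ^ 2 ∂ν := by
  rw [← integral_const_mul]
  refine integral_mono_of_nonneg (ae_of_all _ fun _ => exp_sub_one_sub_nonneg _) (h.const_mul _) ?_
  filter_upwards [hν] with y hy
  refine (exp_sub_one_sub_le _).trans ?_
  calc (ξ * y) ^ 2 * Real.exp (max (ξ * y) 0) ≤ (ξ * y) ^ 2 * Real.exp (η * ξ) := by
        gcongr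
        refine max_le ?_ (by positivity)
        rw [mul_comm]
        gcongr
    _ = _ := by ring

/-! ### The densities of a convolution semigroup and their upper bound -/

/-- The density at time `s` of the convolution semigroup with Lévy measure `ν`, obtained by Fourier
inversion. -/
noncomputable def levyDensity (ν : Measure ℝ) (s x : ℝ) : ℝ :=
  invDensity (fun z => Complex.exp (s * levyExponent ν z)) x

/-- A Lipschitz density cannot have a high narrow peak: exponential moments bound it pointwise. -/
lemma density_mul_exp_le {m : Measure ℝ} {a : ℝ → ℝ}
    (hm : m = volume.withDensity fun x => ENNReal.ofReal (a x)) (hac : Continuous a)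
    {K : ℝ} (hK : 0 < K) (hL : ∀ x y, |a x - a y| ≤ K * |x - y|) {ξ : ℝ} (hξ : 0 ≤ ξ) {L : ℝ}
    (hmgf : ∫⁻ x, ENNReal.ofReal (Real.exp (2 * ξ * x)) ∂m ≤ ENNReal.ofReal (Real.exp (2 * L)))
    (w : ℝ) (haw : 0 ≤ a w) :
    a w * Real.exp (ξ * w) ≤ 2 * Real.sqrt K * Real.exp L := by
  -- on `[w, w + r]` the density is at least half of its value at `w`
  set r := a w / (2 * K) with hr
  have hr0 : 0 ≤ r := by positivity
  have hlow : ∀ x ∈ Icc w (w + r), Real.exp (2 * ξ * w) * (a w / 2) ≤ a x * Real.exp (2 * ξ * x) := by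
    intro x hx
    have h1 := (abs_le.mp (hL w x)).2
    have h2 : K * |w - x| ≤ a w / 2 := by
      rw [abs_sub_comm, abs_of_nonneg (by linarith [hx.1])]
      calc K * (x - w) ≤ K * r := by gcongr; linarith [hx.2]
        _ = a w / 2 := by rw [hr]; field_simp
    rw [mul_comm]
    have h3 : Real.exp (2 * ξ * w) ≤ Real.exp (2 * ξ * x) :=
      Real.exp_le_exp.mpr (mul_le_mul_of_nonneg_left hx.1 (by positivity))
    have h4 : a w / 2 ≤ a x := by linarith
    exact mul_le_mul h4 h3 (Real.exp_pos _).le (by linarith)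
  have hint : ENNReal.ofReal (Real.exp (2 * ξ * w) * (a w / 2) * r)
      ≤ ENNReal.ofReal (Real.exp (2 * L)) := by
    refine le_trans ?_ hmgf
    rw [hm, lintegral_withDensity_eq_lintegral_mul _ (by fun_prop) (by fun_prop)]
    calc ENNReal.ofReal (Real.exp (2 * ξ * w) * (a w / 2) * r)
        = ∫⁻ x in Icc w (w + r), ENNReal.ofReal (Real.exp (2 * ξ * w) * (a w / 2)) := by
          rw [setLIntegral_const, Real.volume_Icc, ← ENNReal.ofReal_mul (by positivity)]
          ring_nf
      _ ≤ ∫⁻ x in Icc w (w + r), ENNReal.ofReal (a x) * ENNReal.ofReal (Real.exp (2 * ξ * x)) := by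
          refine setLIntegral_mono' measurableSet_Icc fun x hx => ?_
          rw [← ENNReal.ofReal_mul' (Real.exp_pos _).le]
          exact ENNReal.ofReal_le_ofReal (hlow x hx)
      _ ≤ _ := setLIntegral_le_lintegral _ _
  have h5 := (ENNReal.ofReal_le_ofReal_iff (Real.exp_pos _).le).mp hint
  refine le_of_sq_le_sq ?_ (by positivity)
  have e1 : Real.exp (2 * ξ * w) = Real.exp (ξ * w) ^ 2 := by
    rw [← Real.exp_nat_mul]; congr 1; push_cast; ring
  have e2 : Real.exp (2 * L) = Real.exp L ^ 2 := by
    rw [← Real.exp_nat_mul]; congr 1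
  rw [e1, e2, hr] at h5
  have h6 : Real.exp (ξ * w) ^ 2 * (a w / 2) * (a w / (2 * K))
      = (a w * Real.exp (ξ * w)) ^ 2 / (4 * K) := by field_simp; ring
  rw [h6, div_le_iff₀ (by positivity)] at h5
  rw [mul_pow (2 * Real.sqrt K), mul_pow 2, Real.sq_sqrt hK.le]
  linarith

lemma integrable_of_forall_pow {φ : ℝ → ℂ} (hm : Continuous φ)
    (h : ∀ k : ℕ, Integrable fun z : ℝ => |z| ^ k * ‖φ z‖) : Integrable φ := by
  have := h 0
  simp only [pow_zero, one_mul] at this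
  exact (integrable_norm_iff hm.aestronglyMeasurable).mp this

/-- Splitting off small jumps for a time `m / 2`, whose density is controlled by
`density_mul_exp_le`, gives a Chernoff bound for the densities which is uniform in `s ≥ m`. -/
theorem exists_levyDensity_le {ν : Measure ℝ} (hν : HasExpMoments ν) (hd : CosDecay ν) {m η : ℝ}
    (hm : 0 < m) (hη : 0 < η) : ∃ C : ℝ, 0 < C ∧ ∀ s, m ≤ s → ∀ ξ, 0 ≤ ξ → ∀ x,
      levyDensity ν s x
        ≤ C * Real.exp (-ξ * x + s * cumulant ν ξ + C * ξ ^ 2 * Real.exp (2 * η * ξ)) := by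
  -- the smoothing component has the jumps of size at most `η` during a time `m / 2`
  set S : Set ℝ := {y | |y| ≤ η} with hS
  have hSm : MeasurableSet S := measurableSet_le (by fun_prop) (by fun_prop)
  have hfin : ν Sᶜ ≠ ⊤ := by
    refine (lt_of_le_of_lt (measure_mono fun y hy => ?_)
      (hν.integrable_sq.measure_norm_ge_lt_top (ε := η ^ 2) (by positivity))).ne
    simp only [hS, mem_compl_iff, mem_ofPred_eq, not_le] at hy
    simp only [Real.norm_eq_abs, abs_pow, mem_ofPred_eq]
    exact pow_le_pow_left₀ hη.le hy.le 2
  set νS := ν.restrict S with hνS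
  have hνSm : HasExpMoments νS := hν.mono Measure.restrict_le_self
  have hνSc : HasExpMoments (ν.restrict Sᶜ) := hν.mono Measure.restrict_le_self
  have hdS : CosDecay νS := hd.restrict hν.integrable_sq hSm hfin
  have hsplit : ∀ z, levyExponent ν z = levyExponent νS z + levyExponent (ν.restrict Sᶜ) z :=
    fun z => by
      rw [← levyExponent_add hνSm.integrable_sq hνSc.integrable_sq, hνS,
        Measure.restrict_add_restrict_compl hSm]
  have hm2 : 0 < m / 2 := by positivity
  obtain ⟨mA, hA, hAexp⟩ := exists_infDiv (hνSm.smul ENNReal.ofReal_ne_top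
    (c := ENNReal.ofReal (m / 2))).integrable_sq
  simp_rw [levyExponent_smul _ hm2.le] at hA
  have hAfun : charFun (mA : Measure ℝ) = fun z => Complex.exp ((m / 2 : ℝ) * levyExponent νS z) :=
    funext hA
  have hpow : ∀ k : ℕ, Integrable fun z : ℝ => |z| ^ k * ‖charFun (mA : Measure ℝ) z‖ := fun k => by
    rw [hAfun]
    exact hdS.integrable_pow_mul_norm hνSm.integrable_sq hm2 k
  have hcA : Continuous (charFun (mA : Measure ℝ)) := by
    rw [hAfun]
    have := continuous_levyExponent hνSm.integrable_sq
    fun_prop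
  have hiA := integrable_of_forall_pow hcA hpow
  have hdens := isSmoothDensity_invDensity hpow
  set a := invDensity (charFun (mA : Measure ℝ)) with ha
  obtain ⟨K₀, hK₀⟩ := hdens.bounded 1
  have hdiff : Differentiable ℝ a := hdens.smooth.differentiable (by simp)
  set K := |K₀| + 1 with hK
  have hLip : ∀ x y, |a x - a y| ≤ K * |x - y| := fun x y => by
    have := convex_univ.norm_image_sub_le_of_norm_deriv_le (f := a) (C := K)
      (fun x _ => hdiff x) (fun x _ => ?_) (mem_univ y) (mem_univ x)
    · simpa [Real.norm_eq_abs] using this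
    · rw [Real.norm_eq_abs, ← iteratedDeriv_one]
      linarith [hK₀ x, le_abs_self K₀]
  set V := ∫ y, y ^ 2 ∂νS with hV
  have hV0 : 0 ≤ V := integral_nonneg fun y => sq_nonneg y
  have hapt : ∀ ξ, 0 ≤ ξ → ∀ w, a w * Real.exp (ξ * w)
      ≤ 2 * Real.sqrt K * Real.exp (m * V * ξ ^ 2 * Real.exp (2 * η * ξ)) := by
    intro ξ hξ w
    refine density_mul_exp_le hdens.density hdiff.continuous (by positivity) hLip hξ ?_ w
      (hdens.nonneg w)
    refine (hAexp (2 * ξ) ((hνSm.smul ENNReal.ofReal_ne_top).integrable_exp_sub _)).trans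
      (ENNReal.ofReal_le_ofReal (Real.exp_le_exp.mpr ?_))
    have h1 := cumulant_smul νS hm2.le (2 * ξ)
    have h2 := cumulant_le hνSm.integrable_sq hη.le (show 0 ≤ 2 * ξ by positivity)
      ((ae_restrict_iff' hSm).mpr (ae_of_all _ fun y hy => (le_abs_self y).trans hy))
    have h3 : η * (2 * ξ) = 2 * η * ξ := by ring
    rw [h3] at h2
    unfold cumulant at h1 h2
    rw [h1]
    have h4 := mul_le_mul_of_nonneg_left h2 hm2.le
    refine h4.trans (le_of_eq ?_)
    ring
  set C := max (2 * Real.sqrt K) (m * V) with hC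
  have hCpos : 0 < C := lt_max_of_lt_left (by positivity)
  refine ⟨C, hCpos, fun s hs ξ hξ x => ?_⟩
  have hs2 : 0 ≤ s - m / 2 := by linarith
  -- the remaining jumps
  set νO := ENNReal.ofReal (s - m / 2) • νS + ENNReal.ofReal s • ν.restrict Sᶜ with hνO
  have hO1 : HasExpMoments (ENNReal.ofReal (s - m / 2) • νS) := hνSm.smul ENNReal.ofReal_ne_top
  have hO2 : HasExpMoments (ENNReal.ofReal s • ν.restrict Sᶜ) := hνSc.smul ENNReal.ofReal_ne_top
  have hOle : νO ≤ ENNReal.ofReal s • ν := by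
    rw [← Measure.restrict_add_restrict_compl (μ := ν) hSm, smul_add]
    have : ENNReal.ofReal (s - m / 2) • νS ≤ ENNReal.ofReal s • νS := by
      gcongr
      linarith
    exact add_le_add_left this _
  have hOm : HasExpMoments νO := (hν.smul ENNReal.ofReal_ne_top).mono hOle
  obtain ⟨mO, hO, hOexp⟩ := exists_infDiv hOm.integrable_sq
  have hchar : (fun z => Complex.exp (s * levyExponent ν z))
      = fun z => charFun (mA : Measure ℝ) z * charFun (mO : Measure ℝ) z := by
    funext z
    rw [hA, hO, ← Complex.exp_add, hνO, levyExponent_add hO1.integrable_sq hO2.integrable_sq,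
      levyExponent_smul _ hs2, levyExponent_smul _ (by linarith), hsplit]
    congr 1
    push_cast
    ring
  rw [levyDensity, hchar, invDensity_mul_charFun hiA]
  set E := 2 * Real.sqrt K * Real.exp (m * V * ξ ^ 2 * Real.exp (2 * η * ξ)) with hE
  have hpt : ∀ y, a (x - y) ≤ E * Real.exp (-ξ * x) * Real.exp (ξ * y) := fun y => by
    have h1 := hapt ξ hξ (x - y)
    have h2 : Real.exp (-ξ * x) * Real.exp (ξ * y) = (Real.exp (ξ * (x - y)))⁻¹ := by
      rw [← Real.exp_neg, ← Real.exp_add]; congr 1; ring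
    rw [mul_assoc, h2, ← div_eq_mul_inv, le_div_iff₀ (Real.exp_pos _)]
    exact h1
  have hmgf : ∫⁻ y, ENNReal.ofReal (Real.exp (ξ * y)) ∂(mO : Measure ℝ)
      ≤ ENNReal.ofReal (Real.exp (s * cumulant ν ξ)) := by
    refine (hOexp ξ (hOm.integrable_exp_sub ξ)).trans
      (ENNReal.ofReal_le_ofReal (Real.exp_le_exp.mpr ?_))
    rw [← cumulant_smul ν (by linarith : 0 ≤ s)]
    exact cumulant_mono hOle (hν.smul ENNReal.ofReal_ne_top) ξ
  have hint : Integrable (fun y => Real.exp (ξ * y)) (mO : Measure ℝ) := by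
    refine ⟨by fun_prop, ?_⟩
    rw [hasFiniteIntegral_iff_ofReal (ae_of_all _ fun y => (Real.exp_pos _).le)]
    exact hmgf.trans_lt ENNReal.ofReal_lt_top
  have hmgf' : ∫ y, Real.exp (ξ * y) ∂(mO : Measure ℝ) ≤ Real.exp (s * cumulant ν ξ) := by
    rw [integral_eq_lintegral_of_nonneg_ae (ae_of_all _ fun y => (Real.exp_pos _).le) (by fun_prop)]
    exact ENNReal.toReal_le_of_le_ofReal (Real.exp_pos _).le hmgf
  calc ∫ y, a (x - y) ∂(mO : Measure ℝ)
      ≤ ∫ y, E * Real.exp (-ξ * x) * Real.exp (ξ * y) ∂(mO : Measure ℝ) :=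
        integral_mono_of_nonneg (ae_of_all _ fun y => hdens.nonneg _) (hint.const_mul _)
          (ae_of_all _ hpt)
    _ = E * Real.exp (-ξ * x) * ∫ y, Real.exp (ξ * y) ∂(mO : Measure ℝ) := integral_const_mul _ _
    _ ≤ E * Real.exp (-ξ * x) * Real.exp (s * cumulant ν ξ) := by gcongr
    _ = 2 * Real.sqrt K * Real.exp (-ξ * x + s * cumulant ν ξ
          + m * V * ξ ^ 2 * Real.exp (2 * η * ξ)) := by
        rw [hE, Real.exp_add, Real.exp_add]; ring
    _ ≤ C * Real.exp (-ξ * x + s * cumulant ν ξ + C * ξ ^ 2 * Real.exp (2 * η * ξ)) := by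
        gcongr
        · exact le_max_left _ _
        · exact le_max_right _ _

/-! ### The lower bound for the densities -/

/-- A law with bounded exponential moments of order `± 1` is concentrated near the origin. -/
lemma half_le_measure_Icc {m : Measure ℝ} [IsProbabilityMeasure m] {L k : ℝ} (hk : L + 2 ≤ k)
    (h1 : ∫⁻ x, ENNReal.ofReal (Real.exp (1 * x)) ∂m ≤ ENNReal.ofReal (Real.exp L))
    (h2 : ∫⁻ x, ENNReal.ofReal (Real.exp (-1 * x)) ∂m ≤ ENNReal.ofReal (Real.exp L)) :
    ENNReal.ofReal (1 / 2) ≤ m (Icc (-k) k) := by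
  have key : ∀ ξ : ℝ, ∫⁻ x, ENNReal.ofReal (Real.exp (ξ * x)) ∂m ≤ ENNReal.ofReal (Real.exp L) →
      m {x | k ≤ ξ * x} ≤ ENNReal.ofReal (1 / 4) := by
    intro ξ h
    have hm : m {x | k ≤ ξ * x} ≤ m {x | ENNReal.ofReal (Real.exp k)
        ≤ ENNReal.ofReal (Real.exp (ξ * x))} := measure_mono fun x hx =>
      ENNReal.ofReal_le_ofReal (Real.exp_le_exp.mpr hx)
    have h3 := (mul_meas_ge_le_lintegral (μ := m)
      (f := fun x => ENNReal.ofReal (Real.exp (ξ * x))) (by fun_prop)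
      (ENNReal.ofReal (Real.exp k))).trans h
    have h4 : ENNReal.ofReal (Real.exp k) * m {x | k ≤ ξ * x} ≤ ENNReal.ofReal (Real.exp L) :=
      (mul_le_mul_right hm _).trans h3
    have h5 : m {x | k ≤ ξ * x} ≤ ENNReal.ofReal (Real.exp L) / ENNReal.ofReal (Real.exp k) := by
      rw [ENNReal.le_div_iff_mul_le (by simp [Real.exp_pos]) (by simp), mul_comm]
      exact h4
    rw [← ENNReal.ofReal_div_of_pos (Real.exp_pos _), ← Real.exp_sub] at h5
    refine h5.trans (ENNReal.ofReal_le_ofReal ?_)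
    have h6 : Real.exp (L - k) ≤ Real.exp (-2) := Real.exp_le_exp.mpr (by linarith)
    refine h6.trans ?_
    rw [Real.exp_neg, ← one_div]
    refine one_div_le_one_div_of_le (by norm_num) ?_
    have := Real.quadratic_le_exp_of_nonneg (show (0 : ℝ) ≤ 2 by norm_num)
    linarith
  have hcover : (univ : Set ℝ) ⊆ Icc (-k) k ∪ ({x | k ≤ 1 * x} ∪ {x | k ≤ -1 * x}) := by
    intro x _
    simp only [mem_union, mem_Icc, mem_ofPred_eq]
    by_contra! hcon
    linarith [hcon.1 (by linarith [hcon.2.2]), hcon.2.1]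
  have h3 := (measure_mono (μ := m) hcover).trans ((measure_union_le _ _).trans
    (add_le_add_right (measure_union_le _ _) _))
  rw [measure_univ] at h3
  have h4 := h3.trans (add_le_add_right (add_le_add (key 1 h1) (key (-1) h2)) _)
  rw [← ENNReal.ofReal_add (by norm_num) (by norm_num)] at h4
  have h5 : (1 : ℝ≥0∞) = ENNReal.ofReal (1 / 2) + ENNReal.ofReal (1 / 4 + 1 / 4) := by
    rw [← ENNReal.ofReal_add (by norm_num) (by norm_num)]; norm_num
  rw [h5] at h4
  exact (ENNReal.add_le_add_iff_right ENNReal.ofReal_ne_top).mp h4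

/-- For finitely many jumps the compensation is a drift. -/
lemma levyExponent_of_finite {κ : Measure ℝ} [IsFiniteMeasure κ] (h : Integrable (fun y : ℝ => y) κ)
    (z : ℝ) : levyExponent κ z
      = charFun κ z - κ.real univ - Complex.I * z * (∫ y, y ∂κ : ℝ) := by
  have h1 : Integrable (fun y : ℝ => Complex.exp (z * y * Complex.I)) κ := by
    refine (integrable_const (1 : ℝ)).mono' (by fun_prop) (ae_of_all _ fun x => ?_)
    rw [← Complex.ofReal_mul, Complex.norm_exp_ofReal_mul_I]
  have h2 : Integrable (fun y : ℝ => Complex.I * z * (y : ℂ)) κ := h.ofReal.const_mul _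
  rw [levyExponent, charFun_apply_real]
  have e : ∀ u : ℝ, Complex.exp (Complex.I * (u : ℂ) * (z : ℂ)) - 1 - Complex.I * (z : ℂ) * (u : ℂ)
      = Complex.exp (z * u * Complex.I) - 1 - Complex.I * z * (u : ℂ) := fun u => by
    congr 3; ring
  simp_rw [e]
  have h3 : Integrable (fun y : ℝ => Complex.exp (z * y * Complex.I) - 1) κ :=
    h1.sub (integrable_const _)
  rw [integral_sub h3 h2, integral_sub h1 (integrable_const _),
    integral_const_mul, integral_complex_ofReal]
  simp

/-- An infinitely divisible law with finite Lévy measure is a shifted compound Poisson law. -/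
lemma exp_levyExponent_of_finite {κ : Measure ℝ} [IsFiniteMeasure κ]
    (h : Integrable (fun y : ℝ => y) κ) (z : ℝ) : Complex.exp (levyExponent κ z)
      = charFun (compoundPoisson κ) z * Complex.exp ((-∫ y, y ∂κ : ℝ) * z * Complex.I) := by
  rw [levyExponent_of_finite h, charFun_compoundPoisson, ← Complex.exp_add]
  congr 1
  push_cast
  ring

/-- `levyDensity ν s` is the density of an actual law. -/
lemma exists_isSmoothDensity_levyDensity {ν : Measure ℝ} (hν : HasExpMoments ν) (hd : CosDecay ν)
    {s : ℝ} (hs : 0 < s) : ∃ m : ProbabilityMeasure ℝ, IsSmoothDensity m (levyDensity ν s) := by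
  obtain ⟨m, hm, -⟩ := exists_infDiv (hν.smul ENNReal.ofReal_ne_top
    (c := ENNReal.ofReal s)).integrable_sq
  simp_rw [levyExponent_smul _ hs.le] at hm
  have hfun : charFun (m : Measure ℝ) = fun z => Complex.exp (s * levyExponent ν z) := funext hm
  have hdens := isSmoothDensity_invDensity (m := (m : Measure ℝ)) fun k => by
    rw [hfun]
    exact hd.integrable_pow_mul_norm hν.integrable_sq hs k
  rw [hfun] at hdens
  exact ⟨m, hdens⟩

/-- A continuous probability density is bounded below on some interval. -/
lemma exists_interval_le_of_isSmoothDensity {m : Measure ℝ} [IsProbabilityMeasure m] {p : ℝ → ℝ}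
    (h : IsSmoothDensity m p) : ∃ κ α δ : ℝ, 0 < κ ∧ 0 < δ ∧ ∀ x, |x - α| ≤ δ → κ ≤ p x := by
  obtain ⟨α, hα⟩ : ∃ α, 0 < p α := by
    by_contra! hcon
    have h1 : m univ = 0 := by
      rw [h.density, withDensity_apply _ MeasurableSet.univ]
      simp [ENNReal.ofReal_eq_zero.mpr (hcon _)]
    simp at h1
  obtain ⟨δ, hδ, hp⟩ := Metric.eventually_nhds_iff.mp
    (h.smooth.continuous.continuousAt.eventually (lt_mem_nhds (half_lt_self hα)))
  refine ⟨p α / 2, α, δ / 2, by positivity, by positivity, fun x hx => (hp ?_).le⟩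
  rw [Real.dist_eq]
  linarith

/-- The measure charges `[r, ε]` for some `r > 0`, however small `ε` is. -/
lemma exists_pos_Icc {ν : Measure ℝ} (h : CosDecay (ν.restrict (Ioi 0)))
    (hν : Integrable (fun y : ℝ => y ^ 2) ν) {ε : ℝ} (hε : 0 < ε) :
    ∃ r, 0 < r ∧ r ≤ ε ∧ 0 < ν (Icc r ε) := by
  have h0 := h.pos_Ioo hν hε
  by_contra! hcon
  have hsub : Ioo 0 ε ⊆ ⋃ n : ℕ, Icc (min ((n : ℝ) + 1)⁻¹ ε) ε := by
    intro y hy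
    have h1 : Tendsto (fun n : ℕ => ((n : ℝ) + 1)⁻¹) atTop (𝓝 0) := by
      simpa using tendsto_one_div_add_atTop_nhds_zero_nat (𝕜 := ℝ)
    obtain ⟨n, hn⟩ := (h1.eventually (gt_mem_nhds hy.1)).exists
    exact mem_iUnion.mpr ⟨n, (min_le_left _ _).trans hn.le, hy.2.le⟩
  have h2 : ν (⋃ n : ℕ, Icc (min ((n : ℝ) + 1)⁻¹ ε) ε) = 0 :=
    measure_iUnion_null fun n => le_antisymm
      (hcon _ (lt_min (by positivity) hε) (min_le_right _ _)) zero_le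
  exact h0.ne' (measure_mono_null hsub h2)

lemma HasExpMoments.measure_Icc_lt_top {ν : Measure ℝ} (hν : HasExpMoments ν) {a b : ℝ}
    (ha : 0 < a) : ν (Icc a b) < ⊤ :=
  (measure_mono Icc_subset_Ici_self).trans_lt (hν.measure_Ici_lt_top ha)

lemma HasExpMoments.measureReal_Icc_le {ν : Measure ℝ} (hν : HasExpMoments ν) {a b : ℝ}
    (ha : 0 < a) : ν.real (Icc a b) ≤ (∫ y, y ^ 2 ∂ν) / a ^ 2 := by
  rw [le_div_iff₀ (by positivity)]
  calc ν.real (Icc a b) * a ^ 2 = ∫ y in Icc a b, a ^ 2 ∂ν := by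
        rw [setIntegral_const, smul_eq_mul]
    _ ≤ ∫ y in Icc a b, y ^ 2 ∂ν := setIntegral_mono_on
        (integrableOn_const (hν.measure_Icc_lt_top ha).ne) hν.integrable_sq.integrableOn
        measurableSet_Icc fun y hy => pow_le_pow_left₀ ha.le hy.1 2
    _ ≤ _ := setIntegral_le_integral hν.integrable_sq (ae_of_all _ fun y => sq_nonneg y)

lemma HasExpMoments.integrableOn_id_Icc {ν : Measure ℝ} (hν : HasExpMoments ν) {a b : ℝ}
    (ha : 0 < a) : IntegrableOn (fun y : ℝ => y) (Icc a b) ν ∧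
      0 ≤ ∫ y in Icc a b, y ∂ν ∧ ∫ y in Icc a b, y ∂ν ≤ (∫ y, y ^ 2 ∂ν) / a := by
  have hpt : ∀ y ∈ Icc a b, y ≤ y ^ 2 / a := fun y hy => by
    rw [le_div_iff₀ ha]
    nlinarith [hy.1]
  have hi : IntegrableOn (fun y : ℝ => y ^ 2 / a) (Icc a b) ν :=
    (hν.integrable_sq.div_const a).integrableOn
  have hi' : IntegrableOn (fun y : ℝ => y) (Icc a b) ν := by
    refine hi.mono' (by fun_prop) ((ae_restrict_iff' measurableSet_Icc).mpr
      (ae_of_all _ fun y hy => ?_))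
    rw [Real.norm_eq_abs, abs_of_pos (ha.trans_le hy.1)]
    exact hpt y hy
  refine ⟨hi', setIntegral_nonneg measurableSet_Icc fun y hy => (ha.trans_le hy.1).le, ?_⟩
  calc ∫ y in Icc a b, y ∂ν ≤ ∫ y in Icc a b, y ^ 2 / a ∂ν :=
        setIntegral_mono_on hi' hi measurableSet_Icc hpt
    _ ≤ ∫ y, y ^ 2 / a ∂ν := setIntegral_le_integral (hν.integrable_sq.div_const a)
        (ae_of_all _ fun y => by positivity)
    _ = _ := integral_div _ _

/-- The strategy of the lower bound: at a time `h₀` the process ends in a fixed window with a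
density at least `κ₀`, during a time `t` its jumps in `[a, b]` and then its jumps in `[r, ε]` bring
it close to the level `x`, while the compensator and the other jumps contribute at most `D`. -/
lemma le_levyDensity_of_window {ν : Measure ℝ} (hν : HasExpMoments ν) (hd : CosDecay ν)
    {h₀ t : ℝ} (hh₀ : 0 < h₀) (ht : 0 < t) {a b r ε κ₀ α : ℝ} (hr : 0 < r) (hrε : r ≤ ε)
    (hεa : ε < a) (hab : a ≤ b) (hℓ : 0 < ν.real (Icc a b)) (hℓ' : 0 < ν.real (Icc r ε))
    (hκ₀ : 0 < κ₀) (hwin : ∀ x, |x - α| ≤ ε → κ₀ ≤ levyDensity ν h₀ x) {D x B : ℝ}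
    (hD : t * (cumulant ν 1 + cumulant ν (-1)) + 2
      + t * ((∫ y, y ^ 2 ∂ν) / r + (∫ y, y ^ 2 ∂ν) / a) ≤ D)
    (hx : D + α ≤ x) (hB : x - α + D ≤ B) :
    κ₀ / 2 * Real.exp ((-(t * ν.real (Icc r ε))
        - b / r * Real.log (1 + b / (r * (t * ν.real (Icc r ε)))))
      + (-(t * ν.real (Icc a b)) - B / a * Real.log (1 + B / (a * (t * ν.real (Icc a b))))))
      ≤ levyDensity ν (h₀ + t) x := by
  have ha : 0 < a := by linarith
  set S₁ : Set ℝ := Icc a b with hS₁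
  set S₂ : Set ℝ := Icc r ε with hS₂
  set S₃ : Set ℝ := (S₂ ∪ S₁)ᶜ with hS₃
  have hdisj : Disjoint S₂ S₁ := disjoint_left.mpr fun y h2 h1 => by linarith [h1.1, h2.2]
  have hm₁ : MeasurableSet S₁ := measurableSet_Icc
  have hm₂ : MeasurableSet S₂ := measurableSet_Icc
  have hdec : ν = ν.restrict S₂ + ν.restrict S₁ + ν.restrict S₃ := by
    rw [← Measure.restrict_union hdisj hm₁, Measure.restrict_add_restrict_compl (hm₂.union hm₁)]
  have hE : ∀ S, HasExpMoments (ν.restrict S) := fun S => hν.mono Measure.restrict_le_self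
  have hψ : ∀ z, levyExponent ν z = levyExponent (ν.restrict S₂) z + levyExponent (ν.restrict S₁) z
      + levyExponent (ν.restrict S₃) z := fun z => by
    conv_lhs => rw [hdec]
    rw [levyExponent_add (((hE S₂).integrable_sq).add_measure (hE S₁).integrable_sq)
      (hE S₃).integrable_sq, levyExponent_add (hE S₂).integrable_sq (hE S₁).integrable_sq]
  have hf₁ : IsFiniteMeasure (ν.restrict S₁) :=
    ⟨by rw [Measure.restrict_apply_univ]; exact hν.measure_Icc_lt_top ha⟩
  have hf₂ : IsFiniteMeasure (ν.restrict S₂) :=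
    ⟨by rw [Measure.restrict_apply_univ]; exact hν.measure_Icc_lt_top hr⟩
  set κ := ENNReal.ofReal t • ν.restrict S₁ with hκ
  set κ' := ENNReal.ofReal t • ν.restrict S₂ with hκ'
  have hfκ : IsFiniteMeasure κ := Measure.smul_finite _ ENNReal.ofReal_ne_top
  have hfκ' : IsFiniteMeasure κ' := Measure.smul_finite _ ENNReal.ofReal_ne_top
  obtain ⟨hi₁, hn₁, hle₁⟩ := hν.integrableOn_id_Icc (b := b) ha
  obtain ⟨hi₂, hn₂, hle₂⟩ := hν.integrableOn_id_Icc (b := ε) hr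
  have hκi : Integrable (fun y : ℝ => y) κ := hi₁.smul_measure ENNReal.ofReal_ne_top
  have hκi' : Integrable (fun y : ℝ => y) κ' := hi₂.smul_measure ENNReal.ofReal_ne_top
  have hM₁ : ∫ y, y ∂κ = t * ∫ y in S₁, y ∂ν := by
    rw [hκ, integral_smul_measure, ENNReal.toReal_ofReal ht.le, smul_eq_mul]
  have hM₂ : ∫ y, y ∂κ' = t * ∫ y in S₂, y ∂ν := by
    rw [hκ', integral_smul_measure, ENNReal.toReal_ofReal ht.le, smul_eq_mul]
  have hκu : κ.real univ = t * ν.real S₁ := by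
    rw [hκ, measureReal_ennreal_smul_apply, ENNReal.toReal_ofReal ht.le,
      measureReal_restrict_apply_univ]
  have hκu' : κ'.real univ = t * ν.real S₂ := by
    rw [hκ', measureReal_ennreal_smul_apply, ENNReal.toReal_ofReal ht.le,
      measureReal_restrict_apply_univ]
  set M := (∫ y, y ∂κ') + ∫ y, y ∂κ with hM
  obtain ⟨R, hR, hRexp⟩ := exists_infDiv ((hE S₃).smul ENNReal.ofReal_ne_top
    (c := ENNReal.ofReal t)).integrable_sq
  set G := (R : Measure ℝ).map (· + -M) with hG
  have hGprob : IsProbabilityMeasure G := Measure.isProbabilityMeasure_map (by fun_prop)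
  set J := compoundPoisson κ' ∗ compoundPoisson κ with hJ
  have hchar : (fun z => Complex.exp ((h₀ + t : ℝ) * levyExponent ν z))
      = fun z => Complex.exp (h₀ * levyExponent ν z) * charFun (J ∗ G) z := by
    funext z
    have e₁ := exp_levyExponent_of_finite hκi z
    have e₂ := exp_levyExponent_of_finite hκi' z
    rw [hκ, levyExponent_smul _ ht.le] at e₁
    rw [hκ', levyExponent_smul _ ht.le] at e₂
    have e₃ := hR z
    rw [levyExponent_smul _ ht.le] at e₃
    have e₄ : ((h₀ + t : ℝ) : ℂ) * levyExponent ν z = h₀ * levyExponent ν z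
        + (t * levyExponent (ν.restrict S₂) z + t * levyExponent (ν.restrict S₁) z
          + t * levyExponent (ν.restrict S₃) z) := by
      rw [hψ]; push_cast; ring
    have e₅ : Complex.exp ((inner ℝ (-M) z : ℝ) * Complex.I)
        = Complex.exp ((-∫ y, y ∂κ' : ℝ) * z * Complex.I)
          * Complex.exp ((-∫ y, y ∂κ : ℝ) * z * Complex.I) := by
      rw [← Complex.exp_add]
      congr 1
      simp only [hM, RCLike.inner_apply, conj_trivial]
      push_cast
      ring
    rw [e₄, Complex.exp_add, Complex.exp_add, Complex.exp_add, e₁, e₂, ← e₃, charFun_conv,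
      hJ, charFun_conv, hG, charFun_map_add_const, e₅]
    ring
  -- the compensator and the other jumps
  have hGJ : ENNReal.ofReal (1 / 2) ≤ G (Icc (-D) D) := by
    set L := cumulant ν 1 + cumulant ν (-1) with hL
    have hcum : ∀ ξ : ℝ, cumulant ν ξ ≤ L → ∫⁻ x, ENNReal.ofReal (Real.exp (ξ * x)) ∂(R : Measure ℝ)
        ≤ ENNReal.ofReal (Real.exp (t * L)) := fun ξ hξ => by
      refine (hRexp ξ (((hE S₃).smul ENNReal.ofReal_ne_top).integrable_exp_sub ξ)).trans
        (ENNReal.ofReal_le_ofReal (Real.exp_le_exp.mpr ?_))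
      have h1 := cumulant_smul (ν.restrict S₃) ht.le ξ
      unfold cumulant at h1
      rw [h1]
      exact mul_le_mul_of_nonneg_left
        ((cumulant_mono Measure.restrict_le_self hν ξ).trans hξ) ht.le
    have h1 := half_le_measure_Icc (m := (R : Measure ℝ)) (le_refl (t * L + 2))
      (hcum 1 (by linarith [cumulant_nonneg ν (-1)]))
      (hcum (-1) (by linarith [cumulant_nonneg ν 1]))
    refine h1.trans ?_
    rw [hG, Measure.map_apply (by fun_prop) measurableSet_Icc]
    refine measure_mono fun y hy => ?_
    have h2 := mul_le_mul_of_nonneg_left hle₁ ht.le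
    have h3 := mul_le_mul_of_nonneg_left hle₂ ht.le
    have h4 := mul_nonneg ht.le hn₁
    have h5 := mul_nonneg ht.le hn₂
    simp only [mem_preimage, mem_Icc, hM, hM₁, hM₂] at hy ⊢
    constructor <;> linarith [hy.1, hy.2]
  set w := Real.exp ((-(t * ν.real S₂)
        - b / r * Real.log (1 + b / (r * (t * ν.real S₂))))
      + (-(t * ν.real S₁) - B / a * Real.log (1 + B / (a * (t * ν.real S₁))))) with hw
  have hJwin : ∀ y, 0 ≤ y → y ≤ B → ENNReal.ofReal w ≤ J (Ioc (y - ε) y) := fun y hy hyB => by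
    have h := ofReal_exp_le_conv_compoundPoisson_Ioc κ κ' (a := a) (b := b) (r := r) (δ := ε)
      ha hab hr hrε
      (by rw [hκ, Measure.smul_apply, Measure.restrict_apply hm₁.compl]; simp)
      (by rw [hκ', Measure.smul_apply, Measure.restrict_apply hm₂.compl]; simp)
      (by rw [hκu]; positivity) (by rw [hκu']; positivity) hy hyB
    rw [hκu, hκu'] at h
    exact h
  have hN : ENNReal.ofReal (w * (1 / 2)) ≤ (J ∗ G) (Ioc (x - α - ε) (x - α)) := by
    rw [conv_Ioc]
    calc ENNReal.ofReal (w * (1 / 2)) = ENNReal.ofReal w * ENNReal.ofReal (1 / 2) :=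
          ENNReal.ofReal_mul (Real.exp_pos _).le
      _ ≤ ENNReal.ofReal w * G (Icc (-D) D) := mul_le_mul_right hGJ _
      _ = ∫⁻ j in Icc (-D) D, ENNReal.ofReal w ∂G := by rw [setLIntegral_const]
      _ ≤ ∫⁻ j in Icc (-D) D, J (Ioc (x - α - ε - j) (x - α - j)) ∂G := by
          refine setLIntegral_mono' measurableSet_Icc fun j hj => ?_
          have h := hJwin (x - α - j) (by linarith [hj.2]) (by linarith [hj.1])
          have e : x - α - j - ε = x - α - ε - j := by ring
          rwa [e] at h
      _ ≤ _ := setLIntegral_le_lintegral _ _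
  obtain ⟨mp, hp⟩ := exists_isSmoothDensity_levyDensity hν hd hh₀
  obtain ⟨K, hK⟩ := hp.bounded 0
  have hcont := hp.smooth.continuous
  have hφ : Integrable fun z : ℝ => Complex.exp (h₀ * levyExponent ν z) :=
    integrable_of_forall_pow (by
      have := continuous_levyExponent hν.integrable_sq
      fun_prop) (hd.integrable_pow_mul_norm hν.integrable_sq hh₀)
  rw [levyDensity, hchar, invDensity_mul_charFun hφ]
  change _ ≤ ∫ y, levyDensity ν h₀ (x - y) ∂(J ∗ G)
  have hint : Integrable (fun y => levyDensity ν h₀ (x - y)) (J ∗ G) := by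
    refine (integrable_const K).mono' (by fun_prop) (ae_of_all _ fun y => ?_)
    simpa using hK (x - y)
  have hNr : w * (1 / 2) ≤ (J ∗ G).real (Ioc (x - α - ε) (x - α)) :=
    (ENNReal.ofReal_le_iff_le_toReal (measure_ne_top _ _)).mp hN
  calc κ₀ / 2 * w = w * (1 / 2) * κ₀ := by ring
    _ ≤ (J ∗ G).real (Ioc (x - α - ε) (x - α)) * κ₀ := by gcongr
    _ = ∫ y in Ioc (x - α - ε) (x - α), κ₀ ∂(J ∗ G) := by rw [setIntegral_const, smul_eq_mul]
    _ ≤ ∫ y in Ioc (x - α - ε) (x - α), levyDensity ν h₀ (x - y) ∂(J ∗ G) := by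
        refine setIntegral_mono_on (integrable_const _) hint.integrableOn measurableSet_Ioc
          fun y hy => hwin _ ?_
        rw [abs_le]
        constructor <;> linarith [hy.1, hy.2]
    _ ≤ _ := setIntegral_le_integral hint (ae_of_all _ fun y => hp.nonneg _)

/-- A lower bound for the densities which is uniform in the time `s ≥ m`, in the level `s v` and in
the sizes `[a, b]` of the jumps which are used to reach it. -/
theorem exists_le_levyDensity {ν : Measure ℝ} (hν : HasExpMoments ν)
    (hd : CosDecay (ν.restrict (Ioi 0))) {m a₀ : ℝ} (hm : 0 < m) (ha₀ : 0 < a₀) :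
    ∃ C : ℝ, 0 < C ∧ ∀ a b s v, a₀ ≤ a → a ≤ b → 0 < ν.real (Icc a b) → m ≤ s → C ≤ v →
      Real.exp (-(s * (C + (v + C) / a * Real.log (1 + C * (v + C) / (a * ν.real (Icc a b)))
        + C * b * Real.log (1 + C * b)))) ≤ levyDensity ν s (s * v) := by
  have hd' : CosDecay ν := hd.mono Measure.restrict_le_self hν.integrable_sq
  have hm2 : 0 < m / 2 := by positivity
  obtain ⟨mp, hp⟩ := exists_isSmoothDensity_levyDensity hν hd' hm2
  obtain ⟨κ₀, α, δ, hκ₀, hδ, hwin⟩ := exists_interval_le_of_isSmoothDensity hp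
  set ε := min δ (a₀ / 2) with hε
  have hεpos : 0 < ε := lt_min hδ (by positivity)
  obtain ⟨r, hr, hrε, hpos⟩ := exists_pos_Icc hd hν.integrable_sq hεpos
  set ℓ' := ν.real (Icc r ε) with hℓ'
  have hℓ'pos : 0 < ℓ' := ENNReal.toReal_pos hpos.ne' (hν.measure_Icc_lt_top hr).ne
  set V := ∫ y, y ^ 2 ∂ν with hV
  have hV0 : 0 ≤ V := integral_nonneg fun y => sq_nonneg y
  set L := cumulant ν 1 + cumulant ν (-1) with hL
  have hL0 : 0 ≤ L := add_nonneg (cumulant_nonneg _ _) (cumulant_nonneg _ _)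
  set C₂ := L + 2 / m + (V / r + V / a₀) with hC₂
  set C₃ := C₂ + |α| / m with hC₃
  have hC₂0 : 0 ≤ C₂ := by positivity
  have hC₃0 : 0 ≤ C₃ := by positivity
  set q := |Real.log (κ₀ / 2)| / m with hq
  have hq0 : 0 ≤ q := by positivity
  have hA0 : 0 ≤ 1 / (r * m) := by positivity
  have hA1 : 0 ≤ 2 / (r * m * ℓ') := by positivity
  have hA2 : 0 ≤ V / a₀ ^ 2 := by positivity
  set C := C₃ + 2 + 1 / (r * m) + 2 / (r * m * ℓ') + ℓ' + V / a₀ ^ 2 + q with hC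
  have hCpos : 0 < C := by positivity
  refine ⟨C, hCpos, fun a b s v haa hab hℓ hs hv => ?_⟩
  have ha : 0 < a := ha₀.trans_le haa
  have hb : 0 < b := ha.trans_le hab
  have hspos : 0 < s := hm.trans_le hs
  have hv0 : 0 ≤ v := hCpos.le.trans hv
  set t := s - m / 2 with ht
  have hts : t ≤ s := by linarith
  have hst : s / 2 ≤ t := by linarith
  have htm : m / 2 ≤ t := by linarith
  have htpos : 0 < t := by linarith
  set ℓ := ν.real (Icc a b) with hℓdef
  have hαs : |α| ≤ s * (|α| / m) := by
    rw [← mul_div_assoc, le_div_iff₀ hm, mul_comm]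
    gcongr
  have h2s : 2 ≤ s * (2 / m) := by
    rw [← mul_div_assoc, le_div_iff₀ hm]
    linarith
  have key := le_levyDensity_of_window hν hd' hm2 htpos hr hrε
    (show ε < a by linarith [min_le_right δ (a₀ / 2)]) hab hℓ hℓ'pos hκ₀
    (fun x hx => hwin x (hx.trans (min_le_left _ _))) (D := s * C₂) (x := s * v)
    (B := s * (v + C₃)) ?_ ?_ ?_
  · have e : m / 2 + t = s := by rw [ht]; ring
    rw [e] at key
    refine le_trans ?_ key
    have hκexp : κ₀ / 2 = Real.exp (Real.log (κ₀ / 2)) := (Real.exp_log (by positivity)).symm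
    rw [hκexp, ← Real.exp_add, Real.exp_le_exp]
    have b1 : -(s * q) ≤ Real.log (κ₀ / 2) := by
      have : |Real.log (κ₀ / 2)| ≤ s * q := by
        rw [hq, ← mul_div_assoc, le_div_iff₀ hm, mul_comm]
        gcongr
      linarith [neg_abs_le (Real.log (κ₀ / 2))]
    have b2 : t * ℓ' ≤ s * ℓ' := by gcongr
    have b3 : t * ℓ ≤ s * (V / a₀ ^ 2) := by
      refine mul_le_mul hts ((hν.measureReal_Icc_le ha).trans ?_) hℓ.le hspos.le
      gcongr
    have b4 : b / r * Real.log (1 + b / (r * (t * ℓ'))) ≤ s * (C * b * Real.log (1 + C * b)) := by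
      have i1 : b / (r * (t * ℓ')) ≤ C * b := by
        calc b / (r * (t * ℓ')) ≤ b / (r * (m / 2 * ℓ')) := by gcongr
          _ = 2 / (r * m * ℓ') * b := by field_simp
          _ ≤ C * b := by gcongr; rw [hC]; linarith
      have i2 : b / r ≤ s * (C * b) := by
        calc b / r = m * (1 / (r * m) * b) := by field_simp
          _ ≤ s * (C * b) := by gcongr; rw [hC]; linarith
      have i3 : Real.log (1 + b / (r * (t * ℓ'))) ≤ Real.log (1 + C * b) :=
        Real.log_le_log (by positivity) (by linarith)
      have i4 : 0 ≤ Real.log (1 + C * b) := Real.log_nonneg (by linarith [mul_pos hCpos hb])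
      calc _ ≤ (s * (C * b)) * Real.log (1 + C * b) :=
            (mul_le_mul_of_nonneg_left i3 (by positivity)).trans
              (mul_le_mul_of_nonneg_right i2 i4)
        _ = _ := by ring
    have b5 : s * (v + C₃) / a * Real.log (1 + s * (v + C₃) / (a * (t * ℓ)))
        ≤ s * ((v + C) / a * Real.log (1 + C * (v + C) / (a * ℓ))) := by
      have hC₃C : C₃ ≤ C := by rw [hC]; linarith
      have i1 : s * (v + C₃) / (a * (t * ℓ)) ≤ C * (v + C) / (a * ℓ) := by
        calc s * (v + C₃) / (a * (t * ℓ)) ≤ s * (v + C) / (a * (s / 2 * ℓ)) := by gcongr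
          _ = 2 * (v + C) / (a * ℓ) := by field_simp
          _ ≤ C * (v + C) / (a * ℓ) := by
              have : 2 ≤ C := by rw [hC]; linarith
              gcongr
      have i3 : Real.log (1 + s * (v + C₃) / (a * (t * ℓ)))
          ≤ Real.log (1 + C * (v + C) / (a * ℓ)) :=
        Real.log_le_log (by positivity) (by linarith)
      have i4 : 0 ≤ Real.log (1 + C * (v + C) / (a * ℓ)) :=
        Real.log_nonneg (by linarith [show 0 ≤ C * (v + C) / (a * ℓ) by positivity])
      calc _ ≤ s * (v + C₃) / a * Real.log (1 + C * (v + C) / (a * ℓ)) :=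
            mul_le_mul_of_nonneg_left i3 (by positivity)
        _ ≤ s * (v + C) / a * Real.log (1 + C * (v + C) / (a * ℓ)) := by gcongr
        _ = _ := by ring
    have b6 : s * (ℓ' + V / a₀ ^ 2 + q) ≤ s * C := by
      refine mul_le_mul_of_nonneg_left ?_ hspos.le
      rw [hC]; linarith
    linarith
  · have h1 : t * L ≤ s * L := by gcongr
    have h2 : t * (V / r + V / a) ≤ s * (V / r + V / a₀) := by gcongr
    calc _ ≤ s * L + s * (2 / m) + s * (V / r + V / a₀) := by gcongr
      _ = _ := by rw [hC₂]; ring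
  · have h1 : C₃ ≤ v := by
      refine le_trans ?_ hv
      rw [hC]; linarith
    calc s * C₂ + α ≤ s * C₂ + s * (|α| / m) := by linarith [le_abs_self α]
      _ = s * C₃ := by rw [hC₃]; ring
      _ ≤ s * v := by gcongr
  · calc s * v - α + s * C₂ ≤ s * v + s * (|α| / m) + s * C₂ := by linarith [neg_abs_le α]
      _ = _ := by rw [hC₃]; ring

/-! ### Asymptotic form of the bounds -/

/-- Terms of order `l² e^{ρ l}`, `ρ < 1`, are negligible against `e^l`. -/
lemma eventually_mul_sq_mul_exp_le {K ρ ε : ℝ} (hρ : ρ < 1) (hε : 0 < ε) :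
    ∀ᶠ l : ℝ in atTop, K * l ^ 2 * Real.exp (ρ * l) ≤ ε * Real.exp l := by
  have h1 : Tendsto (fun l : ℝ => ((1 - ρ) * l) ^ 2 * Real.exp (-((1 - ρ) * l))) atTop (𝓝 0) :=
    (Real.tendsto_pow_mul_exp_neg_atTop_nhds_zero 2).comp
      (tendsto_id.const_mul_atTop (by linarith))
  have h2 := h1.const_mul (K / (1 - ρ) ^ 2)
  rw [mul_zero] at h2
  filter_upwards [h2.eventually (gt_mem_nhds hε)] with l hl
  have h3 : (1 - ρ) ≠ 0 := by linarith
  have h4 : K / (1 - ρ) ^ 2 * (((1 - ρ) * l) ^ 2 * Real.exp (-((1 - ρ) * l)))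
      = K * l ^ 2 * Real.exp (ρ * l) * Real.exp (-l) := by
    have e : Real.exp (-((1 - ρ) * l)) = Real.exp (ρ * l) * Real.exp (-l) := by
      rw [← Real.exp_add]; congr 1; ring
    rw [e]; field_simp
  rw [h4, Real.exp_neg, ← div_eq_mul_inv, div_lt_iff₀ (Real.exp_pos _)] at hl
  exact hl.le

/-- Lower bound at the level `s e^l`, when the jumps of size about `l ^ r` have intensity at least of
order `e^{-D l}`. -/
lemma eventually_exp_le_levyDensity {ν : Measure ℝ} (hν : HasExpMoments ν)
    (hd : CosDecay (ν.restrict (Ioi 0))) {m : ℝ} (hm : 0 < m) {r a₁ b₁ D ω : ℝ} (hr0 : 0 ≤ r)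
    (hr1 : r ≤ 1) (ha₁ : 0 < a₁) (hab : a₁ ≤ b₁) (hD : 0 ≤ D) (hω : 0 < ω)
    (hℓ : ∀ᶠ l : ℝ in atTop, ω * Real.exp (-(D * l)) ≤ ν.real (Icc (a₁ * l ^ r) (b₁ * l ^ r)))
    {c : ℝ} (hc : (1 + D) / a₁ < c) :
    ∀ᶠ l : ℝ in atTop, ∀ s, m ≤ s →
      Real.exp (-(c * (s * Real.exp l * l ^ (1 - r)))) ≤ levyDensity ν s (s * Real.exp l) := by
  obtain ⟨C, hC, hlow⟩ := exists_le_levyDensity hν hd hm ha₁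
  -- all relative errors are absorbed in `ε`
  obtain ⟨ε, hε, hεc⟩ : ∃ ε > 0, (1 + ε) * ((1 + ε) * (1 + D)) / a₁ + ε < c := by
    have h1 : Tendsto (fun ε : ℝ => (1 + ε) * ((1 + ε) * (1 + D)) / a₁ + ε) (𝓝[>] 0)
        (𝓝 ((1 + 0) * ((1 + 0) * (1 + D)) / a₁ + 0)) :=
      (Continuous.tendsto (by fun_prop) 0).mono_left nhdsWithin_le_nhds
    obtain ⟨ε, h2, h3⟩ := ((h1.eventually (gt_mem_nhds (by simpa using hc))).and
      self_mem_nhdsWithin).exists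
    exact ⟨ε, h3, h2⟩
  set K := 1 + C * (1 + C) / (a₁ * ω) with hK
  have hKpos : 0 < K := by positivity
  have hv := Real.tendsto_exp_atTop
  filter_upwards [hℓ, hv.eventually_ge_atTop C, hv.eventually_ge_atTop (C / ε),
    eventually_ge_atTop (1 : ℝ), eventually_ge_atTop (Real.log K / ε),
    eventually_mul_sq_mul_exp_le (K := C + (C * b₁) ^ 2) (ρ := 0) zero_lt_one hε]
    with l hl hvC hvC' hl1 hlK hlsq s hs
  set v := Real.exp l with hvdef
  have hl0 : 0 < l := by linarith
  have hlr : 1 ≤ l ^ r := Real.one_le_rpow hl1 hr0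
  have hlr' : l ^ r ≤ l := by simpa using Real.rpow_le_rpow_of_exponent_le hl1 hr1
  have hg : 1 ≤ l ^ (1 - r) := Real.one_le_rpow hl1 (by linarith)
  have hgl : l ^ (1 - r) = l / l ^ r := by rw [Real.rpow_sub hl0, Real.rpow_one]
  have hv1 : 1 ≤ v := Real.one_le_exp hl0.le
  have hspos : 0 < s := hm.trans_le hs
  set ℓ := ν.real (Icc (a₁ * l ^ r) (b₁ * l ^ r)) with hℓdef
  have hℓpos : 0 < ℓ := lt_of_lt_of_le (by positivity) hl
  have key := hlow (a₁ * l ^ r) (b₁ * l ^ r) s v (le_mul_of_one_le_right ha₁.le hlr)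
    (by gcongr) hℓpos hs hvC
  refine le_trans (Real.exp_le_exp.mpr (neg_le_neg ?_)) key
  have e1 : C ≤ ε * v := by rwa [div_le_iff₀' hε] at hvC'
  have e2 : Real.log (1 + C * (v + C) / (a₁ * l ^ r * ℓ)) ≤ (1 + ε) * (1 + D) * l := by
    have i1 : 1 + C * (v + C) / (a₁ * l ^ r * ℓ) ≤ K * Real.exp ((1 + D) * l) := by
      have j0 : v + C ≤ v * (1 + C) := by nlinarith
      have j1 : a₁ * (ω * Real.exp (-(D * l))) ≤ a₁ * l ^ r * ℓ := by
        refine mul_le_mul (le_mul_of_one_le_right ha₁.le hlr) hl (by positivity) (by positivity)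
      have j2 : C * (v + C) / (a₁ * l ^ r * ℓ)
          ≤ C * (v * (1 + C)) / (a₁ * (ω * Real.exp (-(D * l)))) := by gcongr
      have j3 : C * (v * (1 + C)) / (a₁ * (ω * Real.exp (-(D * l))))
          = C * (1 + C) / (a₁ * ω) * Real.exp ((1 + D) * l) := by
        have : Real.exp ((1 + D) * l) = v / Real.exp (-(D * l)) := by
          rw [hvdef, ← Real.exp_sub]; congr 1; ring
        rw [this]; field_simp
      have j4 : 1 ≤ Real.exp ((1 + D) * l) := Real.one_le_exp (by positivity)
      rw [hK, add_mul, one_mul]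
      linarith
    have i2 := Real.log_le_log (by positivity) i1
    rw [Real.log_mul hKpos.ne' (Real.exp_pos _).ne', Real.log_exp] at i2
    have i3 : Real.log K ≤ ε * l := by rwa [div_le_iff₀' hε] at hlK
    have i4 : 0 ≤ ε * l * D := by positivity
    nlinarith
  have e3 : (v + C) / (a₁ * l ^ r) * Real.log (1 + C * (v + C) / (a₁ * l ^ r * ℓ))
      ≤ (1 + ε) * ((1 + ε) * (1 + D)) / a₁ * (v * l ^ (1 - r)) := by
    calc _ ≤ ((1 + ε) * v) / (a₁ * l ^ r) * ((1 + ε) * (1 + D) * l) := by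
          refine mul_le_mul ?_ e2 (Real.log_nonneg ?_) (by positivity)
          · gcongr; linarith
          · have : 0 ≤ C * (v + C) / (a₁ * l ^ r * ℓ) := by positivity
            linarith
      _ = _ := by rw [hgl]; field_simp
  have e4 : C + C * (b₁ * l ^ r) * Real.log (1 + C * (b₁ * l ^ r)) ≤ ε * (v * l ^ (1 - r)) := by
    have hb₁ : 0 < b₁ := ha₁.trans_le hab
    have i1 : Real.log (1 + C * (b₁ * l ^ r)) ≤ C * (b₁ * l) := by
      refine (Real.log_le_sub_one_of_pos (by positivity)).trans ?_
      have : C * (b₁ * l ^ r) ≤ C * (b₁ * l) := by gcongr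
      linarith
    have i2 : C * (b₁ * l ^ r) * Real.log (1 + C * (b₁ * l ^ r)) ≤ C * (b₁ * l) * (C * (b₁ * l)) := by
      refine mul_le_mul (by gcongr) i1 (Real.log_nonneg ?_) (by positivity)
      have : 0 ≤ C * (b₁ * l ^ r) := by positivity
      linarith
    rw [zero_mul, Real.exp_zero, mul_one] at hlsq
    have i3 : C ≤ C * l ^ 2 := le_mul_of_one_le_right hC.le (one_le_pow₀ hl1)
    have i4 : v ≤ v * l ^ (1 - r) := le_mul_of_one_le_right (by positivity) hg
    have i5 := mul_le_mul_of_nonneg_left i4 hε.le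
    calc _ ≤ C * l ^ 2 + C * (b₁ * l) * (C * (b₁ * l)) := add_le_add i3 i2
      _ = (C + (C * b₁) ^ 2) * l ^ 2 := by ring
      _ ≤ _ := hlsq.trans i5
  have e5 : ((1 + ε) * ((1 + ε) * (1 + D)) / a₁ + ε) * (v * l ^ (1 - r)) ≤ c * (v * l ^ (1 - r)) := by
    gcongr
  calc _ ≤ s * (c * (v * l ^ (1 - r))) := by
        refine mul_le_mul_of_nonneg_left ?_ hspos.le
        linarith
    _ = _ := by ring

/-- Upper bound at the level `s e^l`, if the cumulant at `κ l ^ (1 - r)` is of smaller order than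
`e^l`. -/
lemma eventually_levyDensity_le {ν : Measure ℝ} (hν : HasExpMoments ν) (hd : CosDecay ν) {m : ℝ}
    (hm : 0 < m) {r κ c C₀ ρ η : ℝ} (hr0 : 0 ≤ r) (hr1 : r ≤ 1) (hκ : 0 ≤ κ) (hc : c < κ)
    (hρ0 : 0 ≤ ρ) (hρ : ρ < 1) (hη : 0 < η)
    (hΛ : ∀ᶠ l : ℝ in atTop, cumulant ν (κ * l ^ (1 - r)) ≤ C₀ * l ^ 2 * Real.exp (ρ * l))
    (hηρ : ∀ᶠ l : ℝ in atTop, 2 * η * (κ * l ^ (1 - r)) ≤ ρ * l) :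
    ∀ᶠ l : ℝ in atTop, ∀ s, m ≤ s →
      levyDensity ν s (s * Real.exp l) ≤ Real.exp (-(c * (s * Real.exp l * l ^ (1 - r)))) := by
  obtain ⟨C, hC, hup⟩ := exists_levyDensity_le hν hd hm hη
  set q := |Real.log C| / m with hq
  filter_upwards [hΛ, hηρ, eventually_ge_atTop (1 : ℝ),
    eventually_mul_sq_mul_exp_le (K := q + C₀ + C * κ ^ 2 / m) hρ (sub_pos.mpr hc)]
    with l hl1 hl2 hl3 hl4 s hs
  have hl0 : 0 < l := by linarith
  have hspos : 0 < s := hm.trans_le hs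
  set g := l ^ (1 - r) with hg
  have hg1 : 1 ≤ g := Real.one_le_rpow hl3 (by linarith)
  have hgl : g ≤ l := by
    simpa using Real.rpow_le_rpow_of_exponent_le hl3 (show 1 - r ≤ 1 by linarith)
  refine (hup s hs (κ * g) (by positivity) (s * Real.exp l)).trans ?_
  have hCe : C = Real.exp (Real.log C) := (Real.exp_log hC).symm
  -- the prefactor and the last term are bounded by multiples of `s`, because `s ≥ m`
  nth_rewrite 1 [hCe]
  rw [← Real.exp_add, Real.exp_le_exp]
  have h1 : 1 ≤ l ^ 2 * Real.exp (ρ * l) :=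
    one_le_mul_of_one_le_of_one_le (one_le_pow₀ hl3) (Real.one_le_exp (by positivity))
  have b1 : Real.log C ≤ s * (q * (l ^ 2 * Real.exp (ρ * l))) := by
    have i1 : |Real.log C| ≤ s * q := by
      rw [hq, ← mul_div_assoc, le_div_iff₀ hm, mul_comm]
      gcongr
    have i2 : 0 ≤ q := by positivity
    calc Real.log C ≤ s * q := (le_abs_self _).trans i1
      _ ≤ s * (q * (l ^ 2 * Real.exp (ρ * l))) := by
        gcongr
        exact le_mul_of_one_le_right i2 h1
  have b2 : s * cumulant ν (κ * g) ≤ s * (C₀ * l ^ 2 * Real.exp (ρ * l)) := by gcongr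
  have b3 : C * (κ * g) ^ 2 * Real.exp (2 * η * (κ * g))
      ≤ s * (C * κ ^ 2 / m * (l ^ 2 * Real.exp (ρ * l))) := by
    calc C * (κ * g) ^ 2 * Real.exp (2 * η * (κ * g))
        ≤ C * (κ * l) ^ 2 * Real.exp (ρ * l) := by gcongr
      _ = m * (C * κ ^ 2 / m * (l ^ 2 * Real.exp (ρ * l))) := by field_simp
      _ ≤ _ := by gcongr
  have b4 : (κ - c) * Real.exp l ≤ (κ - c) * (Real.exp l * g) := by
    refine mul_le_mul_of_nonneg_left ?_ (by linarith)
    exact le_mul_of_one_le_right (Real.exp_pos _).le hg1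
  have b5 := mul_le_mul_of_nonneg_left (hl4.trans b4) hspos.le
  linarith

/-! ### Scaling of space -/

lemma invDensity_comp_mul (φ : ℝ → ℂ) {χ : ℝ} (hχ : 0 < χ) (x : ℝ) :
    invDensity (fun z => φ (χ * z)) x = χ⁻¹ * invDensity φ (x / χ) := by
  have h : ∫ z : ℝ, Complex.exp (-(z * x : ℝ) * Complex.I) * φ (χ * z)
      = (χ⁻¹ : ℝ) • ∫ z : ℝ, Complex.exp (-(z * (x / χ) : ℝ) * Complex.I) * φ z := by
    have h1 := Measure.integral_comp_mul_left
      (fun z : ℝ => Complex.exp (-(z * (x / χ) : ℝ) * Complex.I) * φ z) χ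
    rw [abs_of_pos (inv_pos.mpr hχ)] at h1
    rw [← h1]
    refine integral_congr_ae (ae_of_all _ fun z => ?_)
    have e : χ * z * (x / χ) = z * x := by field_simp
    simp only [e]
  rw [invDensity, invDensity, fourier_two_pi_inv, fourier_two_pi_inv, h, Complex.smul_re,
    smul_eq_mul]
  ring

/-- Along `T`, `log χ` is eventually at most `θ` by the growth condition, and on the remaining segment
it is bounded while `θ ≥ m`. -/
lemma ScalingAssumptions.exists_log_le {T : Set ℝ} {θ χ : ℝ → ℝ} (h : ScalingAssumptions T θ χ)
    {m : ℝ} (hm : 0 < m) (hmT : ∀ t ∈ T, m ≤ θ t ∧ m ≤ χ t) {t₀ : ℝ} (ht₀ : 0 < t₀) :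
    ∃ K, 0 ≤ K ∧ ∀ t ∈ T, t₀ ≤ t → Real.log (χ t) ≤ K * θ t := by
  have h1 := Asymptotics.isLittleO_iff.mp h.chi_growth one_pos
  have h2 := h1.and (h.theta_tendsto.eventually_ge_atTop 1)
  rw [eventually_inf_principal, eventually_atTop] at h2
  obtain ⟨t₁, ht₁⟩ := h2
  obtain ⟨C, hC⟩ := h.bounded_on_segments t₀ (max t₀ t₁) ht₀ (le_max_left _ _)
  refine ⟨max 1 (|Real.log C| / m), by positivity, fun t ht htt => ?_⟩
  obtain ⟨hθ, hχ⟩ := hmT t ht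
  have hθ0 : 0 < θ t := by linarith
  rcases le_total t₁ t with h3 | h3
  · obtain ⟨h4, h5⟩ := ht₁ t h3 ht
    have h6 : 0 ≤ Real.log (max (Real.log (χ t)) 1) := Real.log_nonneg (le_max_right _ _)
    rw [Real.norm_eq_abs, Real.norm_eq_abs, one_mul, abs_of_nonneg h6,
      abs_of_nonneg (Real.log_nonneg h5), Real.log_le_log_iff (by positivity) hθ0] at h4
    calc Real.log (χ t) ≤ 1 * θ t := by linarith [le_max_left (Real.log (χ t)) 1]
      _ ≤ _ := by gcongr; exact le_max_left _ _
  · have h4 := (hC t ⟨ht, htt, h3.trans (le_max_right _ _)⟩).2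
    calc Real.log (χ t) ≤ Real.log C := Real.log_le_log (by linarith) h4
      _ ≤ |Real.log C| / m * m := by rw [div_mul_cancel₀ _ hm.ne']; exact le_abs_self _
      _ ≤ _ := by gcongr; exact le_max_right _ _

/-- The space scale `χ` only contributes a factor `e^{O(θ)}`, which is negligible. -/
lemma exists_forall_scaled {T : Set ℝ} {θ χ : ℝ → ℝ} (h : ScalingAssumptions T θ χ)
    {m : ℝ} (hm : 0 < m) (hmT : ∀ t ∈ T, m ≤ θ t ∧ m ≤ χ t) {t₀ : ℝ} (ht₀ : 0 < t₀)
    {q : ℝ → ℝ → ℝ} {p c : ℝ} (hp : 0 ≤ p)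
    (hlow : ∀ c' > c, ∀ᶠ l : ℝ in atTop, ∀ s, m ≤ s →
      Real.exp (-(c' * (s * Real.exp l * l ^ p))) ≤ q s (s * Real.exp l))
    (hup : ∀ c' < c, ∀ᶠ l : ℝ in atTop, ∀ s, m ≤ s →
      q s (s * Real.exp l) ≤ Real.exp (-(c' * (s * Real.exp l * l ^ p))))
    {c₁ c₂ : ℝ} (hc₁ : c < c₁) (hc₂ : c₂ < c) :
    ∃ y : ℝ, ∀ t ∈ T, t₀ ≤ t → ∀ x : ℝ, y < x / (χ t * θ t) →
      Real.exp (-c₁ * (x / χ t) * Real.log (x / (χ t * θ t)) ^ p) ≤ (χ t)⁻¹ * q (θ t) (x / χ t) ∧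
      (χ t)⁻¹ * q (θ t) (x / χ t) ≤ Real.exp (-c₂ * (x / χ t) * Real.log (x / (χ t * θ t)) ^ p) := by
  obtain ⟨K, hK0, hK⟩ := h.exists_log_le hm hmT ht₀
  -- intermediate constants leave room for the factor `(χ t)⁻¹`
  obtain ⟨d₁, hd₁, hd₁'⟩ := exists_between hc₁
  obtain ⟨d₂, hd₂, hd₂'⟩ := exists_between hc₂
  obtain ⟨l₀, hl₀⟩ := eventually_atTop.mp ((hlow d₁ hd₁).and ((hup d₂ hd₂').and
    ((eventually_ge_atTop (1 : ℝ)).and ((eventually_ge_atTop (K / (c₁ - d₁))).and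
      (eventually_ge_atTop (|Real.log m| / m / (d₂ - c₂)))))))
  refine ⟨Real.exp l₀, fun t ht htt x hx => ?_⟩
  obtain ⟨hθ, hχ⟩ := hmT t ht
  have hθ0 : 0 < θ t := by linarith
  have hχ0 : 0 < χ t := by linarith
  set l := Real.log (x / (χ t * θ t)) with hl
  have hv0 : 0 < x / (χ t * θ t) := (Real.exp_pos _).trans hx
  have hle : l₀ ≤ l := ((Real.lt_log_iff_exp_lt hv0).mpr hx).le
  obtain ⟨h1, h2, h3, h4, h5⟩ := hl₀ l hle
  have hxe : x / χ t = θ t * Real.exp l := by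
    rw [hl, Real.exp_log hv0]; field_simp
  have hinv : (χ t)⁻¹ = Real.exp (-Real.log (χ t)) := by rw [Real.exp_neg, Real.exp_log hχ0]
  have hg : l ≤ Real.exp l * l ^ p := by
    have i1 : 1 ≤ l ^ p := Real.one_le_rpow h3 hp
    have i2 := Real.add_one_le_exp l
    calc l ≤ Real.exp l := by linarith
      _ ≤ _ := le_mul_of_one_le_right (Real.exp_pos _).le i1
  rw [hxe, hinv]
  constructor
  · refine le_trans ?_ (mul_le_mul_of_nonneg_left (h1 (θ t) hθ) (Real.exp_pos _).le)
    rw [← Real.exp_add, Real.exp_le_exp]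
    rw [div_le_iff₀' (by linarith)] at h4
    have i1 : K ≤ (c₁ - d₁) * (Real.exp l * l ^ p) :=
      h4.trans (mul_le_mul_of_nonneg_left hg (by linarith))
    have i2 := mul_le_mul_of_nonneg_left i1 hθ0.le
    have i3 := hK t ht htt
    linarith
  · refine le_trans (mul_le_mul_of_nonneg_left (h2 (θ t) hθ) (Real.exp_pos _).le) ?_
    rw [← Real.exp_add, Real.exp_le_exp]
    rw [div_le_iff₀' (by linarith)] at h5
    have i1 : |Real.log m| / m ≤ (d₂ - c₂) * (Real.exp l * l ^ p) :=
      h5.trans (mul_le_mul_of_nonneg_left hg (by linarith))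
    have i2 := mul_le_mul_of_nonneg_left i1 hθ0.le
    have i3 : Real.log m ≤ Real.log (χ t) := Real.log_le_log hm hχ
    have i4 : |Real.log m| ≤ θ t * (|Real.log m| / m) := by
      rw [← mul_div_assoc, le_div_iff₀ hm, mul_comm]
      gcongr
    linarith [neg_abs_le (Real.log m)]

/-! ### The jumps of the integral near the essential supremum of the kernel -/

lemma KernelAssumptions.ae_le_essSup {f : ℝ → ℝ} (hf : KernelAssumptions f) :
    ∀ᵐ s, f s ≤ essSup f volume := by
  obtain ⟨C, hC⟩ := hf.bounded
  exact _root_.ae_le_essSup (isBoundedUnder_of ⟨C, fun s => (le_abs_self _).trans (hC s)⟩)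

lemma KernelAssumptions.essSup_pos {f : ℝ → ℝ} (hf : KernelAssumptions f) :
    0 < essSup f volume := by
  by_contra! hcon
  have h : (fun s => (max (f s) 0) ^ 2) =ᵐ[volume] fun _ => 0 := by
    filter_upwards [hf.ae_le_essSup] with s hs
    rw [max_eq_right (hs.trans hcon)]
    simp
  have h1 := hf.nondegenerate
  rw [integral_congr_ae h] at h1
  simp at h1

/-- The set where `f` is close to its essential supremum. -/
lemma KernelAssumptions.measureReal_pos {f : ℝ → ℝ} (hf : KernelAssumptions f) {F' : ℝ}
    (h0 : 0 < F') (h1 : F' < essSup f volume) :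
    0 < volume.real {s | f s ∈ Icc F' (essSup f volume)} := by
  refine ENNReal.toReal_pos (fun h => ?_) ?_
  · have h2 : ∀ᵐ s, f s ≤ F' := by
      rw [ae_iff]
      refine le_antisymm ?_ zero_le
      rw [← h]
      refine measure_mono_ae ?_
      filter_upwards [hf.ae_le_essSup] with s hs
      intro (hs' : ¬ f s ≤ F')
      exact ⟨(not_le.mp hs').le, hs⟩
    have h3 : essSup f volume ≤ F' := essSup_le_of_ae_le F' h2
      (isCoboundedUnder_le_of_le _ fun s => hf.nonneg s)
    linarith
  · refine (lt_of_le_of_lt (measure_mono fun s hs => ?_)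
      (hf.sq_integrable.measure_norm_ge_lt_top (ε := F' ^ 2) (by positivity))).ne
    simp only [Real.norm_eq_abs, abs_pow, sq_abs, mem_ofPred_eq]
    exact pow_le_pow_left₀ h0.le hs.1 2

/-- Jumps in `[u, v]` of the process at times when `f` is within `[F', F]`, `F` being the essential
supremum, give jumps in `[F' u, F v]` of the integral. -/
lemma mul_measureReal_le_kernelMeasure {μ : Measure ℝ} [SFinite μ] (hμ : HasExpMoments μ)
    {f : ℝ → ℝ} (hf : KernelAssumptions f) {F' u v : ℝ} (h0 : 0 < F') (hu : 0 < u) :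
    volume.real {s | f s ∈ Icc F' (essSup f volume)} * μ.real (Icc u v)
      ≤ (kernelMeasure μ f).real (Icc (F' * u) (essSup f volume * v)) := by
  have hfm := hf.measurable
  rw [mul_comm, measureReal_def, measureReal_def, measureReal_def, ← ENNReal.toReal_mul,
    ← Measure.prod_prod]
  refine ENNReal.toReal_mono
    ((hasExpMoments_kernelMeasure hμ hf).measure_Icc_lt_top (by positivity)).ne ?_
  rw [kernelMeasure, Measure.map_apply (by fun_prop) measurableSet_Icc]
  refine measure_mono fun p hp => ?_
  obtain ⟨⟨h1, h2⟩, h3, h4⟩ := hp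
  have h5 : 0 < p.1 := hu.trans_le h1
  have h6 : 0 < f p.2 := h0.trans_le h3
  refine ⟨?_, ?_⟩
  · show F' * u ≤ p.1 * f p.2
    rw [mul_comm]
    exact mul_le_mul h1 h3 h0.le h5.le
  · show p.1 * f p.2 ≤ essSup f volume * v
    rw [mul_comm]
    exact mul_le_mul h4 h2 h5.le (h6.le.trans h4)

/-- The cumulant of the integral is controlled by the worst value of the kernel, its essential
supremum. -/
lemma cumulant_kernelMeasure_le {μ : Measure ℝ} [SFinite μ] {f : ℝ → ℝ}
    (hf : KernelAssumptions f) {ξ : ℝ} (hξ : 0 ≤ ξ) {G : ℝ → ℝ} (hG : Integrable G μ)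
    (hle : ∀ᵐ u ∂μ, u ^ 2 * Real.exp (ξ * essSup f volume * max u 0) ≤ G u) :
    cumulant (kernelMeasure μ f) ξ ≤ ξ ^ 2 * (∫ u, G u ∂μ) * ∫ s, f s ^ 2 := by
  have hfm := hf.measurable
  set F := essSup f volume with hF
  rw [cumulant, kernelMeasure, integral_map (by fun_prop) (by fun_prop), mul_assoc,
    ← integral_prod_mul (μ := μ) (ν := volume) G (fun s => f s ^ 2), ← integral_const_mul]
  refine integral_mono_of_nonneg (ae_of_all _ fun _ => exp_sub_one_sub_nonneg _)
    ((hG.mul_prod hf.sq_integrable).const_mul _) ?_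
  have h1 : ∀ᵐ p : ℝ × ℝ ∂(μ.prod volume), f p.2 ≤ F :=
    Measure.quasiMeasurePreserving_snd.ae hf.ae_le_essSup
  have h2 : ∀ᵐ p : ℝ × ℝ ∂(μ.prod volume), p.1 ^ 2 * Real.exp (ξ * F * max p.1 0) ≤ G p.1 :=
    Measure.quasiMeasurePreserving_fst.ae hle
  filter_upwards [h1, h2] with p hp1 hp2
  have h3 : max (ξ * (p.1 * f p.2)) 0 ≤ ξ * F * max p.1 0 := by
    refine max_le ?_ (by have := hf.essSup_pos; positivity)
    calc ξ * (p.1 * f p.2) ≤ ξ * (max p.1 0 * f p.2) := by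
          gcongr
          · exact hf.nonneg _
          · exact le_max_left _ _
      _ ≤ ξ * (max p.1 0 * F) := by gcongr
      _ = _ := by ring
  calc _ ≤ (ξ * (p.1 * f p.2)) ^ 2 * Real.exp (max (ξ * (p.1 * f p.2)) 0) := exp_sub_one_sub_le _
    _ ≤ (ξ * (p.1 * f p.2)) ^ 2 * Real.exp (ξ * F * max p.1 0) := by gcongr
    _ = ξ ^ 2 * ((p.1 ^ 2 * Real.exp (ξ * F * max p.1 0)) * f p.2 ^ 2) := by ring
    _ ≤ ξ ^ 2 * (G p.1 * f p.2 ^ 2) := by gcongr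

/-! ### Truncated Lévy measures -/

/-- The infimum which defines `sigmaPlus μ` is attained. -/
lemma measure_Ioi_sigmaPlus {μ : Measure ℝ} (h : Truncated μ) : μ (Ioi (sigmaPlus μ)) = 0 := by
  have hne : {σ : ℝ | 0 < σ ∧ μ (Ioi σ) = 0}.Nonempty := by
    obtain ⟨R, hR⟩ := h
    refine ⟨max R 1, by positivity, measure_mono_null (fun u hu => ?_) hR⟩
    exact ((le_max_left _ _).trans_lt hu).trans_le (le_abs_self u)
  have hgt : ∀ n : ℕ, μ (Ioi (sigmaPlus μ + ((n : ℝ) + 1)⁻¹)) = 0 := fun n => by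
    obtain ⟨σ, hσ, hlt⟩ := exists_lt_of_csInf_lt hne
      (show sInf {σ : ℝ | 0 < σ ∧ μ (Ioi σ) = 0} < sigmaPlus μ + ((n : ℝ) + 1)⁻¹ from
        lt_add_of_pos_right _ (by positivity))
    exact measure_mono_null (Ioi_subset_Ioi hlt.le) hσ.2
  refine measure_mono_null (fun u hu => ?_) (measure_iUnion_null hgt)
  have h1 : Tendsto (fun n : ℕ => ((n : ℝ) + 1)⁻¹) atTop (𝓝 0) := by
    simpa using tendsto_one_div_add_atTop_nhds_zero_nat (𝕜 := ℝ)
  obtain ⟨n, hn⟩ := (h1.eventually (gt_mem_nhds (sub_pos.mpr hu))).exists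
  exact mem_iUnion.mpr ⟨n, by simp only [mem_Ioi]; linarith⟩

lemma sigmaPlus_pos {μ : Measure ℝ} (h : Truncated μ) (hpos : 0 < μ (Ioi 0)) :
    0 < sigmaPlus μ := by
  refine lt_of_le_of_ne (Real.sInf_nonneg fun σ hσ => hσ.1.le) fun h0 => hpos.ne' ?_
  rw [h0]
  exact measure_Ioi_sigmaPlus h

lemma measure_Icc_sigmaPlus_pos {μ : Measure ℝ} (h : Truncated μ) {σ : ℝ} (hσ0 : 0 < σ)
    (hσ : σ < sigmaPlus μ) : 0 < μ (Icc σ (sigmaPlus μ)) := by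
  refine pos_iff_ne_zero.mpr fun h0 => ?_
  have h1 : μ (Ioi σ) = 0 := by
    refine measure_mono_null (fun u hu => ?_)
      (measure_union_null h0 (measure_Ioi_sigmaPlus h))
    rcases le_or_gt u (sigmaPlus μ) with h2 | h2
    · exact Or.inl ⟨le_of_lt hu, h2⟩
    · exact Or.inr h2
  have h2 : sigmaPlus μ ≤ σ := csInf_le ⟨0, fun x hx => hx.1.le⟩ ⟨hσ0, h1⟩
  linarith

/-- Lower bound in the truncated case: jumps of almost the maximal size, at times when the kernel is
almost maximal, have positive intensity. -/
lemma eventually_exp_le_levyDensity_of_truncated {μ : Measure ℝ} [SFinite μ] (hμ : HasExpMoments μ) {f : ℝ → ℝ}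
    (hf : KernelAssumptions f) (hd : CosDecay ((kernelMeasure μ f).restrict (Ioi 0)))
    (hpos : 0 < μ (Ioi 0)) (h : Truncated μ) {m : ℝ} (hm : 0 < m) {c : ℝ}
    (hc : 1 / (sigmaPlus μ * essSup f volume) < c) :
    ∀ᶠ l : ℝ in atTop, ∀ s, m ≤ s → Real.exp (-(c * (s * Real.exp l * l ^ (1 : ℝ))))
      ≤ levyDensity (kernelMeasure μ f) s (s * Real.exp l) := by
  set F := essSup f volume with hF
  have hFpos : 0 < F := hf.essSup_pos
  set σ := sigmaPlus μ with hσ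
  have hσpos : 0 < σ := sigmaPlus_pos h hpos
  -- the jump size and the level of the kernel are taken a factor `k` below their maxima
  obtain ⟨k, ⟨hk0, hk1⟩, hkc⟩ : ∃ k ∈ Ioo (0 : ℝ) 1, 1 / (k * F * (k * σ)) < c := by
    have h1 : ContinuousAt (fun k : ℝ => 1 / (k * F * (k * σ))) 1 :=
      ContinuousAt.div (by fun_prop) (by fun_prop) (by positivity)
    have h2 := h1.tendsto.mono_left (nhdsWithin_le_nhds (s := Iio 1))
    obtain ⟨k, h3, h4⟩ := ((h2.eventually (gt_mem_nhds (by
      simpa [mul_comm F σ] using hc))).and (Ioo_mem_nhdsLT (zero_lt_one (α := ℝ)))).exists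
    exact ⟨k, h4, h3⟩
  have hkF : k * F < F := mul_lt_of_lt_one_left hFpos hk1
  have hkσ : k * σ < σ := mul_lt_of_lt_one_left hσpos hk1
  have hω := hf.measureReal_pos (mul_pos hk0 hFpos) hkF
  have hμσ : 0 < μ.real (Icc (k * σ) σ) :=
    ENNReal.toReal_pos (measure_Icc_sigmaPlus_pos h (by positivity) hkσ).ne'
      (hμ.measure_Icc_lt_top (by positivity)).ne
  have key := eventually_exp_le_levyDensity (hasExpMoments_kernelMeasure hμ hf) hd hm
    (r := 0) (a₁ := k * F * (k * σ)) (b₁ := F * σ) (D := 0)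
    (ω := volume.real {s | f s ∈ Icc (k * F) F} * μ.real (Icc (k * σ) σ))
    le_rfl zero_le_one (by positivity) (mul_le_mul hkF.le hkσ.le (by positivity) hFpos.le) le_rfl
    (by positivity) (Eventually.of_forall fun l => by
      simpa using mul_measureReal_le_kernelMeasure hμ hf (v := σ) (mul_pos hk0 hFpos)
        (mul_pos hk0 hσpos)) (c := c) (by simpa using hkc)
  simpa using key

/-- Upper bound in the truncated case: the Chernoff bound at `ξ = κ l` with `κ` slightly below the
critical constant, for which the cumulant is of order `l² e^{κ σ₊ F l}`. -/
lemma eventually_levyDensity_le_of_truncated {μ : Measure ℝ} [SFinite μ] (hμ : HasExpMoments μ) {f : ℝ → ℝ}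
    (hf : KernelAssumptions f) (hd : CosDecay (kernelMeasure μ f))
    (hpos : 0 < μ (Ioi 0)) (h : Truncated μ) {m : ℝ} (hm : 0 < m) {c : ℝ}
    (hc : c < 1 / (sigmaPlus μ * essSup f volume)) :
    ∀ᶠ l : ℝ in atTop, ∀ s, m ≤ s → levyDensity (kernelMeasure μ f) s (s * Real.exp l)
      ≤ Real.exp (-(c * (s * Real.exp l * l ^ (1 : ℝ)))) := by
  set F := essSup f volume with hF
  have hFpos : 0 < F := hf.essSup_pos
  set σ := sigmaPlus μ with hσ
  have hσpos : 0 < σ := sigmaPlus_pos h hpos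
  obtain ⟨κ, hκ, hκ'⟩ := exists_between (max_lt hc (show 0 < 1 / (σ * F) by positivity))
  obtain ⟨hκc, hκ0⟩ := max_lt_iff.mp hκ
  have hρ : κ * (σ * F) < 1 := by rwa [lt_div_iff₀ (by positivity)] at hκ'
  have hle : ∀ᵐ u ∂μ, u ≤ σ := by
    rw [ae_iff]
    simp only [not_le]
    exact measure_Ioi_sigmaPlus h
  have key := eventually_levyDensity_le (hasExpMoments_kernelMeasure hμ hf) hd hm
    (r := 0) (κ := κ) (c := c) (C₀ := κ ^ 2 * (∫ u, u ^ 2 ∂μ) * ∫ s, f s ^ 2)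
    (ρ := κ * (σ * F)) (η := σ * F / 2) le_rfl zero_le_one hκ0.le hκc (by positivity) hρ
    (by positivity) ?_ ?_
  · simpa using key
  · filter_upwards [eventually_ge_atTop (0 : ℝ)] with l hl
    rw [sub_zero, Real.rpow_one]
    refine (cumulant_kernelMeasure_le hf (by positivity)
      (hμ.integrable_sq.mul_const (Real.exp (κ * (σ * F) * l))) ?_).trans (le_of_eq ?_)
    · filter_upwards [hle] with u hu
      refine mul_le_mul_of_nonneg_left (Real.exp_le_exp.mpr ?_) (sq_nonneg u)
      calc κ * l * F * max u 0 ≤ κ * l * F * σ := by gcongr; exact max_le hu hσpos.le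
        _ = _ := by ring
    · rw [integral_mul_const]; ring
  · refine Eventually.of_forall fun l => ?_
    rw [sub_zero, Real.rpow_one]
    exact le_of_eq (by ring)

/-! ### Exponentially damped Lévy measures -/

lemma eventually_eval_le_exp (Q : Polynomial ℝ) {δ : ℝ} (hδ : 0 < δ) :
    ∀ᶠ u : ℝ in atTop, Q.eval u ≤ Real.exp (δ * u) := by
  have h1 := (Q.comp (Polynomial.C δ⁻¹ * Polynomial.X)).tendsto_div_exp_atTop.comp
    (tendsto_id.const_mul_atTop hδ)
  filter_upwards [h1.eventually (gt_mem_nhds zero_lt_one)] with u hu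
  have e : δ⁻¹ * (δ * u) = u := by field_simp
  simp only [Function.comp_apply, Polynomial.eval_comp, Polynomial.eval_mul, Polynomial.eval_C,
    Polynomial.eval_X, id, e] at hu
  rw [div_lt_one (Real.exp_pos _)] at hu
  exact hu.le

lemma le_rpow_of_one_le {u β : ℝ} (hu : 1 ≤ u) (hβ : 1 ≤ β) : u ≤ u ^ β := by
  simpa using Real.rpow_le_rpow_of_exponent_le hu hβ

/-- The mass of `[W, 2W]` is of the order `e^{-b W^β}` on the exponential scale. -/
lemma ExponentiallyDamped.eventually_le_measureReal_Icc {μ : Measure ℝ} (hμ : HasExpMoments μ)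
    {b β : ℝ} (h : ExponentiallyDamped μ b β) {b' : ℝ} (hb' : b < b') :
    ∀ᶠ W : ℝ in atTop, Real.exp (-(b' * W ^ β)) ≤ μ.real (Icc W (2 * W)) := by
  obtain ⟨hb, hβ, Q, hQ⟩ := h
  set δ := min ((b' - b) / 2) (b / 4) with hδ
  have hδ0 : 0 < δ := lt_min (by linarith) (by linarith)
  have hδ1 : b + 2 * δ ≤ b' := by linarith [min_le_left ((b' - b) / 2) (b / 4)]
  have hδ2 : 4 * δ ≤ b := by linarith [min_le_right ((b' - b) / 2) (b / 4)]
  have h2 : Tendsto (fun W : ℝ => 2 * W) atTop atTop := tendsto_id.const_mul_atTop (by norm_num)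
  filter_upwards [hQ, h2.eventually hQ, eventually_eval_le_exp Q hδ0,
    h2.eventually (eventually_eval_le_exp Q hδ0), eventually_ge_atTop (1 : ℝ),
    eventually_ge_atTop (1 / δ)] with W hW hW2 hQ1 hQ2 hW1 hWδ
  have hWpos : 0 < W := by linarith
  have hU := le_rpow_of_one_le hW1 hβ.le
  set U := W ^ β with hUdef
  have hU2 : 2 * U ≤ (2 * W) ^ β := by
    rw [Real.mul_rpow (by norm_num) hWpos.le]
    gcongr
    exact le_rpow_of_one_le (by norm_num) hβ.le
  have hfin := (hμ.measure_Ici_lt_top hWpos).ne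
  have hfin2 := (hμ.measure_Ici_lt_top (show 0 < 2 * W by linarith)).ne
  have l1 : Real.exp (-((b + δ) * U)) ≤ μ.real (Ici W) := by
    have i1 := (ENNReal.ofReal_le_iff_le_toReal hfin).mp hW.2.1
    refine le_trans ?_ i1
    have i2 : Real.exp (-(δ * U)) ≤ 1 / Q.eval W := by
      rw [Real.exp_neg, ← one_div]
      refine one_div_le_one_div_of_le hW.1 (hQ1.trans ?_)
      gcongr
    calc Real.exp (-((b + δ) * U)) = Real.exp (-(δ * U)) * Real.exp (-b * U) := by
          rw [← Real.exp_add]; congr 1; ring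
      _ ≤ _ := by gcongr
  have l2 : μ.real (Ici (2 * W)) ≤ Real.exp (-((2 * b - 2 * δ) * U)) := by
    refine (ENNReal.toReal_le_of_le_ofReal (by have := hW2.1; positivity) hW2.2.2).trans ?_
    calc Q.eval (2 * W) * Real.exp (-b * (2 * W) ^ β)
        ≤ Real.exp (δ * (2 * W)) * Real.exp (-b * (2 * U)) := by
          refine mul_le_mul hQ2 (Real.exp_le_exp.mpr ?_) (Real.exp_pos _).le (Real.exp_pos _).le
          rw [neg_mul, neg_mul]
          gcongr
      _ = Real.exp (δ * (2 * W) + -b * (2 * U)) := by rw [← Real.exp_add]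
      _ ≤ _ := by
          refine Real.exp_le_exp.mpr ?_
          have := mul_le_mul_of_nonneg_left hU hδ0.le
          linarith
  have l3 : μ.real (Ici W) ≤ μ.real (Icc W (2 * W)) + μ.real (Ici (2 * W)) := by
    have hsub : Ici W ⊆ Icc W (2 * W) ∪ Ici (2 * W) := fun u hu => by
      rcases le_total u (2 * W) with h | h
      · exact Or.inl ⟨hu, h⟩
      · exact Or.inr h
    refine (measureReal_mono hsub ?_).trans (measureReal_union_le _ _)
    exact ((measure_union_le _ _).trans_lt (ENNReal.add_lt_top.mpr
      ⟨hμ.measure_Icc_lt_top hWpos, hfin2.lt_top⟩)).ne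
  have hδU : 1 ≤ δ * U := by
    rw [div_le_iff₀' hδ0] at hWδ
    exact hWδ.trans (mul_le_mul_of_nonneg_left hU hδ0.le)
  have l4 : 2 * Real.exp (-((b + 2 * δ) * U)) ≤ Real.exp (-((b + δ) * U)) := by
    have i1 : Real.exp (-((b + δ) * U)) = Real.exp (δ * U) * Real.exp (-((b + 2 * δ) * U)) := by
      rw [← Real.exp_add]; congr 1; ring
    rw [i1]
    gcongr
    linarith [Real.add_one_le_exp (δ * U)]
  have hUpos : 0 ≤ U := by positivity
  have l5 : Real.exp (-((2 * b - 2 * δ) * U)) ≤ Real.exp (-((b + 2 * δ) * U)) :=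
    Real.exp_le_exp.mpr (neg_le_neg (mul_le_mul_of_nonneg_right (by linarith) hUpos))
  have l6 : Real.exp (-(b' * U)) ≤ Real.exp (-((b + 2 * δ) * U)) :=
    Real.exp_le_exp.mpr (neg_le_neg (mul_le_mul_of_nonneg_right hδ1 hUpos))
  linarith

/-- Exponential damping with parameter `b` gives finite moments `∫ u² e^{b' u₊^β} μ(du)` for
`b' < b`. -/
lemma ExponentiallyDamped.integrable_sq_mul_exp {μ : Measure ℝ} (hμ : HasExpMoments μ)
    {b β : ℝ} (h : ExponentiallyDamped μ b β) {b' : ℝ} (hb0 : 0 ≤ b') (hb' : b' < b) :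
    Integrable (fun u => u ^ 2 * Real.exp (b' * max u 0 ^ β)) μ := by
  obtain ⟨hb, hβ, Q, hQ⟩ := h
  set δ := (b - b') / 4 with hδ
  have hδ0 : 0 < δ := by rw [hδ]; linarith
  have hratio : Tendsto (fun u : ℝ => b' * (1 + u⁻¹) ^ β) atTop (𝓝 (b' * (1 + 0) ^ β)) :=
    ((tendsto_const_nhds.add tendsto_inv_atTop_zero).rpow_const (Or.inl (by norm_num))).const_mul b'
  rw [add_zero, Real.one_rpow, mul_one] at hratio
  obtain ⟨R, hR⟩ := eventually_atTop.mp (hQ.and ((eventually_eval_le_exp Q hδ0).and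
    ((eventually_eval_le_exp ((Polynomial.X + 1) ^ 2) hδ0).and
    ((hratio.eventually (gt_mem_nhds (show b' < b' + δ by linarith))).and
      (eventually_ge_atTop (1 : ℝ))))))
  have hcont : Measurable fun u : ℝ => u ^ 2 * Real.exp (b' * max u 0 ^ β) := by fun_prop
  rw [← integrableOn_univ, ← Iio_union_Ici (a := R)]
  refine IntegrableOn.union ?_ ?_
  · refine ((hμ.integrable_sq.mul_const (Real.exp (b' * max R 0 ^ β))).integrableOn).mono'
      hcont.aestronglyMeasurable ((ae_restrict_iff' measurableSet_Iio).mpr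
        (ae_of_all _ fun u hu => ?_))
    rw [Real.norm_eq_abs, abs_of_nonneg (by positivity)]
    have : u ≤ R := le_of_lt hu
    gcongr
  · refine ⟨hcont.aestronglyMeasurable, ?_⟩
    rw [hasFiniteIntegral_iff_ofReal (ae_of_all _ fun u => by positivity)]
    have hcover : Ici R ⊆ ⋃ n : ℕ, Ico (R + n) (R + n + 1) := fun u hu => by
      have h0 : 0 ≤ u - R := sub_nonneg.mpr hu
      refine mem_iUnion.mpr ⟨⌊u - R⌋₊, ?_, ?_⟩
      · linarith [Nat.floor_le h0]
      · linarith [Nat.lt_floor_add_one (u - R)]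
    have hterm : ∀ n : ℕ, ∫⁻ u in Ico (R + n) (R + n + 1),
        ENNReal.ofReal (u ^ 2 * Real.exp (b' * max u 0 ^ β)) ∂μ
          ≤ ENNReal.ofReal (Real.exp (-(δ * n))) := by
      intro n
      set w := R + n with hw
      obtain ⟨⟨hQ1, -, hQ3⟩, hQ4, hQ5, hQ6, hw1⟩ := hR w (by linarith [Nat.cast_nonneg (α := ℝ) n])
      simp only [Polynomial.eval_pow, Polynomial.eval_add, Polynomial.eval_X,
        Polynomial.eval_one] at hQ5
      have hw0 : 0 < w := by linarith
      set U := w ^ β with hU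
      have hwU : w ≤ U := le_rpow_of_one_le hw1 hβ.le
      have hnext : b' * (w + 1) ^ β ≤ (b' + δ) * U := by
        have e : w + 1 = w * (1 + w⁻¹) := by field_simp
        rw [e, Real.mul_rpow hw0.le (by positivity), hU]
        have := mul_le_mul_of_nonneg_right hQ6.le (show 0 ≤ w ^ β by positivity)
        linarith
      calc ∫⁻ u in Ico w (w + 1), ENNReal.ofReal (u ^ 2 * Real.exp (b' * max u 0 ^ β)) ∂μ
          ≤ ∫⁻ u in Ico w (w + 1), ENNReal.ofReal ((w + 1) ^ 2 * Real.exp ((b' + δ) * U)) ∂μ := by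
            refine setLIntegral_mono' measurableSet_Ico fun u hu => ENNReal.ofReal_le_ofReal ?_
            have hu0 : 0 ≤ u := hw0.le.trans hu.1
            rw [max_eq_left hu0]
            refine mul_le_mul (pow_le_pow_left₀ hu0 hu.2.le 2) (Real.exp_le_exp.mpr
              (le_trans ?_ hnext)) (Real.exp_pos _).le (by positivity)
            have := hu.2.le
            gcongr
        _ = ENNReal.ofReal ((w + 1) ^ 2 * Real.exp ((b' + δ) * U)) * μ (Ico w (w + 1)) :=
            setLIntegral_const _ _
        _ ≤ ENNReal.ofReal ((w + 1) ^ 2 * Real.exp ((b' + δ) * U))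
              * ENNReal.ofReal (Q.eval w * Real.exp (-b * U)) := by
            gcongr
            exact (measure_mono Ico_subset_Ici_self).trans hQ3
        _ = ENNReal.ofReal (((w + 1) ^ 2 * Real.exp ((b' + δ) * U))
              * (Q.eval w * Real.exp (-b * U))) := (ENNReal.ofReal_mul (by positivity)).symm
        _ ≤ ENNReal.ofReal (Real.exp (-(δ * n))) := by
            refine ENNReal.ofReal_le_ofReal ?_
            calc _ ≤ (Real.exp (δ * w) * Real.exp ((b' + δ) * U))
                  * (Real.exp (δ * w) * Real.exp (-b * U)) := by gcongr
              _ = Real.exp (2 * δ * w - 3 * δ * U) := by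
                  rw [← Real.exp_add, ← Real.exp_add, ← Real.exp_add]
                  congr 1
                  rw [hδ]; ring
              _ ≤ _ := by
                  refine Real.exp_le_exp.mpr ?_
                  have i1 := mul_le_mul_of_nonneg_left hwU hδ0.le
                  have i2 : (n : ℝ) ≤ w := by
                    have hR1 := (hR R le_rfl).2.2.2.2
                    linarith
                  have i3 := mul_le_mul_of_nonneg_left i2 hδ0.le
                  linarith
    have hsum : Summable fun n : ℕ => Real.exp (-(δ * n)) := by
      have e : (fun n : ℕ => Real.exp (-(δ * n))) = fun n : ℕ => Real.exp (-δ) ^ n := by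
        funext n
        rw [← Real.exp_nat_mul]; congr 1; ring
      rw [e]
      exact summable_geometric_of_lt_one (Real.exp_pos _).le 
        ((Real.exp_lt_exp.mpr (neg_lt_zero.mpr hδ0)).trans_eq Real.exp_zero)
    calc _ ≤ ∫⁻ u in ⋃ n : ℕ, Ico (R + n) (R + n + 1),
          ENNReal.ofReal (u ^ 2 * Real.exp (b' * max u 0 ^ β)) ∂μ := lintegral_mono_set hcover
      _ ≤ ∑' n : ℕ, ENNReal.ofReal (Real.exp (-(δ * n))) :=
          (lintegral_iUnion_le _ _).trans (ENNReal.tsum_le_tsum hterm)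
      _ < ⊤ := hsum.tsum_ofReal_lt_top

/-- The maximum of `x ↦ x - x ^ β` on the positive half-line. -/
noncomputable def dampedMax (β : ℝ) : ℝ := β ^ (-1 / (β - 1)) - β ^ (-β / (β - 1))

lemma dampedMax_eq {β : ℝ} (hβ : 1 < β) : dampedMax β = (β - 1) * β ^ (-β / (β - 1)) := by
  have h0 : 0 < β := by linarith
  have h1 : β - 1 ≠ 0 := by linarith
  have e : (-1 : ℝ) / (β - 1) = 1 + -β / (β - 1) := by field_simp; ring
  rw [dampedMax, e, Real.rpow_add h0, Real.rpow_one]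
  ring

lemma dampedMax_pos {β : ℝ} (hβ : 1 < β) : 0 < dampedMax β := by
  rw [dampedMax_eq hβ]
  have h1 : 0 < β - 1 := by linarith
  have h0 : 0 < β := by linarith
  positivity

lemma sub_rpow_le_dampedMax {β w : ℝ} (hβ : 1 < β) (hw : 0 ≤ w) : w - w ^ β ≤ dampedMax β := by
  have h0 : 0 < β := by linarith
  have h1 : β - 1 ≠ 0 := by linarith
  set x₀ := β ^ (-1 / (β - 1)) with hx₀
  have hx₀pos : 0 < x₀ := by positivity
  have e1 : x₀ ^ β = β ^ (-β / (β - 1)) := by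
    rw [hx₀, ← Real.rpow_mul h0.le]; congr 1; ring
  have e2 : x₀ = β * x₀ ^ β := by
    rw [e1, hx₀]
    have e : (-1 : ℝ) / (β - 1) = 1 + -β / (β - 1) := by field_simp; ring
    rw [e, Real.rpow_add h0, Real.rpow_one]
  -- Bernoulli's inequality: the graph of `x ^ β` lies above its tangent at `x₀`
  have h2 := one_add_mul_self_le_rpow_one_add (s := w / x₀ - 1)
    (by linarith [div_nonneg hw hx₀pos.le]) hβ.le
  rw [add_sub_cancel, Real.div_rpow hw hx₀pos.le, le_div_iff₀ (by positivity)] at h2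
  have h3 : (1 + β * (w / x₀ - 1)) * x₀ ^ β = x₀ ^ β + w - x₀ := by
    have h4 : β * (w / x₀ - 1) * x₀ ^ β = (w / x₀ - 1) * (β * x₀ ^ β) := by ring
    rw [add_mul, one_mul, h4, ← e2, sub_mul, div_mul_cancel₀ _ hx₀pos.ne', one_mul]
    ring
  rw [h3] at h2
  rw [dampedMax, ← e1, ← hx₀]
  linarith

/-- Young's inequality with the optimal constant in the form needed for the damped case. -/
lemma mul_le_young {β A b u : ℝ} (hβ : 1 < β) (hA : 0 < A) (hb : 0 < b) (hu : 0 ≤ u) :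
    A * u ≤ A * (A / b) ^ (1 / (β - 1)) * dampedMax β + b * u ^ β := by
  have h1 : β - 1 ≠ 0 := by linarith
  set k := (A / b) ^ (1 / (β - 1)) with hk
  have hkpos : 0 < k := by positivity
  have e1 : b * k ^ β = A * k := by
    have e2 : k ^ (β - 1) = A / b := by
      rw [hk, ← Real.rpow_mul (by positivity), one_div_mul_cancel h1, Real.rpow_one]
    have e3 : k ^ β = k ^ (β - 1) * k := by
      rw [Real.rpow_sub_one hkpos.ne', div_mul_cancel₀ _ hkpos.ne']
    rw [e3, e2]; field_simp
  have h2 := sub_rpow_le_dampedMax hβ (show 0 ≤ u / k by positivity)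
  have h3 := mul_le_mul_of_nonneg_left h2 (show 0 ≤ A * k by positivity)
  have h4 : A * k * (u / k - (u / k) ^ β) = A * u - b * u ^ β := by
    rw [mul_sub]
    congr 1
    · field_simp
    · rw [← e1, Real.div_rpow hu hkpos.le]; field_simp
  rw [h4] at h3
  linarith

lemma dampedConst_eq (b β F : ℝ) :
    dampedConst b β F = dampedMax β ^ (-(β - 1) / β) * b ^ (1 / β) * F⁻¹ := rfl

lemma dampedConst_pos {b β F : ℝ} (hb : 0 < b) (hβ : 1 < β) (hF : 0 < F) :
    0 < dampedConst b β F := by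
  have := dampedMax_pos hβ
  rw [dampedConst_eq]
  positivity

/-- At the critical constant the exponent in Young's inequality is exactly `l` for
`ξ = dampedConst b β F * l ^ (1 - 1/β)`. -/
lemma young_dampedConst {b β F : ℝ} (hb : 0 < b) (hβ : 1 < β) (hF : 0 < F) :
    (dampedConst b β F * F) * (dampedConst b β F * F / b) ^ (1 / (β - 1)) * dampedMax β = 1 := by
  have hd := dampedMax_pos hβ
  have h1 : β - 1 ≠ 0 := by linarith
  have h0 : β ≠ 0 := by linarith
  have e1 : dampedConst b β F * F = dampedMax β ^ (-(β - 1) / β) * b ^ (1 / β) := by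
    rw [dampedConst_eq]; field_simp
  have e2 : dampedConst b β F * F / b = dampedMax β ^ (-(β - 1) / β) * b ^ (-(β - 1) / β) := by
    rw [e1, mul_div_assoc, ← Real.rpow_sub_one hb.ne']
    congr 2
    field_simp
    ring
  rw [e2, e1, Real.mul_rpow (by positivity) (by positivity), ← Real.rpow_mul hd.le,
    ← Real.rpow_mul hb.le]
  have e3 : -(β - 1) / β * (1 / (β - 1)) = -(1 / β) := by field_simp
  rw [e3]
  have e4 : dampedMax β ^ (-(β - 1) / β) * dampedMax β ^ (-(1 / β)) * dampedMax β = 1 := by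
    have : dampedMax β ^ (-(β - 1) / β) * dampedMax β ^ (-(1 / β)) = (dampedMax β)⁻¹ := by
      rw [← Real.rpow_add hd, ← Real.rpow_neg_one]
      congr 1
      field_simp
      ring
    rw [this, inv_mul_cancel₀ hd.ne']
  have e5 : b ^ (1 / β) * b ^ (-(1 / β)) = 1 := by
    rw [← Real.rpow_add hb, add_neg_cancel, Real.rpow_zero]
  calc _ = (dampedMax β ^ (-(β - 1) / β) * dampedMax β ^ (-(1 / β)) * dampedMax β)
        * (b ^ (1 / β) * b ^ (-(1 / β))) := by ring
    _ = 1 := by rw [e4, e5, one_mul]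

/-- The critical constant as the value at the optimal jump size `x₀ (log v) ^ (1 / β)`. -/
lemma dampedConst_eq_div {b β F : ℝ} (hb : 0 < b) (hβ : 1 < β) {x₀ : ℝ}
    (hx₀ : x₀ = (b * (β - 1)) ^ (-(1 / β))) :
    (1 + b * x₀ ^ β) / (F * x₀) = dampedConst b β F := by
  have h0 : 0 < β := by linarith
  have h1 : 0 < β - 1 := by linarith
  have e1 : x₀ ^ β = (b * (β - 1))⁻¹ := by
    rw [hx₀, ← Real.rpow_mul (by positivity), ← Real.rpow_neg_one]
    congr 1; field_simp
  have e2 : x₀⁻¹ = b ^ (1 / β) * (β - 1) ^ (1 / β) := by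
    rw [hx₀, ← Real.rpow_neg (by positivity), neg_neg, Real.mul_rpow hb.le h1.le]
  have e3 : dampedMax β ^ (-(β - 1) / β) = β * (β - 1)⁻¹ * (β - 1) ^ (1 / β) := by
    rw [dampedMax_eq hβ, Real.mul_rpow h1.le (by positivity), ← Real.rpow_mul h0.le]
    have i1 : -β / (β - 1) * (-(β - 1) / β) = 1 := by field_simp
    have i2 : -(β - 1) / β = 1 / β - 1 := by field_simp; ring
    rw [i1, Real.rpow_one, i2, Real.rpow_sub_one h1.ne']
    ring
  rw [dampedConst_eq, e3, e1, div_eq_mul_inv, mul_inv F, e2]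
  field_simp
  ring

/-- Lower bound in the damped case: jumps of size `W = x₀ l^{1/β}`, whose intensity is about
`e^{-b W^β} = e^{-b x₀^β l}`, at times when the kernel is almost maximal. -/
lemma eventually_exp_le_levyDensity_of_damped {μ : Measure ℝ} [SFinite μ] (hμ : HasExpMoments μ) {f : ℝ → ℝ}
    (hf : KernelAssumptions f) (hd : CosDecay ((kernelMeasure μ f).restrict (Ioi 0)))
    {b β : ℝ} (h : ExponentiallyDamped μ b β) {m : ℝ} (hm : 0 < m) {c : ℝ}
    (hc : dampedConst b β (essSup f volume) < c) :
    ∀ᶠ l : ℝ in atTop, ∀ s, m ≤ s → Real.exp (-(c * (s * Real.exp l * l ^ ((β - 1) / β))))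
      ≤ levyDensity (kernelMeasure μ f) s (s * Real.exp l) := by
  have hb : 0 < b := h.1
  have hβ : 1 < β := h.2.1
  have hβ0 : 0 < β := by linarith
  have hβ1 : 0 < β - 1 := by linarith
  set F := essSup f volume with hF
  have hFpos : 0 < F := hf.essSup_pos
  -- `x₀` minimizes `(1 + b x ^ β) / x`
  obtain ⟨x₀, hx₀⟩ : ∃ x, x = (b * (β - 1)) ^ (-(1 / β)) := ⟨_, rfl⟩
  have hx₀pos : 0 < x₀ := by rw [hx₀]; positivity
  rw [← dampedConst_eq_div hb hβ hx₀] at hc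
  obtain ⟨k, ⟨hk0, hk1⟩, hkc⟩ : ∃ k ∈ Ioo (0 : ℝ) 1, (1 + b / k * x₀ ^ β) / (k * F * x₀) < c := by
    have h1 : ContinuousAt (fun k : ℝ => (1 + b / k * x₀ ^ β) / (k * F * x₀)) 1 :=
      ContinuousAt.div (continuousAt_const.add
        ((continuousAt_const.div continuousAt_id one_ne_zero).mul continuousAt_const))
        (by fun_prop) (by positivity)
    have h2 := h1.tendsto.mono_left (nhdsWithin_le_nhds (s := Iio 1))
    obtain ⟨k, h3, h4⟩ := ((h2.eventually (gt_mem_nhds (by simpa using hc))).and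
      (Ioo_mem_nhdsLT (zero_lt_one (α := ℝ)))).exists
    exact ⟨k, h4, h3⟩
  have hkF : k * F < F := mul_lt_of_lt_one_left hFpos hk1
  have hbk : b < b / k := by rw [lt_div_iff₀ hk0]; exact mul_lt_of_lt_one_right hb hk1
  have hW : Tendsto (fun l : ℝ => x₀ * l ^ (1 / β)) atTop atTop :=
    (tendsto_rpow_atTop (by positivity)).const_mul_atTop hx₀pos
  have key := eventually_exp_le_levyDensity (hasExpMoments_kernelMeasure hμ hf) hd hm
    (r := 1 / β) (a₁ := k * F * x₀) (b₁ := F * (2 * x₀)) (D := b / k * x₀ ^ β)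
    (ω := volume.real {s | f s ∈ Icc (k * F) F}) (by positivity)
    ((div_le_one hβ0).mpr hβ.le) (by positivity)
    (mul_le_mul hkF.le (by linarith) hx₀pos.le hFpos.le) (by positivity)
    (hf.measureReal_pos (mul_pos hk0 hFpos) hkF) ?_ hkc
  · have e : 1 - 1 / β = (β - 1) / β := by field_simp
    rwa [e] at key
  · filter_upwards [hW.eventually (h.eventually_le_measureReal_Icc hμ hbk), eventually_gt_atTop 0]
      with l hl hl0
    have e : (x₀ * l ^ (1 / β)) ^ β = x₀ ^ β * l := by
      rw [Real.mul_rpow hx₀pos.le (by positivity), ← Real.rpow_mul hl0.le,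
        one_div_mul_cancel hβ0.ne', Real.rpow_one]
    rw [e, ← mul_assoc] at hl
    have h1 := mul_measureReal_le_kernelMeasure hμ hf (F' := k * F) (u := x₀ * l ^ (1 / β))
      (v := 2 * (x₀ * l ^ (1 / β))) (mul_pos hk0 hFpos) (by positivity)
    rw [← hF] at h1
    have e2 : k * F * x₀ * l ^ (1 / β) = k * F * (x₀ * l ^ (1 / β)) := by ring
    have e3 : F * (2 * x₀) * l ^ (1 / β) = F * (2 * (x₀ * l ^ (1 / β))) := by ring
    rw [e2, e3]
    exact (mul_le_mul_of_nonneg_left hl measureReal_nonneg).trans h1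

/-- Upper bound in the damped case: the Chernoff bound at `ξ = κ l^{1 - 1/β}` with `κ` slightly below
the critical constant. By Young's inequality the cumulant is of order `l² e^{ρ l}` for some `ρ < 1`. -/
lemma eventually_levyDensity_le_of_damped {μ : Measure ℝ} [SFinite μ] (hμ : HasExpMoments μ) {f : ℝ → ℝ}
    (hf : KernelAssumptions f) (hd : CosDecay (kernelMeasure μ f))
    {b β : ℝ} (h : ExponentiallyDamped μ b β) {m : ℝ} (hm : 0 < m) {c : ℝ}
    (hc : c < dampedConst b β (essSup f volume)) :
    ∀ᶠ l : ℝ in atTop, ∀ s, m ≤ s → levyDensity (kernelMeasure μ f) s (s * Real.exp l)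
      ≤ Real.exp (-(c * (s * Real.exp l * l ^ ((β - 1) / β)))) := by
  have hb : 0 < b := h.1
  have hβ : 1 < β := h.2.1
  have hβ0 : 0 < β := by linarith
  have hβ1 : 0 < β - 1 := by linarith
  have hd0 := dampedMax_pos hβ
  set F := essSup f volume with hF
  have hFpos : 0 < F := hf.essSup_pos
  obtain ⟨κ, hκ, hκ'⟩ := exists_between (max_lt hc (dampedConst_pos hb hβ hFpos))
  obtain ⟨hκc, hκ0⟩ := max_lt_iff.mp hκ
  -- the damping parameter may be decreased a little
  obtain ⟨b', ⟨hb'0, hb'⟩, hρ⟩ : ∃ b' ∈ Ioo 0 b,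
      κ * F * (κ * F / b') ^ (1 / (β - 1)) * dampedMax β < 1 := by
    have h1 : ContinuousAt (fun b' : ℝ => κ * F * (κ * F / b') ^ (1 / (β - 1)) * dampedMax β) b :=
      (continuousAt_const.mul ((continuousAt_const.div continuousAt_id hb.ne').rpow_const
        (Or.inr (by positivity)))).mul continuousAt_const
    have h2 : κ * F * (κ * F / b) ^ (1 / (β - 1)) * dampedMax β < 1 := by
      refine lt_of_lt_of_eq ?_ (young_dampedConst hb hβ hFpos)
      have i1 : κ * F < dampedConst b β F * F := mul_lt_mul_of_pos_right hκ' hFpos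
      refine mul_lt_mul_of_pos_right (mul_lt_mul i1 (Real.rpow_le_rpow (by positivity)
        (div_le_div_of_nonneg_right i1.le hb.le) (by positivity)) (by positivity)
        ((by positivity : 0 ≤ κ * F).trans i1.le)) hd0
    have h3 := h1.tendsto.mono_left (nhdsWithin_le_nhds (s := Iio b))
    obtain ⟨b', h4, h5⟩ := ((h3.eventually (gt_mem_nhds h2)).and (Ioo_mem_nhdsLT hb)).exists
    exact ⟨b', h5, h4⟩
  set ρ := κ * F * (κ * F / b') ^ (1 / (β - 1)) * dampedMax β with hρdef
  have hρ0 : 0 < ρ := by positivity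
  have hint := h.integrable_sq_mul_exp hμ hb'0.le hb'
  have hr1 : 1 / β ≤ 1 := (div_le_one hβ0).mpr hβ.le
  have key := eventually_levyDensity_le (hasExpMoments_kernelMeasure hμ hf) hd hm
    (r := 1 / β) (κ := κ) (c := c)
    (C₀ := κ ^ 2 * (∫ u, u ^ 2 * Real.exp (b' * max u 0 ^ β) ∂μ) * ∫ s, f s ^ 2)
    (ρ := ρ) (η := 1) (by positivity) hr1 hκ0.le hκc hρ0.le hρ one_pos ?_ ?_
  · have e : 1 - 1 / β = (β - 1) / β := by field_simp
    rwa [e] at key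
  · filter_upwards [eventually_ge_atTop (1 : ℝ)] with l hl
    have hl0 : 0 < l := by linarith
    set g := l ^ (1 - 1 / β) with hg
    have hg0 : 0 < g := by positivity
    have hgl : g ≤ l := by
      have : 0 ≤ 1 / β := by positivity
      exact (Real.rpow_le_rpow_of_exponent_le hl (show 1 - 1 / β ≤ 1 by linarith)).trans_eq
        (Real.rpow_one l)
    have hgg : g * g ^ (1 / (β - 1)) = l := by
      rw [hg, ← Real.rpow_mul hl0.le, ← Real.rpow_add hl0]
      have e : 1 - 1 / β + (1 - 1 / β) * (1 / (β - 1)) = 1 := by field_simp; ring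
      rw [e, Real.rpow_one]
    refine (cumulant_kernelMeasure_le hf (by positivity) (hint.const_mul (Real.exp (ρ * l)))
      (ae_of_all _ fun u => ?_)).trans ?_
    · have hy := mul_le_young hβ (A := κ * g * F) (b := b') (by positivity) hb'0
        (le_max_right u 0)
      have e : κ * g * F * (κ * g * F / b') ^ (1 / (β - 1)) * dampedMax β = ρ * l := by
        have e1 : κ * g * F / b' = κ * F / b' * g := by ring
        rw [e1, Real.mul_rpow (by positivity) hg0.le, hρdef]
        conv_rhs => rw [← hgg]
        ring
      rw [e] at hy
      calc u ^ 2 * Real.exp (κ * g * F * max u 0)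
          ≤ u ^ 2 * Real.exp (ρ * l + b' * max u 0 ^ β) := by gcongr
        _ = _ := by rw [Real.exp_add]; ring
    · rw [integral_const_mul]
      have i1 : 0 ≤ ∫ u, u ^ 2 * Real.exp (b' * max u 0 ^ β) ∂μ :=
        integral_nonneg fun u => by positivity
      have i2 : 0 ≤ ∫ s, f s ^ 2 := integral_nonneg fun s => sq_nonneg _
      calc _ ≤ (κ * l) ^ 2 * (Real.exp (ρ * l) * ∫ u, u ^ 2 * Real.exp (b' * max u 0 ^ β) ∂μ)
            * ∫ s, f s ^ 2 := by gcongr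
        _ = _ := by ring
  · filter_upwards [eventually_gt_atTop (0 : ℝ),
      (tendsto_rpow_atTop (show 0 < 1 / β by positivity)).eventually_ge_atTop (2 * κ / ρ)]
      with l hl0 hl
    rw [div_le_iff₀' hρ0] at hl
    have e : l = l ^ (1 / β) * l ^ (1 - 1 / β) := by
      rw [← Real.rpow_add hl0]; simp
    calc 2 * 1 * (κ * l ^ (1 - 1 / β)) = 2 * κ * l ^ (1 - 1 / β) := by ring
      _ ≤ ρ * l ^ (1 / β) * l ^ (1 - 1 / β) := by gcongr
      _ = ρ * l := by nth_rewrite 3 [e]; ring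

end LevyDensity

open LevyDensity

theorem theorem5p1 {Ω : Type*} [MeasurableSpace Ω] (P : Measure Ω) [IsProbabilityMeasure P]
    (μ : Measure ℝ) (hμ : IsLevyMeasure μ) (hμ_exp : ExpIntegrable μ) (hμ_pos : 0 < μ (Ioi 0))
    (I : Set ℝ) (hI : I.OrdConnected) (Z : I → Ω → ℝ) (hZ : IsLevyProcess P μ I Z)
    (f : ℝ → ℝ) (hf : KernelAssumptions f) (hreg : RegularityAssumptions μ f)
    (T : Set ℝ) (θ χ : ℝ → ℝ) (hscale : ScalingAssumptions T θ χ)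
    (hsupp : ∀ t ∈ T, ∀ s, s ∉ I → f (s / θ t) = 0)
    (Y : ℝ → Ω → ℝ)
    (hY : ∀ t ∈ T, IsLevyIntegral P I Z (fun s => χ t * f (s / θ t)) (Y t)) :
    ∃ p : ℝ → ℝ → ℝ,
      (∀ t ∈ T, IsSmoothDensity (P.map (Y t)) (p t)) ∧
      (Truncated μ →
        ∀ t₀ : ℝ, 0 < t₀ → ∀ c₁ c₂ : ℝ,
          1 / (sigmaPlus μ * essSup f volume) < c₁ →
          c₂ < 1 / (sigmaPlus μ * essSup f volume) →
          ∃ y : ℝ, ∀ t ∈ T, t₀ ≤ t → ∀ x : ℝ, y < x / (χ t * θ t) →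
            Real.exp (-c₁ * (x / χ t) * Real.log (x / (χ t * θ t))) ≤ p t x ∧
            p t x ≤ Real.exp (-c₂ * (x / χ t) * Real.log (x / (χ t * θ t)))) ∧
      (∀ b β : ℝ, ExponentiallyDamped μ b β →
        ∀ t₀ : ℝ, 0 < t₀ → ∀ c₁ c₂ : ℝ,
          dampedConst b β (essSup f volume) < c₁ →
          c₂ < dampedConst b β (essSup f volume) →
          ∃ y : ℝ, ∀ t ∈ T, t₀ ≤ t → ∀ x : ℝ, y < x / (χ t * θ t) →
            Real.exp (-c₁ * (x / χ t) * Real.log (x / (χ t * θ t)) ^ ((β - 1) / β)) ≤ p t x ∧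
            p t x ≤
              Real.exp (-c₂ * (x / χ t) * Real.log (x / (χ t * θ t)) ^ ((β - 1) / β))) := by
  have hσ := hμ.sigmaFinite
  have hE := hμ.hasExpMoments hμ_exp
  have hEν := hasExpMoments_kernelMeasure hE hf
  have hd := cosDecay_of_regularity hE hf hreg
  have hd' : CosDecay (kernelMeasure μ f) := hd.mono Measure.restrict_le_self hEν.integrable_sq
  obtain ⟨m, hm, hmT⟩ := hscale.away_from_zero
  have hchar : ∀ t ∈ T, charFun (P.map (Y t))
      = fun z => Complex.exp (θ t * levyExponent (kernelMeasure μ f) (χ t * z)) := fun t ht =>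
    funext fun z => charFun_scaledIntegral hE hI hZ hf (hm.trans_le (hmT t ht).1) (hsupp t ht)
      (hY t ht) z
  have hp : ∀ t ∈ T, ∀ x, invDensity (charFun (P.map (Y t))) x
      = (χ t)⁻¹ * levyDensity (kernelMeasure μ f) (θ t) (x / χ t) := fun t ht x => by
    rw [hchar t ht]
    exact invDensity_comp_mul (fun z => Complex.exp (θ t * levyExponent (kernelMeasure μ f) z))
      (hm.trans_le (hmT t ht).2) x
  refine ⟨fun t => invDensity (charFun (P.map (Y t))), fun t ht => ?_, ?_, ?_⟩
  · have hprob : IsProbabilityMeasure (P.map (Y t)) :=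
      Measure.isProbabilityMeasure_map (hY t ht).1
    refine isSmoothDensity_invDensity fun k => ?_
    have hχ : χ t ≠ 0 := (hm.trans_le (hmT t ht).2).ne'
    have h1 := ((hd'.integrable_pow_mul_norm hEν.integrable_sq
      (hm.trans_le (hmT t ht).1) k).comp_mul_left' hχ).const_mul (|χ t| ^ k)⁻¹
    rw [hchar t ht]
    refine h1.congr (ae_of_all _ fun z => ?_)
    have : |χ t| ^ k ≠ 0 := pow_ne_zero _ (abs_ne_zero.mpr hχ)
    simp only [abs_mul, mul_pow]
    field_simp
  · intro h t₀ ht₀ c₁ c₂ hc₁ hc₂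
    obtain ⟨y, hy⟩ := exists_forall_scaled hscale hm hmT ht₀ zero_le_one
      (fun c' hc' => eventually_exp_le_levyDensity_of_truncated hE hf hd hμ_pos h hm hc')
      (fun c' hc' => eventually_levyDensity_le_of_truncated hE hf hd' hμ_pos h hm hc') hc₁ hc₂
    refine ⟨y, fun t ht htt x hx => ?_⟩
    have := hy t ht htt x hx
    rw [← hp t ht, Real.rpow_one] at this
    exact this
  · intro b β h t₀ ht₀ c₁ c₂ hc₁ hc₂
    have hβ : 0 < β - 1 := by linarith [h.2.1]
    obtain ⟨y, hy⟩ := exists_forall_scaled hscale hm hmT ht₀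
      (show 0 ≤ (β - 1) / β from div_nonneg hβ.le (by linarith))
      (fun c' hc' => eventually_exp_le_levyDensity_of_damped hE hf hd h hm hc')
      (fun c' hc' => eventually_levyDensity_le_of_damped hE hf hd' h hm hc') hc₁ hc₂
    refine ⟨y, fun t ht htt x hx => ?_⟩
    have := hy t ht htt x hx
    rw [← hp t ht] at this
    exact this
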